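/- Proposition 3.3. Let $\mathbb{T}^2=(\mathbb{R}/2\pi\mathbb{Z})^2$ and let $\xi$ be a real-valued spatial white noise on $\mathbb{T}^2$ with zero spatial average, defined on a probability space $(\Omega,\mathbb{P})$: a random distribution such that for every real $\varphi\in C^\infty(\mathbb{T}^2)$ the variable $\langle\xi,\varphi\rangle$ is a centred Gaussian with variance $\|\varphi-\bar\varphi\|_{L^2}^2$, where $\bar\varphi=(2\pi)^{-2}\int_{\mathbb{T}^2}\varphi\,dx$. Let $\rho\in C_c^\infty(\mathbb{R}^2)$ be real-valued with $\int\rho=1$, and for $0<\varepsilon<e^{-1}$ put $\rho_\varepsilon=\varepsilon^{-2}\rho(\cdot/\varepsilon)$, $\xi_\varepsilon=\rho_\varepsilon*\xi$, let $Y_\varepsilon=\Delta^{-1}\xi_\varepsilon$ be the solution of $\Delta Y_\varepsilon=\xi_\varepsilon$ with zero average, and put $C_\varepsilon=\mathbb{E}|\nabla Y_\varepsilon|^2$ (which does not depend on $x$ by stationarity) and ${:}|\nabla Y_\varepsilon|^2{:}=|\nabla Y_\varepsilon|^2-C_\varepsilon$. Consider the linear equation $$ i\,\frac{dv_\varepsilon}{dt}=\Delta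 v_\varepsilon-2\nabla v_\varepsilon\cdot\nabla Y_\varepsilon+v_\varepsilon\,{:}|\nabla Y_\varepsilon|^2{:}\,,\qquad v_\varepsilon(0)=v_0 . \tag{1}$$ There exist a constant $c>0$ and nonnegative random variables $K_\varepsilon$, $0<\varepsilon<e^{-1}$, with $$\sup_{0<\varepsilon<e^{-1}}\mathbb{E}\,K_\varepsilon^p<\infty\qquad\text{for every } 1\le p<\infty ,$$ such that almost surely, for every $0<\varepsilon<e^{-1}$, every $v_0\in H^2(\mathbb{T}^2;\mathbb{C})$, every $T>0$ and every solution $v_\varepsilon\in C([0,T];H^2)$ of (1), with time derivative taken in $L^2$, $$\|v_\varepsilon(t)\|_{H^2}\le c\,K_\varepsilon\left(\|v_0\|_{H^2}+\|v_0\|_{L^2}\,|\ln\varepsilon|^2\right)\qquad\text{for all } t\in[0,T].$$ -/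

import Mathlib

open MeasureTheory ProbabilityTheory Filter Topology
open scoped ENNReal NNReal

namespace TorusNoise

/-! ## The torus `𝕋² = (ℝ / 2πℤ)²`

Smooth functions on the torus are `2π`-periodic functions on `ℝ²`; square integrable functions on
the torus are square integrable functions on the fundamental cell. -/

/-- The Euclidean plane. -/
abbrev Plane : Type := EuclideanSpace ℝ (Fin 2)

/-- The period lattice `2πℤ²`. -/
noncomputable def period (k : Fin 2 → ℤ) : Plane :=
  WithLp.toLp 2 (fun i => 2 * Real.pi * (k i : ℝ))

/-- The fundamental cell `(0, 2π]²`. -/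
def cell : Set Plane := {x | ∀ i, x i ∈ Set.Ioc (0 : ℝ) (2 * Real.pi)}

/-- Lebesgue measure on the torus, of total mass `(2π)²`. -/
noncomputable def torusMeasure : Measure Plane := volume.restrict cell

/-- The complex space `L²(𝕋²)`. -/
abbrev L2T : Type := Lp ℂ 2 torusMeasure

/-- `|k|²` for a frequency `k ∈ ℤ²`. -/
def freqSq (k : Fin 2 → ℤ) : ℝ := ∑ i, (k i : ℝ) ^ 2

/-- The Fourier mode `e_k(x) = exp(i k·x)`. -/
noncomputable def mode (k : Fin 2 → ℤ) (x : Plane) : ℂ :=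
  Complex.exp (Complex.I * ((∑ i, (k i : ℝ) * x i : ℝ) : ℂ))

/-- The Fourier coefficient `(2π)⁻² ∫_{𝕋²} f(x) exp(-i k·x) dx`. -/
noncomputable def coeff (f : Plane → ℂ) (k : Fin 2 → ℤ) : ℂ :=
  ((((2 * Real.pi) ^ 2)⁻¹ : ℝ) : ℂ) * ∫ x, mode (-k) x * f x ∂torusMeasure

theorem volume_cell_lt_top : volume cell < ⊤ := by
  have hb : Bornology.IsBounded cell := by
    rw [isBounded_iff_forall_norm_le]
    refine ⟨√(∑ _i : Fin 2, (2 * Real.pi) ^ 2), fun x hx => ?_⟩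
    rw [EuclideanSpace.norm_eq]
    refine Real.sqrt_le_sqrt (Finset.sum_le_sum fun i _ => ?_)
    rw [Real.norm_eq_abs, sq_abs]
    exact pow_le_pow_left₀ (hx i).1.le (hx i).2 2
  exact hb.measure_lt_top

instance : IsFiniteMeasure torusMeasure :=
  ⟨by simpa [torusMeasure] using volume_cell_lt_top⟩

theorem memLp_mode (k : Fin 2 → ℤ) : MemLp (mode k) 2 torusMeasure := by
  refine MemLp.of_bound (C := 1) ?_ (Eventually.of_forall fun x => ?_)
  · refine Continuous.aestronglyMeasurable ?_
    unfold mode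
    fun_prop
  · rw [mode, mul_comm, Complex.norm_exp_ofReal_mul_I]

/-- The Fourier mode as an element of `L²(𝕋²)`. -/
noncomputable def modeL2 (k : Fin 2 → ℤ) : L2T := (memLp_mode k).toLp

/-! ## Sobolev space `H²(𝕋²)` and weak derivatives, through Fourier series -/

/-- `f ∈ H²(𝕋²)`. -/
def MemH2 (f : L2T) : Prop :=
  Summable fun k : Fin 2 → ℤ => (1 + freqSq k) ^ 2 * ‖coeff f k‖ ^ 2

/-- The `H²(𝕋²)` norm. -/
noncomputable def h2Norm (f : L2T) : ℝ :=
  √(∑' k : Fin 2 → ℤ, (1 + freqSq k) ^ 2 * ‖coeff f k‖ ^ 2)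

/-- The weak partial derivative `∂_j f`, for `f` in `H²(𝕋²)`; the series converges in `L²(𝕋²)`. -/
noncomputable def weakPartial (j : Fin 2) (f : L2T) : L2T :=
  ∑' k : Fin 2 → ℤ, (Complex.I * (k j : ℂ) * coeff f k) • modeL2 k

/-- The weak Laplacian `Δ f`, for `f` in `H²(𝕋²)`; the series converges in `L²(𝕋²)`. -/
noncomputable def weakLaplacian (f : L2T) : L2T :=
  ∑' k : Fin 2 → ℤ, (-(freqSq k : ℂ) * coeff f k) • modeL2 k

/-- `Δ⁻¹ f` for a smooth periodic function `f` of zero average: the solution of zero average of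
`Δ Y = f`, given by its Fourier series. -/
noncomputable def invLaplacian (f : Plane → ℝ) (x : Plane) : ℝ :=
  (∑' k : Fin 2 → ℤ,
    if k = 0 then 0 else -((freqSq k : ℂ)⁻¹ * coeff (fun y => (f y : ℂ)) k * mode k x)).re

/-! ## Distributions on the torus -/

/-- Real test functions on the torus: smooth `2π`-periodic functions. -/
def TestFn : Submodule ℝ (Plane → ℝ) where
  carrier := {φ | ContDiff ℝ (⊤ : ℕ∞) φ ∧ ∀ (k : Fin 2 → ℤ) (x : Plane), φ (x + period k) = φ x}
  zero_mem' := ⟨contDiff_const, fun _ _ => rfl⟩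
  add_mem' := fun {f g} hf hg =>
    ⟨hf.1.add hg.1, fun k x => by rw [Pi.add_apply, Pi.add_apply, hf.2, hg.2]⟩
  smul_mem' := fun c f hf =>
    ⟨contDiff_const.smul hf.1, fun k x => by rw [Pi.smul_apply, Pi.smul_apply, hf.2]⟩

/-- Real distributions on the torus: linear functionals on the test functions that are continuous,
that is, bounded by a `C^N` norm. -/
structure TorusDistribution where
  toLin : TestFn →ₗ[ℝ] ℝ
  continuous_toLin : ∃ (N : ℕ) (C : ℝ), ∀ (φ : TestFn) (M : ℝ),
    (∀ n ≤ N, ∀ x : Plane, ‖iteratedFDeriv ℝ n (φ : Plane → ℝ) x‖ ≤ M) → |toLin φ| ≤ C * M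

/-- The average of a function over the torus. -/
noncomputable def average (φ : Plane → ℝ) : ℝ :=
  ((2 * Real.pi) ^ 2)⁻¹ * ∫ x, φ x ∂torusMeasure

/-- The squared `L²(𝕋²)` norm of the part of `φ` of zero average. -/
noncomputable def centeredSq (φ : Plane → ℝ) : ℝ :=
  ∫ x, (φ x - average φ) ^ 2 ∂torusMeasure

/-- `ξ` is a real spatial white noise on the torus with zero spatial average: a random distribution
such that, for every test function `φ`, the variable `⟨ξ, φ⟩` is a centred Gaussian whose variance is
the squared `L²` norm of the part of `φ` of zero average (by linearity in `φ` the whole family is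
then jointly Gaussian). -/
structure IsWhiteNoise {Ω : Type*} [MeasurableSpace Ω] (μ : Measure Ω)
    (ξ : Ω → TorusDistribution) : Prop where
  measurable : ∀ φ : TestFn, Measurable fun ω => (ξ ω).toLin φ
  law : ∀ φ : TestFn,
    μ.map (fun ω => (ξ ω).toLin φ) = gaussianReal 0 (centeredSq (φ : Plane → ℝ)).toNNReal

/-! ## Mollification -/

/-- A compactly supported smooth mollifier on `ℝ²`. -/
structure Mollifier where
  toFun : Plane → ℝ
  smooth : ContDiff ℝ (⊤ : ℕ∞) toFun
  hasCompactSupport : HasCompactSupport toFun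
  integral_eq_one : ∫ x, toFun x = 1

/-- The rescaled mollifier `ρ_ε = ε⁻² ρ(· / ε)`. -/
noncomputable def Mollifier.scaled (ρ : Mollifier) (ε : ℝ) (x : Plane) : ℝ :=
  (ε ^ 2)⁻¹ * ρ.toFun (ε⁻¹ • x)

/-- The periodization of a compactly supported function on `ℝ²`. -/
noncomputable def periodize (f : Plane → ℝ) (x : Plane) : ℝ :=
  ∑ᶠ k : Fin 2 → ℤ, f (x + period k)

theorem period_add (k l : Fin 2 → ℤ) : period (k + l) = period k + period l := by
  ext i
  simp [period, mul_add]

theorem period_neg (k : Fin 2 → ℤ) : period (-k) = -period k := by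
  ext i
  simp [period]

theorem periodize_add_period (f : Plane → ℝ) (x : Plane) (l : Fin 2 → ℤ) :
    periodize f (x + period l) = periodize f x := by
  unfold periodize
  rw [← finsum_comp_equiv (Equiv.addLeft l) (f := fun k => f (x + period k))]
  refine finsum_congr fun k => ?_
  rw [Equiv.coe_addLeft, period_add, add_assoc]

theorem finite_period_norm_le (R : ℝ) : {k : Fin 2 → ℤ | ‖period k‖ ≤ R}.Finite := by
  refine (Set.finite_Icc (fun _ : Fin 2 => -⌈R⌉) (fun _ => ⌈R⌉)).subset fun k hk => ?_
  have h : ∀ i, |(k i : ℝ)| ≤ R := by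
    intro i
    have h1 : |2 * Real.pi * (k i : ℝ)| ≤ R :=
      (PiLp.norm_apply_le (period k) i).trans hk
    rw [abs_mul, abs_of_pos (by positivity)] at h1
    have h2 : (1 : ℝ) ≤ 2 * Real.pi := by linarith [Real.pi_gt_three]
    nlinarith [abs_nonneg (k i : ℝ)]
  refine ⟨fun i => ?_, fun i => ?_⟩
  · have := (neg_le_of_abs_le (h i)).trans' (neg_le_neg (Int.le_ceil R))
    exact_mod_cast this
  · have := (le_of_abs_le (h i)).trans (Int.le_ceil R)
    exact_mod_cast this

theorem contDiff_periodize {f : Plane → ℝ} (hf : ContDiff ℝ (⊤ : ℕ∞) f) (hc : HasCompactSupport f) :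
    ContDiff ℝ (⊤ : ℕ∞) (periodize f) := by
  have key : ContMDiff (modelWithCornersSelf ℝ Plane) (modelWithCornersSelf ℝ ℝ) (⊤ : ℕ∞) fun x =>
      ∑ᶠ k : Fin 2 → ℤ, f (x + period k) := by
    refine contMDiff_finsum (fun k => ?_) ?_
    · exact (hf.comp (contDiff_id.add contDiff_const)).contMDiff
    · obtain ⟨R, hR⟩ := hc.isCompact.isBounded.exists_norm_le
      intro x
      refine ⟨Metric.ball x 1, Metric.ball_mem_nhds x one_pos, ?_⟩
      refine (finite_period_norm_le (R + ‖x‖ + 1)).subset ?_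
      rintro k ⟨y, hy, hyx⟩
      have h1 : ‖y + period k‖ ≤ R := hR _ (subset_tsupport _ hy)
      have h2 : ‖y - x‖ < 1 := by simpa [dist_eq_norm] using hyx
      have h3 : period k = (y + period k) - (y - x) - x := by abel
      have h4 := norm_sub_le ((y + period k) - (y - x)) x
      have h5 := norm_sub_le (y + period k) (y - x)
      rw [Set.mem_ofPred_eq, h3]
      linarith
  exact contMDiff_iff_contDiff.1 key

theorem Mollifier.contDiff_scaled (ρ : Mollifier) (ε : ℝ) : ContDiff ℝ (⊤ : ℕ∞) (ρ.scaled ε) :=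
  contDiff_const.mul (ρ.smooth.comp (contDiff_const_smul ε⁻¹))

theorem Mollifier.hasCompactSupport_scaled (ρ : Mollifier) (ε : ℝ) :
    HasCompactSupport (ρ.scaled ε) := by
  rcases eq_or_ne ε 0 with rfl | hε
  · have : ρ.scaled 0 = 0 := by
      funext x
      simp [Mollifier.scaled]
    rw [this]
    exact HasCompactSupport.zero
  · exact (ρ.hasCompactSupport.comp_smul (inv_ne_zero hε)).mul_left

/-- The test function `y ↦ ρ_ε(x - y)` on the torus. -/
noncomputable def kernel (ρ : Mollifier) (ε : ℝ) (x : Plane) : TestFn :=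
  ⟨fun y => periodize (ρ.scaled ε) (x - y),
    (contDiff_periodize (ρ.contDiff_scaled ε) (ρ.hasCompactSupport_scaled ε)).comp
      (contDiff_const.sub contDiff_id),
    fun k y => by
      change periodize (ρ.scaled ε) (x - (y + period k)) = periodize (ρ.scaled ε) (x - y)
      have h : x - (y + period k) = x - y + period (-k) := by rw [period_neg]; abel
      rw [h, periodize_add_period]⟩

/-- The smooth noise `ξ_ε = ρ_ε * ξ`, for a distribution `ξ`. -/
noncomputable def mollified (ρ : Mollifier) (ε : ℝ) (ξ : TorusDistribution) (x : Plane) : ℝ :=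
  ξ.toLin (kernel ρ ε x)

/-- `Y_ε = Δ⁻¹ ξ_ε`. -/
noncomputable def potential (ρ : Mollifier) (ε : ℝ) (ξ : TorusDistribution) : Plane → ℝ :=
  invLaplacian (mollified ρ ε ξ)

/-- The renormalization constant `C_ε = 𝔼 |∇Y_ε|²`; by stationarity it may be computed at the
origin. -/
noncomputable def renormConst {Ω : Type*} [MeasurableSpace Ω] (μ : Measure Ω) (ρ : Mollifier)
    (ξ : Ω → TorusDistribution) (ε : ℝ) : ℝ :=
  ∫ ω, ‖gradient (potential ρ ε (ξ ω)) 0‖ ^ 2 ∂μ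

/-! ## The linear Schrödinger equation -/

/-- `v ∈ C([0,T]; H²)` solves `i dv/dt = Δv - 2 ∇v·∇Y + v (|∇Y|² - C)` on `[0,T]`, the time
derivative being taken in `L²(𝕋²)`. -/
structure IsSolution (Y : Plane → ℝ) (C T : ℝ) (v : ℝ → L2T) : Prop where
  memH2 : ∀ t ∈ Set.Icc 0 T, MemH2 (v t)
  continuous_h2 : ∀ t ∈ Set.Icc 0 T,
    Tendsto (fun s => h2Norm (v s - v t)) (𝓝[Set.Icc 0 T] t) (𝓝 0)
  equation : ∀ t ∈ Set.Icc 0 T, ∃ w : L2T, HasDerivWithinAt v w (Set.Icc 0 T) t ∧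
    ∀ᵐ x ∂torusMeasure, Complex.I * w x =
      weakLaplacian (v t) x
        - 2 * ∑ j, weakPartial j (v t) x * ((gradient Y x j : ℝ) : ℂ)
        + v t x * ((‖gradient Y x‖ ^ 2 - C : ℝ) : ℂ)

end TorusNoise

open TorusNoise

/-! The equation conserves a weighted mass. Since `Δ - 2∇Y·∇ = exp(2Y) div(exp(-2Y) ∇)` and the
potential is real, the operator `G` on the right-hand side is symmetric in `L²(exp(-2Y) dx)`, so `∫
exp(-2Y) |v|²` is constant along solutions (`mass_eq_of_evolves`). The equation is linear and
autonomous, so differences of time translates evolve in the same way, and the mass of `∂_t v = -i G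
v` is constant too (`mass_deriv_eq`). Hence `‖v(t)‖` and `‖∂_t v(t)‖` in `L²` are controlled by
their values at time `0`, up to the factor `exp(2 sup |Y|)`.

To return to `H²` one solves the equation for `Δv`. Measured at a frequency scale `R` with `R²` a
large multiple of `∫ |∇Y|⁴ + C²`, the drift and the potential cost at most `3 (R² ‖v‖ + ‖v‖_{H²})`
(`norm_lower_le`), and `3 < 2π` allows the `H²` part to be absorbed. This gives a deterministic
bound in terms of `sup |Y|`, `∫ |∇Y|⁴` and `C` (`h2Norm_le_of_isSolution`), valid for every
realization of the noise.

Probability is needed only for the size of these three quantities. The Green function has Fourier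
coefficients `O(|m|⁻²)` in dimension two; cutting `Y_ε` into dyadic blocks, with Bernstein's
inequality and Gaussian moments on each, shows that a bound for `sup |Y_ε|` has exponential moments
uniform in `ε` (`abs_potential_le`, `lintegral_exp_rpow_le`). The variance of `∇Y_ε` is of order at
most the sum of `|m|⁻²` over `|m| ≲ 1/ε`, that is `|ln ε|`, so `C_ε` is `O(|ln ε|)` and the moments
of `∫ |∇Y_ε|⁴ / |ln ε|²` are bounded (`exists_gradGreen_variance_le`). The product `noiseBound` of
the two random factors serves as `K_ε`. -/

namespace TorusNoise

/-! ### Fourier modes on the cell, Parseval's identity and completeness. -/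

theorem measurableSet_cell : MeasurableSet cell := by
  have : cell = ⋂ i : Fin 2, (fun x : Plane => x i) ⁻¹' Set.Ioc (0 : ℝ) (2 * Real.pi) := by
    ext x; simp [cell]
  rw [this]
  exact MeasurableSet.iInter fun i => (by fun_prop : Measurable fun x : Plane => x i) measurableSet_Ioc

/-- The rescaled cell identifies the normalized torus measure with that of the unit cell. -/
theorem map_scale_unitCell :
    ((volume : Measure (Fin 2 → ℝ)).restrict {x | ∀ i, x i ∈ Set.Ioc (0 : ℝ) (0 + 1)}).map
      (fun x => (WithLp.toLp 2 ((2 * Real.pi) • x) : Plane)) =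
    ENNReal.ofReal ((2 * Real.pi) ^ 2)⁻¹ • torusMeasure := by
  have hpi : (0 : ℝ) < 2 * Real.pi := by positivity
  have hset : {x : Fin 2 → ℝ | ∀ i, x i ∈ Set.Ioc (0 : ℝ) (0 + 1)} =
      (fun x => (WithLp.toLp 2 ((2 * Real.pi) • x) : Plane)) ⁻¹' cell := by
    ext x
    simp only [Set.mem_ofPred_eq, cell, Set.mem_preimage, Set.mem_Ioc, Pi.smul_apply, smul_eq_mul,
      zero_add]
    refine forall_congr' fun i => ?_
    constructor
    · rintro ⟨h1, h2⟩; exact ⟨by positivity, by nlinarith⟩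
    · rintro ⟨h1, h2⟩; exact ⟨by by_contra h; push Not at h; nlinarith, by by_contra h; push Not at h; nlinarith⟩
  have hm : Measurable (fun x : Fin 2 → ℝ => (WithLp.toLp 2 ((2 * Real.pi) • x) : Plane)) :=
    (PiLp.volume_preserving_toLp (Fin 2)).measurable.comp (measurable_const_smul _)
  rw [hset, ← Measure.restrict_map hm measurableSet_cell, torusMeasure]
  rw [← Measure.restrict_smul]
  congr 1
  have h1 : (fun x : Fin 2 → ℝ => (WithLp.toLp 2 ((2 * Real.pi) • x) : Plane)) =
    (WithLp.toLp 2) ∘ (fun x : Fin 2 → ℝ => (2 * Real.pi) • x) := rfl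
  rw [h1, ← Measure.map_map (PiLp.volume_preserving_toLp (Fin 2)).measurable (measurable_const_smul _),
    Measure.map_addHaar_smul _ hpi.ne', Measure.map_smul, (PiLp.volume_preserving_toLp (Fin 2)).map_eq]
  simp [abs_of_pos hpi]

noncomputable local instance : MeasureSpace UnitAddCircle := ⟨AddCircle.haarAddCircle⟩

/-- The representative in the fundamental cell of a point of the unit torus, rescaled. -/
noncomputable def toCell (θ : UnitAddTorus (Fin 2)) : Plane :=
  WithLp.toLp 2 ((2 * Real.pi) • (UnitAddTorus.measurableEquivPiIoc (fun _ => 0) θ).1)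

/-- Fourier analysis is transported along this map: the unit torus with Haar measure corresponds to
the cell with Lebesgue measure normalized to mass one. -/
theorem measurePreserving_toCell :
    MeasurePreserving toCell volume (ENNReal.ofReal ((2 * Real.pi) ^ 2)⁻¹ • torusMeasure) := by
  have hm : Measurable (fun x : Fin 2 → ℝ => (WithLp.toLp 2 ((2 * Real.pi) • x) : Plane)) :=
    (PiLp.volume_preserving_toLp (Fin 2)).measurable.comp (measurable_const_smul _)
  have h0 := UnitAddTorus.measurePreserving_equivPiIoc (d := Fin 2) (fun _ => 0)
  have hS : MeasurableSet {x : Fin 2 → ℝ | ∀ i, x i ∈ Set.Ioc (0 : ℝ) (0 + 1)} :=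
    MeasurableSet.univ_pi' fun i => measurableSet_Ioc
  refine ⟨hm.comp (measurable_subtype_coe.comp h0.measurable), ?_⟩
  have : toCell = (fun x : Fin 2 → ℝ => (WithLp.toLp 2 ((2 * Real.pi) • x) : Plane)) ∘
    (Subtype.val ∘ UnitAddTorus.measurableEquivPiIoc (fun _ => 0)) := rfl
  rw [this, ← Measure.map_map hm (measurable_subtype_coe.comp h0.measurable),
    ← Measure.map_map measurable_subtype_coe h0.measurable, h0.map_eq,
    ← map_scale_unitCell]
  congr 1
  exact map_comap_subtype_coe hS volume

theorem mFourier_eq_mode (k : Fin 2 → ℤ) (θ : UnitAddTorus (Fin 2)) :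
    UnitAddTorus.mFourier k θ = mode k (toCell θ) := by
  have h : θ = fun i => (((UnitAddTorus.measurableEquivPiIoc (fun _ => 0) θ).1 i : ℝ) : UnitAddCircle) :=
    ((UnitAddTorus.measurableEquivPiIoc (fun _ => 0)).symm_apply_apply θ).symm
  conv_lhs => rw [h]
  simp only [UnitAddTorus.mFourier, ContinuousMap.coe_mk, fourier_coe_apply, ← Complex.exp_sum, mode, toCell]
  congr 1
  simp only [Fin.sum_univ_two, Pi.smul_apply, smul_eq_mul]
  push_cast
  ring

theorem integral_torus_eq {E : Type*} [NormedAddCommGroup E] [NormedSpace ℝ E] {f : Plane → E}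
    (hf : AEStronglyMeasurable f torusMeasure) :
    ∫ θ, f (toCell θ) = ((2 * Real.pi) ^ 2)⁻¹ • ∫ x, f x ∂torusMeasure := by
  have h := measurePreserving_toCell
  rw [← integral_map h.measurable.aemeasurable, h.map_eq, integral_smul_measure,
    ENNReal.toReal_ofReal (by positivity)]
  rw [h.map_eq]
  exact hf.mono_ac (Measure.smul_absolutelyContinuous)

theorem coeff_eq_mFourierCoeff {f : Plane → ℂ} (hf : AEStronglyMeasurable f torusMeasure)
    (k : Fin 2 → ℤ) :
    coeff f k = UnitAddTorus.mFourierCoeff (fun θ => f (toCell θ)) k := by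
  rw [UnitAddTorus.mFourierCoeff]
  simp_rw [mFourier_eq_mode]
  rw [integral_torus_eq (f := fun x => mode (-k) x • f x)]
  · simp [coeff, Complex.real_smul]
  · exact (memLp_mode _).1.smul hf

/-- **Parseval's identity** on the torus. -/
theorem hasSum_sq_coeff {f : Plane → ℂ} (hf : MemLp f 2 torusMeasure) :
    HasSum (fun k => ‖coeff f k‖ ^ 2) (((2 * Real.pi) ^ 2)⁻¹ * ∫ x, ‖f x‖ ^ 2 ∂torusMeasure) := by
  have h := measurePreserving_toCell
  have hF : MemLp (fun θ => f (toCell θ)) 2 volume := by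
    refine MemLp.comp_measurePreserving (ν := ENNReal.ofReal ((2 * Real.pi) ^ 2)⁻¹ • torusMeasure) ?_ h
    exact hf.smul_measure ENNReal.ofReal_ne_top
  have h1 := UnitAddTorus.hasSum_sq_mFourierCoeff hF.toLp
  have h2 : ∀ k, UnitAddTorus.mFourierCoeff hF.toLp k = coeff f k := fun k => by
    rw [coeff_eq_mFourierCoeff hf.1]
    refine integral_congr_ae ?_
    filter_upwards [hF.coeFn_toLp] with x hx
    rw [hx]
  simp_rw [h2] at h1
  convert h1 using 1
  rw [← smul_eq_mul, ← integral_torus_eq (f := fun x => ‖f x‖ ^ 2) (hf.1.norm.pow 2)]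
  refine integral_congr_ae ?_
  filter_upwards [hF.coeFn_toLp] with x hx
  rw [hx]

theorem norm_mode (k : Fin 2 → ℤ) (x : Plane) : ‖mode k x‖ = 1 := by
  rw [mode, mul_comm, Complex.norm_exp_ofReal_mul_I]

theorem mode_add (k l : Fin 2 → ℤ) (x : Plane) : mode (k + l) x = mode k x * mode l x := by
  simp only [mode, ← Complex.exp_add, Fin.sum_univ_two, Pi.add_apply]
  congr 1; push_cast; ring

theorem conj_mode (k : Fin 2 → ℤ) (x : Plane) : (starRingEnd ℂ) (mode k x) = mode (-k) x := by
  simp only [mode, ← Complex.exp_conj, Fin.sum_univ_two, Pi.neg_apply, map_mul, Complex.conj_I,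
    Complex.conj_ofReal]
  congr 1; push_cast; ring

theorem mode_zero (x : Plane) : mode 0 x = 1 := by simp [mode]

theorem continuous_mode (k : Fin 2 → ℤ) : Continuous (mode k) := by
  unfold mode; fun_prop

theorem coeFn_modeL2 (k : Fin 2 → ℤ) : modeL2 k =ᵐ[torusMeasure] mode k := (memLp_mode k).coeFn_toLp

theorem coeff_congr_ae {f g : Plane → ℂ} (h : f =ᵐ[torusMeasure] g) (k : Fin 2 → ℤ) :
    coeff f k = coeff g k := by
  rw [coeff, coeff]
  congr 1
  refine integral_congr_ae ?_
  filter_upwards [h] with x hx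
  rw [hx]

theorem inner_modeL2 (k : Fin 2 → ℤ) (f : L2T) :
    inner ℂ (modeL2 k) f = (((2 * Real.pi) ^ 2 : ℝ) : ℂ) * coeff f k := by
  rw [coeff, ← mul_assoc, ← Complex.ofReal_mul, mul_inv_cancel₀ (by positivity), Complex.ofReal_one,
    one_mul, L2.inner_def]
  refine integral_congr_ae ?_
  filter_upwards [coeFn_modeL2 k] with x hx
  rw [hx, RCLike.inner_apply, conj_mode, mul_comm]

theorem coeff_eq_inner (k : Fin 2 → ℤ) (f : L2T) :
    coeff f k = (((2 * Real.pi) ^ 2 : ℝ) : ℂ)⁻¹ * inner ℂ (modeL2 k) f := by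
  rw [inner_modeL2, inv_mul_cancel_left₀]
  exact_mod_cast (by positivity : (2 * Real.pi) ^ 2 ≠ 0)

theorem coeff_sub (f g : L2T) (k : Fin 2 → ℤ) :
    coeff (f - g : L2T) k = coeff f k - coeff g k := by
  simp only [coeff_eq_inner, inner_sub_right, mul_sub]

theorem norm_sq_eq_integral (f : L2T) : ‖f‖ ^ 2 = ∫ x, ‖f x‖ ^ 2 ∂torusMeasure := by
  rw [← inner_self_eq_norm_sq (𝕜 := ℂ), L2.inner_def, ← integral_re (L2.integrable_inner f f)]
  simp [← Complex.ofReal_pow]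

theorem hasSum_sq_coeff_L2 (f : L2T) :
    HasSum (fun k => ‖coeff f k‖ ^ 2) (((2 * Real.pi) ^ 2)⁻¹ * ‖f‖ ^ 2) := by
  rw [norm_sq_eq_integral]
  exact hasSum_sq_coeff (Lp.memLp f)

theorem integral_mode (k : Fin 2 → ℤ) :
    ∫ x, mode k x ∂torusMeasure = if k = 0 then (((2 * Real.pi) ^ 2 : ℝ) : ℂ) else 0 := by
  have h := integral_torus_eq (f := mode k) (continuous_mode k).aestronglyMeasurable
  have h2 : ∫ θ, mode k (toCell θ) = if k = 0 then 1 else 0 := by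
    have h3 := orthonormal_iff_ite.1 (UnitAddTorus.orthonormal_mFourier (d := Fin 2)) 0 k
    simp only [ContinuousMap.inner_toLp] at h3
    simp_rw [mFourier_eq_mode, mode_zero] at h3
    simp only [map_one, mul_one, eq_comm (a := (0 : Fin 2 → ℤ))] at h3
    exact h3
  rw [h2] at h
  have h4 : ∫ x, mode k x ∂torusMeasure =
      (2 * Real.pi) ^ 2 • (((2 * Real.pi) ^ 2)⁻¹ • ∫ x, mode k x ∂torusMeasure) := by
    rw [smul_inv_smul₀ (by positivity)]
  rw [h4, ← h]
  split_ifs <;> simp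

theorem inner_modeL2_modeL2 (k l : Fin 2 → ℤ) :
    inner ℂ (modeL2 k) (modeL2 l) = if k = l then (((2 * Real.pi) ^ 2 : ℝ) : ℂ) else 0 := by
  have : inner ℂ (modeL2 k) (modeL2 l) = ∫ x, mode (l - k) x ∂torusMeasure := by
    rw [L2.inner_def]
    refine integral_congr_ae ?_
    filter_upwards [coeFn_modeL2 k, coeFn_modeL2 l] with x hx hy
    rw [hx, hy, RCLike.inner_apply, conj_mode, sub_eq_add_neg, mode_add]
  rw [this, integral_mode]
  simp only [sub_eq_zero, eq_comm (a := l)]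

theorem coeff_modeL2 (k l : Fin 2 → ℤ) : coeff (modeL2 l) k = if k = l then 1 else 0 := by
  rw [coeff_eq_inner, inner_modeL2_modeL2]
  split_ifs
  · rw [inv_mul_cancel₀]
    exact_mod_cast (by positivity : (2 * Real.pi) ^ 2 ≠ 0)
  · simp

theorem orthonormal_modeL2 :
    Orthonormal ℂ fun k => (((2 * Real.pi : ℝ) : ℂ))⁻¹ • modeL2 k := by
  have hpi : ((2 * Real.pi : ℝ) : ℂ) ≠ 0 := by exact_mod_cast (by positivity : 2 * Real.pi ≠ 0)
  rw [orthonormal_iff_ite]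
  intro k l
  rw [inner_smul_left, inner_smul_right, inner_modeL2_modeL2]
  split_ifs
  · rw [← Complex.ofReal_inv, Complex.conj_ofReal]
    push_cast at hpi ⊢
    field_simp
  · simp

/-- The normalized Fourier modes form a Hilbert basis of `L²(𝕋²)`. -/
noncomputable def modeBasis : HilbertBasis (Fin 2 → ℤ) ℂ L2T :=
  HilbertBasis.mkOfOrthogonalEqBot orthonormal_modeL2 (by
    rw [Submodule.eq_bot_iff]
    intro f hf
    have h0 : ∀ k, coeff f k = 0 := fun k => by
      have h1 := (Submodule.mem_orthogonal _ f).1 hf _ (Submodule.subset_span ⟨k, rfl⟩)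
      rw [inner_smul_left, mul_eq_zero] at h1
      rw [coeff_eq_inner, h1.resolve_left, mul_zero]
      simp [Real.pi_ne_zero]
    -- Completeness follows from Parseval: when all coefficients vanish, so does the norm.
    have h2 := hasSum_sq_coeff_L2 f
    simp only [h0, norm_zero, ne_eq, OfNat.ofNat_ne_zero, not_false_eq_true, zero_pow] at h2
    have h3 := h2.unique hasSum_zero
    have h4 : ((2 * Real.pi) ^ 2)⁻¹ ≠ 0 := by positivity
    simpa [h4, Real.pi_ne_zero] using h3)

theorem modeBasis_apply (k : Fin 2 → ℤ) :
    modeBasis k = (((2 * Real.pi : ℝ) : ℂ))⁻¹ • modeL2 k := by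
  rw [modeBasis, HilbertBasis.coe_mkOfOrthogonalEqBot]

theorem modeL2_eq_smul (k : Fin 2 → ℤ) : modeL2 k = ((2 * Real.pi : ℝ) : ℂ) • modeBasis k := by
  rw [modeBasis_apply, smul_inv_smul₀]
  exact_mod_cast (by positivity : 2 * Real.pi ≠ 0)

theorem modeBasis_repr (f : L2T) (k : Fin 2 → ℤ) :
    modeBasis.repr f k = ((2 * Real.pi : ℝ) : ℂ) * coeff f k := by
  have hpi : ((2 * Real.pi : ℝ) : ℂ) ≠ 0 := by exact_mod_cast (by positivity : 2 * Real.pi ≠ 0)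
  rw [HilbertBasis.repr_apply_apply, modeBasis_apply, inner_smul_left, inner_modeL2,
    ← Complex.ofReal_inv, Complex.conj_ofReal]
  push_cast at hpi ⊢
  field_simp

/-- An `L²` function is the sum of its Fourier series. -/
theorem hasSum_coeff_smul_modeL2 (f : L2T) : HasSum (fun k => coeff f k • modeL2 k) f := by
  have h := modeBasis.hasSum_repr f
  convert h using 2 with k
  rw [modeBasis_repr, modeL2_eq_smul, smul_smul, mul_comm]

/-- A square summable family is the family of Fourier coefficients of an `L²` function. -/
theorem exists_hasSum_smul_modeL2 {a : (Fin 2 → ℤ) → ℂ} (ha : Summable fun k => ‖a k‖ ^ 2) :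
    ∃ f : L2T, HasSum (fun k => a k • modeL2 k) f ∧ ∀ k, coeff f k = a k := by
  have hpi : ((2 * Real.pi : ℝ) : ℂ) ≠ 0 := by exact_mod_cast (by positivity : 2 * Real.pi ≠ 0)
  have hm : Memℓp (fun k => ((2 * Real.pi : ℝ) : ℂ) * a k) 2 := by
    rw [memℓp_gen_iff (by norm_num)]
    simp only [norm_mul, ENNReal.toReal_ofNat, Real.rpow_two, mul_pow]
    exact ha.mul_left _
  obtain ⟨f, hf⟩ := modeBasis.repr.surjective ⟨_, hm⟩
  have hc : ∀ k, coeff f k = a k := fun k => by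
    have h1 := modeBasis_repr f k
    rw [hf] at h1
    exact (mul_left_cancel₀ hpi h1).symm
  refine ⟨f, ?_, hc⟩
  simpa only [hc] using hasSum_coeff_smul_modeL2 f

/-! ### Lattice sums over frequencies. -/

theorem freqSq_nonneg (k : Fin 2 → ℤ) : 0 ≤ freqSq k := Finset.sum_nonneg fun _ _ => sq_nonneg _

theorem freqSq_neg (k : Fin 2 → ℤ) : freqSq (-k) = freqSq k := by simp [freqSq]

theorem sq_le_freqSq (k : Fin 2 → ℤ) (j : Fin 2) : (k j : ℝ) ^ 2 ≤ freqSq k :=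
  Finset.single_le_sum (f := fun i => (k i : ℝ) ^ 2) (fun _ _ => sq_nonneg _) (Finset.mem_univ j)

theorem one_le_freqSq {k : Fin 2 → ℤ} (hk : k ≠ 0) : 1 ≤ freqSq k := by
  obtain ⟨j, hj⟩ := Function.ne_iff.1 hk
  refine le_trans ?_ (sq_le_freqSq k j)
  have : (1 : ℤ) ≤ (k j) ^ 2 := Int.one_le_abs (pow_ne_zero 2 hj) |>.trans_eq (abs_of_nonneg (sq_nonneg _))
  exact_mod_cast this

/-- One-dimensional lattice sum. -/
theorem sum_nat_inv_sq_add_sq_le {R : ℝ} (hR : 1 ≤ R) (n : ℕ) :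
    ∑ a ∈ Finset.range n, (R ^ 2 + (a : ℝ) ^ 2)⁻¹ ≤ 4 / R := by
  -- With `x = R - 1/2 + a` one has `x (x + 1) = (R + a)² - 1/4 ≤ 2 (R² + a²)`, so each term is at
  -- most twice the telescoping difference `1/x - 1/(x + 1)`.
  have h1 : ∀ n : ℕ, ∑ a ∈ Finset.range n, (R ^ 2 + (a : ℝ) ^ 2)⁻¹ ≤
      2 * ((R - 1 / 2)⁻¹ - (R - 1 / 2 + n)⁻¹) := by
    intro n
    induction n with
    | zero => simp
    | succ n ih =>
      rw [Finset.sum_range_succ]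
      have hn : (0 : ℝ) ≤ n := n.cast_nonneg
      have h2 : (R ^ 2 + (n : ℝ) ^ 2)⁻¹ ≤ 2 * ((R - 1 / 2 + n)⁻¹ - (R - 1 / 2 + (n + 1 : ℕ))⁻¹) := by
        push_cast
        have e : (R - 1 / 2 + n)⁻¹ - (R - 1 / 2 + (n + 1))⁻¹ =
            ((R - 1 / 2 + n) * (R - 1 / 2 + (n + 1)))⁻¹ := by
          rw [inv_sub_inv (by linarith) (by linarith)]
          rw [inv_eq_one_div]; congr 1; ring
        rw [e, ← div_eq_mul_inv, inv_eq_one_div, div_le_div_iff₀ (by positivity)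
          (mul_pos (by linarith) (by linarith))]
        nlinarith [sq_nonneg (R - n)]
      linarith
  refine (h1 n).trans ?_
  have h3 : (0 : ℝ) ≤ (R - 1 / 2 + n)⁻¹ := by
    have : (0 : ℝ) ≤ n := n.cast_nonneg
    exact inv_nonneg.2 (by linarith)
  have h4 : (R - 1 / 2)⁻¹ ≤ 2 / R := by
    rw [inv_eq_one_div, div_le_div_iff₀ (by linarith) (by linarith)]; linarith
  have : 4 / R = 2 * (2 / R) := by ring
  linarith

theorem summable_int_inv_sq_add_sq {R : ℝ} (hR : 1 ≤ R) :
    Summable (fun a : ℤ => (R ^ 2 + (a : ℝ) ^ 2)⁻¹) ∧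
    ∑' a : ℤ, (R ^ 2 + (a : ℝ) ^ 2)⁻¹ ≤ 8 / R := by
  have hs : Summable (fun a : ℕ => (R ^ 2 + (a : ℝ) ^ 2)⁻¹) :=
    summable_of_sum_range_le (fun _ => by positivity) (sum_nat_inv_sq_add_sq_le hR)
  have hle : ∑' a : ℕ, (R ^ 2 + (a : ℝ) ^ 2)⁻¹ ≤ 4 / R :=
    hs.tsum_le_of_sum_range_le (sum_nat_inv_sq_add_sq_le hR)
  have hs' : Summable (fun a : ℕ => (R ^ 2 + ((a + 1 : ℕ) : ℝ) ^ 2)⁻¹) :=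
    (summable_nat_add_iff 1).2 hs
  have hle' : ∑' a : ℕ, (R ^ 2 + ((a + 1 : ℕ) : ℝ) ^ 2)⁻¹ ≤ 4 / R := by
    refine le_trans ?_ hle
    rw [hs.tsum_eq_zero_add]
    have : 0 ≤ (R ^ 2 + ((0 : ℕ) : ℝ) ^ 2)⁻¹ := by positivity
    linarith
  have h := HasSum.of_nat_of_neg_add_one (f := fun a : ℤ => (R ^ 2 + (a : ℝ) ^ 2)⁻¹)
    (by simpa using hs.hasSum) (m' := ∑' a : ℕ, (R ^ 2 + ((a + 1 : ℕ) : ℝ) ^ 2)⁻¹) (by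
      convert hs'.hasSum using 3
      push_cast; ring)
  refine ⟨h.summable, ?_⟩
  rw [h.tsum_eq]
  have : 8 / R = 4 / R + 4 / R := by ring
  linarith

/-- Two-dimensional lattice sum. -/
theorem lattice_sum {R : ℝ} (hR : 1 ≤ R) :
    Summable (fun k : Fin 2 → ℤ => ((R ^ 2 + freqSq k) ^ 2)⁻¹) ∧
    ∑' k : Fin 2 → ℤ, ((R ^ 2 + freqSq k) ^ 2)⁻¹ ≤ 64 / R ^ 2 := by
  obtain ⟨hs, hle⟩ := summable_int_inv_sq_add_sq hR
  set u : ℤ → ℝ := fun a => (R ^ 2 + (a : ℝ) ^ 2)⁻¹ with hu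
  have hu0 : ∀ a, 0 ≤ u a := fun a => by positivity
  have hp : Summable fun x : ℤ × ℤ => u x.1 * u x.2 := hs.mul_of_nonneg hs hu0 hu0
  have hp' : Summable fun k : Fin 2 → ℤ => u (k 0) * u (k 1) :=
    (finTwoArrowEquiv ℤ).summable_iff.2 hp
  -- `(R² + |k|²)²` dominates `(R² + k₀²)(R² + k₁²)`, so the sum is bounded by a product of two
  -- one-dimensional ones.
  have hbd : ∀ k : Fin 2 → ℤ, ((R ^ 2 + freqSq k) ^ 2)⁻¹ ≤ u (k 0) * u (k 1) := by
    intro k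
    simp only [hu, freqSq, Fin.sum_univ_two]
    rw [← mul_inv]
    refine inv_anti₀ (by positivity) ?_
    nlinarith [sq_nonneg (k 0 : ℝ), sq_nonneg (k 1 : ℝ), sq_nonneg R,
      mul_nonneg (sq_nonneg (k 0 : ℝ)) (sq_nonneg (k 1 : ℝ)),
      mul_nonneg (sq_nonneg R) (sq_nonneg (k 1 : ℝ)), mul_nonneg (sq_nonneg R) (sq_nonneg (k 0 : ℝ)),
      sq_nonneg ((k 0 : ℝ) ^ 2), sq_nonneg ((k 1 : ℝ) ^ 2)]
  have hsum := Summable.of_nonneg_of_le (fun k => by positivity) hbd hp'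
  refine ⟨hsum, (hsum.tsum_le_tsum hbd hp').trans ?_⟩
  have e : ∑' k : Fin 2 → ℤ, u (k 0) * u (k 1) = (∑' a, u a) * ∑' a, u a := by
    rw [hs.tsum_mul_tsum hs hp]
    exact (finTwoArrowEquiv ℤ).tsum_eq (fun x : ℤ × ℤ => u x.1 * u x.2)
  rw [e]
  have h0 : 0 ≤ ∑' a, u a := tsum_nonneg hu0
  calc _ ≤ (8 / R) * (8 / R) := mul_le_mul hle hle h0 (by positivity)
    _ = 64 / R ^ 2 := by ring

theorem lattice_sum_finset {R : ℝ} (hR : 1 ≤ R) (F : Finset (Fin 2 → ℤ)) :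
    ∑ k ∈ F, ((R ^ 2 + freqSq k) ^ 2)⁻¹ ≤ 64 / R ^ 2 :=
  ((lattice_sum hR).1.sum_le_tsum F fun _ _ => by positivity).trans (lattice_sum hR).2

/-- The logarithmic lattice sum, with cut-off at frequency `n`. -/
theorem log_lattice_sum_finset (n : ℕ) (F : Finset (Fin 2 → ℤ)) (hF : ∀ k ∈ F, k ≠ 0) :
    ∑ k ∈ F, ((freqSq k)⁻¹ - (freqSq k + ((n : ℝ) + 1) ^ 2)⁻¹) ≤
      256 + 192 * (harmonic n : ℝ) := by
  induction n with
  | zero =>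
    simp only [Nat.cast_zero, zero_add, harmonic_zero, Rat.cast_zero, mul_zero, add_zero, one_pow]
    calc _ ≤ ∑ k ∈ F, 4 * (((1 : ℝ) ^ 2 + freqSq k) ^ 2)⁻¹ := by
          refine Finset.sum_le_sum fun k hk => ?_
          have h1 := one_le_freqSq (hF k hk)
          rw [inv_sub_inv (by positivity) (by positivity), ← div_eq_mul_inv,
            div_le_div_iff₀ (by positivity) (by positivity)]
          nlinarith
      _ ≤ 4 * (64 / 1 ^ 2) := by
          rw [← Finset.mul_sum]
          exact mul_le_mul_of_nonneg_left (lattice_sum_finset le_rfl F) (by norm_num)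
      _ = _ := by norm_num
  | succ n ih =>
    -- Raising the cut-off from `n + 1` to `n + 2` adds at most `3(n + 1) / ((n + 1)² + |k|²)²` at
    -- each frequency. By `lattice_sum_finset` this sums to `192 / (n + 1)`, an increment of the
    -- harmonic number.
    have h2 : ∑ k ∈ F, ((freqSq k + ((n : ℝ) + 1) ^ 2)⁻¹ - (freqSq k + ((n : ℝ) + 1 + 1) ^ 2)⁻¹) ≤
        192 * ((n : ℝ) + 1)⁻¹ := by
      have hn : (0 : ℝ) ≤ n := n.cast_nonneg
      calc _ ≤ ∑ k ∈ F, (3 * ((n : ℝ) + 1)) * ((((n : ℝ) + 1) ^ 2 + freqSq k) ^ 2)⁻¹ := by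
            refine Finset.sum_le_sum fun k hk => ?_
            have h0 := freqSq_nonneg k
            have hp : 0 < freqSq k + ((n : ℝ) + 1) ^ 2 := by positivity
            have hp2 : freqSq k + ((n : ℝ) + 1) ^ 2 ≤ freqSq k + ((n : ℝ) + 1 + 1) ^ 2 := by nlinarith
            rw [inv_sub_inv (by positivity) (by positivity), ← div_eq_mul_inv, add_comm _ (freqSq k), sq (freqSq k + _)]
            refine div_le_div₀ (by positivity) (by nlinarith) (by positivity) ?_
            exact mul_le_mul_of_nonneg_left hp2 hp.le
        _ ≤ (3 * ((n : ℝ) + 1)) * (64 / ((n : ℝ) + 1) ^ 2) := by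
            rw [← Finset.mul_sum]
            exact mul_le_mul_of_nonneg_left (lattice_sum_finset (by linarith) F) (by positivity)
        _ = _ := by field_simp; norm_num
    rw [harmonic_succ]
    push_cast
    have e : ∀ k, (freqSq k)⁻¹ - (freqSq k + ((n : ℝ) + 1 + 1) ^ 2)⁻¹ =
        ((freqSq k)⁻¹ - (freqSq k + ((n : ℝ) + 1) ^ 2)⁻¹) +
        ((freqSq k + ((n : ℝ) + 1) ^ 2)⁻¹ - (freqSq k + ((n : ℝ) + 1 + 1) ^ 2)⁻¹) := fun k => by ring
    simp only [e, Finset.sum_add_distrib]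
    linarith

/-! ### Weak derivatives and Sobolev norms through Fourier coefficients. -/

theorem summable_sq_coeff (f : L2T) : Summable fun k => ‖coeff f k‖ ^ 2 := (hasSum_sq_coeff_L2 f).summable

theorem norm_sq_eq_tsum (f : L2T) : ‖f‖ ^ 2 = (2 * Real.pi) ^ 2 * ∑' k, ‖coeff f k‖ ^ 2 := by
  rw [(hasSum_sq_coeff_L2 f).tsum_eq, mul_inv_cancel_left₀ (by positivity)]

theorem eq_of_coeff_eq {f g : L2T} (h : ∀ k, coeff f k = coeff g k) : f = g := by
  have hf := hasSum_coeff_smul_modeL2 f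
  simp only [h] at hf
  exact hf.unique (hasSum_coeff_smul_modeL2 g)

theorem summable_multiplier {f : L2T} (hf : MemH2 f) {m : (Fin 2 → ℤ) → ℂ}
    (hm : ∀ k, ‖m k‖ ≤ 1 + freqSq k) : Summable fun k => ‖m k * coeff f k‖ ^ 2 := by
  refine Summable.of_nonneg_of_le (fun k => by positivity) (fun k => ?_) hf
  rw [norm_mul, mul_pow]
  exact mul_le_mul_of_nonneg_right (pow_le_pow_left₀ (norm_nonneg _) (hm k) 2) (by positivity)

theorem norm_partial_symbol_le (j : Fin 2) (k : Fin 2 → ℤ) :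
    ‖Complex.I * (k j : ℂ)‖ ≤ 1 + freqSq k := by
  have h := sq_le_freqSq k j
  have h1 : ‖Complex.I * (k j : ℂ)‖ = |(k j : ℝ)| := by simp
  rw [h1]
  nlinarith [sq_abs (k j : ℝ), sq_nonneg (|(k j : ℝ)| - 1), abs_nonneg (k j : ℝ)]

theorem norm_laplacian_symbol_le (k : Fin 2 → ℤ) : ‖(-(freqSq k : ℂ))‖ ≤ 1 + freqSq k := by
  rw [norm_neg, Complex.norm_real, Real.norm_of_nonneg (freqSq_nonneg k)]
  linarith

theorem hasSum_multiplier {f : L2T} (hf : MemH2 f) {m : (Fin 2 → ℤ) → ℂ}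
    (hm : ∀ k, ‖m k‖ ≤ 1 + freqSq k) :
    HasSum (fun k => (m k * coeff f k) • modeL2 k) (∑' k, (m k * coeff f k) • modeL2 k) ∧
    ∀ k, coeff (∑' k, (m k * coeff f k) • modeL2 k : L2T) k = m k * coeff f k := by
  obtain ⟨g, hg, hc⟩ := exists_hasSum_smul_modeL2 (summable_multiplier hf hm)
  rw [hg.tsum_eq]
  exact ⟨hg, hc⟩

theorem hasSum_weakPartial {f : L2T} (hf : MemH2 f) (j : Fin 2) :
    HasSum (fun k => (Complex.I * (k j : ℂ) * coeff f k) • modeL2 k) (weakPartial j f) :=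
  (hasSum_multiplier hf (norm_partial_symbol_le j)).1

theorem coeff_weakPartial {f : L2T} (hf : MemH2 f) (j : Fin 2) (k : Fin 2 → ℤ) :
    coeff (weakPartial j f) k = Complex.I * (k j : ℂ) * coeff f k :=
  (hasSum_multiplier hf (norm_partial_symbol_le j)).2 k

theorem hasSum_weakLaplacian {f : L2T} (hf : MemH2 f) :
    HasSum (fun k => (-(freqSq k : ℂ) * coeff f k) • modeL2 k) (weakLaplacian f) :=
  (hasSum_multiplier hf norm_laplacian_symbol_le).1

theorem coeff_weakLaplacian {f : L2T} (hf : MemH2 f) (k : Fin 2 → ℤ) :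
    coeff (weakLaplacian f) k = -(freqSq k : ℂ) * coeff f k :=
  (hasSum_multiplier hf norm_laplacian_symbol_le).2 k

theorem MemH2.sub {f g : L2T} (hf : MemH2 f) (hg : MemH2 g) : MemH2 (f - g) := by
  refine Summable.of_nonneg_of_le (fun k => by positivity) (fun k => ?_)
    ((hf.mul_left 2).add (hg.mul_left 2))
  rw [coeff_sub, ← mul_assoc, ← mul_assoc, mul_comm (2 : ℝ), mul_assoc, mul_assoc, ← mul_add]
  refine mul_le_mul_of_nonneg_left ?_ (by positivity)
  have := norm_sub_le (coeff f k) (coeff g k)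
  nlinarith [norm_nonneg (coeff f k - coeff g k), sq_nonneg (‖coeff f k‖ - ‖coeff g k‖)]

theorem weakPartial_sub {f g : L2T} (hf : MemH2 f) (hg : MemH2 g) (j : Fin 2) :
    weakPartial j (f - g) = weakPartial j f - weakPartial j g :=
  eq_of_coeff_eq fun k => by
    rw [coeff_weakPartial (hf.sub hg), coeff_sub, coeff_sub, coeff_weakPartial hf,
      coeff_weakPartial hg, mul_sub]

theorem weakLaplacian_sub {f g : L2T} (hf : MemH2 f) (hg : MemH2 g) :
    weakLaplacian (f - g) = weakLaplacian f - weakLaplacian g :=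
  eq_of_coeff_eq fun k => by
    rw [coeff_weakLaplacian (hf.sub hg), coeff_sub, coeff_sub, coeff_weakLaplacian hf,
      coeff_weakLaplacian hg, mul_sub]

theorem h2Norm_nonneg (f : L2T) : 0 ≤ h2Norm f := Real.sqrt_nonneg _

theorem h2Norm_sq (f : L2T) :
    h2Norm f ^ 2 = ∑' k : Fin 2 → ℤ, (1 + freqSq k) ^ 2 * ‖coeff f k‖ ^ 2 :=
  Real.sq_sqrt (tsum_nonneg fun _ => by positivity)

theorem norm_weakLaplacian_le {f : L2T} (hf : MemH2 f) :
    ‖weakLaplacian f‖ ≤ 2 * Real.pi * h2Norm f := by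
  refine le_of_sq_le_sq ?_ (mul_nonneg (by positivity) (h2Norm_nonneg f))
  rw [norm_sq_eq_tsum, mul_pow _ (h2Norm f), h2Norm_sq]
  refine mul_le_mul_of_nonneg_left ?_ (by positivity)
  refine (summable_sq_coeff _).tsum_le_tsum (fun k => ?_) hf
  rw [coeff_weakLaplacian hf, norm_mul, mul_pow]
  exact mul_le_mul_of_nonneg_right
    (pow_le_pow_left₀ (norm_nonneg _) (norm_laplacian_symbol_le k) 2) (by positivity)

/-- The weight `1 + |k|²` is the symbol of `1 - Δ`, so the norm equals `(2π)⁻¹ ‖f - Δf‖`. The factor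
`(2π)⁻¹` is kept because it leaves the room in which the lower order terms are absorbed. -/
theorem h2Norm_le {f : L2T} (hf : MemH2 f) :
    h2Norm f ≤ (2 * Real.pi)⁻¹ * (‖f‖ + ‖weakLaplacian f‖) := by
  have h1 : h2Norm f = (2 * Real.pi)⁻¹ * ‖f - weakLaplacian f‖ := by
    have h0 : (0 : ℝ) ≤ (2 * Real.pi)⁻¹ := by positivity
    rw [← sq_eq_sq₀ (h2Norm_nonneg f) (by positivity), mul_pow, h2Norm_sq, norm_sq_eq_tsum,
      inv_pow, inv_mul_cancel_left₀ (by positivity)]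
    refine tsum_congr fun k => ?_
    have : coeff (f - weakLaplacian f : L2T) k = ((1 + freqSq k : ℝ) : ℂ) * coeff f k := by
      rw [coeff_sub, coeff_weakLaplacian hf]; push_cast; ring
    rw [this, norm_mul, mul_pow, Complex.norm_real, Real.norm_eq_abs, sq_abs]
  rw [h1]
  exact mul_le_mul_of_nonneg_left (norm_sub_le _ _) (by positivity)

/-- The `H²` norm with a frequency scale `R`. -/
noncomputable def scaledNorm (R : ℝ) (f : L2T) : ℝ :=
  √(∑' k : Fin 2 → ℤ, (R ^ 2 + freqSq k) ^ 2 * ‖coeff f k‖ ^ 2)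

theorem summable_scaled {f : L2T} (hf : MemH2 f) {R : ℝ} (hR : 1 ≤ R) :
    Summable fun k : Fin 2 → ℤ => (R ^ 2 + freqSq k) ^ 2 * ‖coeff f k‖ ^ 2 := by
  refine Summable.of_nonneg_of_le (fun k => by positivity) (fun k => ?_) (hf.mul_left (R ^ 4))
  rw [← mul_assoc]
  refine mul_le_mul_of_nonneg_right ?_ (by positivity)
  have h := freqSq_nonneg k
  have h1 : R ^ 2 + freqSq k ≤ R ^ 2 * (1 + freqSq k) := by
    nlinarith [mul_le_mul_of_nonneg_right (one_le_pow₀ hR : 1 ≤ R ^ 2) h]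
  calc _ ≤ (R ^ 2 * (1 + freqSq k)) ^ 2 := pow_le_pow_left₀ (by positivity) h1 2
    _ = _ := by ring

theorem scaledNorm_nonneg (R : ℝ) (f : L2T) : 0 ≤ scaledNorm R f := Real.sqrt_nonneg _

/-- The multiplication estimates below gain negative powers of `R` against `scaledNorm R`. A large
`R` therefore makes the lower order terms small relative to the `H²` norm, at the price of `R²`
times the `L²` norm. -/
theorem scaledNorm_le {f : L2T} (hf : MemH2 f) {R : ℝ} (hR : 1 ≤ R) :
    scaledNorm R f ≤ 2 * (R ^ 2 * ‖f‖ + h2Norm f) := by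
  have h0 := h2Norm_nonneg f
  refine Real.sqrt_le_iff.2 ⟨by positivity, ?_⟩
  have h1 : ∑' k : Fin 2 → ℤ, (R ^ 2 + freqSq k) ^ 2 * ‖coeff f k‖ ^ 2 ≤
      2 * R ^ 4 * ∑' k, ‖coeff f k‖ ^ 2 + 2 * h2Norm f ^ 2 := by
    rw [h2Norm_sq, ← tsum_mul_left, ← tsum_mul_left,
      ← ((summable_sq_coeff f).mul_left _).tsum_add (hf.mul_left _)]
    refine (summable_scaled hf hR).tsum_le_tsum (fun k => ?_)
      (((summable_sq_coeff f).mul_left _).add (hf.mul_left _))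
    have h := freqSq_nonneg k
    rw [← mul_assoc, ← add_mul]
    refine mul_le_mul_of_nonneg_right ?_ (by positivity)
    nlinarith [sq_nonneg (R ^ 2 - freqSq k)]
  have h2 := norm_sq_eq_tsum f
  have h3 : ∑' k, ‖coeff f k‖ ^ 2 ≤ ‖f‖ ^ 2 := by
    rw [h2]
    refine le_mul_of_one_le_left (tsum_nonneg fun _ => by positivity) (one_le_pow₀ ?_)
    linarith [Real.pi_gt_three]
  have h4 : 2 * R ^ 4 * ∑' k, ‖coeff f k‖ ^ 2 ≤ 2 * R ^ 4 * ‖f‖ ^ 2 :=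
    mul_le_mul_of_nonneg_left h3 (by positivity)
  nlinarith [mul_nonneg (mul_nonneg (sq_nonneg R) (norm_nonneg f)) h0, sq_nonneg (h2Norm f), sq_nonneg (R ^ 2 * ‖f‖)]

/-! ### Multiplication operators -/

theorem memLp_bcf_mul (g : BoundedContinuousFunction Plane ℂ) (f : L2T) :
    MemLp (fun x => g x * f x) 2 torusMeasure :=
  (Lp.memLp f).mul (memLp_top_of_bound g.continuous.aestronglyMeasurable ‖g‖
    (Eventually.of_forall g.norm_coe_le_norm))

/-- Multiplication by a bounded continuous function on `L²(𝕋²)`. -/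
noncomputable def mulOp (g : BoundedContinuousFunction Plane ℂ) : L2T →L[ℂ] L2T :=
  LinearMap.mkContinuous
    { toFun := fun f => (memLp_bcf_mul g f).toLp
      map_add' := fun f h => by
        refine Lp.ext ?_
        filter_upwards [(memLp_bcf_mul g (f + h)).coeFn_toLp, (memLp_bcf_mul g f).coeFn_toLp,
          (memLp_bcf_mul g h).coeFn_toLp, Lp.coeFn_add f h,
          Lp.coeFn_add (memLp_bcf_mul g f).toLp (memLp_bcf_mul g h).toLp] with x h1 h2 h3 h4 h5
        rw [h1, h5, Pi.add_apply, h2, h3, h4, Pi.add_apply, mul_add]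
      map_smul' := fun c f => by
        refine Lp.ext ?_
        filter_upwards [(memLp_bcf_mul g (c • f)).coeFn_toLp, (memLp_bcf_mul g f).coeFn_toLp,
          Lp.coeFn_smul c f, Lp.coeFn_smul c (memLp_bcf_mul g f).toLp] with x h1 h2 h3 h4
        rw [h1, RingHom.id_apply, h4, Pi.smul_apply, h2, h3, Pi.smul_apply, smul_eq_mul,
          smul_eq_mul]
        ring }
    ‖g‖ (fun f => by
      refine Lp.norm_le_mul_norm_of_ae_le_mul ?_
      simp only [LinearMap.coe_mk, AddHom.coe_mk]
      filter_upwards [(memLp_bcf_mul g f).coeFn_toLp] with x hx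
      rw [hx, norm_mul]
      exact mul_le_mul_of_nonneg_right (g.norm_coe_le_norm x) (norm_nonneg _))

theorem coeFn_mulOp (g : BoundedContinuousFunction Plane ℂ) (f : L2T) :
    mulOp g f =ᵐ[torusMeasure] fun x => g x * f x :=
  (memLp_bcf_mul g f).coeFn_toLp

theorem coeFn_trigSum (F : Finset (Fin 2 → ℤ)) (c : (Fin 2 → ℤ) → ℂ) :
    (∑ k ∈ F, c k • modeL2 k : L2T) =ᵐ[torusMeasure] fun x => ∑ k ∈ F, c k * mode k x := by
  classical
  induction F using Finset.induction_on with
  | empty =>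
    simp only [Finset.sum_empty]
    exact Lp.coeFn_zero _ _ _
  | insert k F hk ih =>
    rw [Finset.sum_insert hk]
    filter_upwards [Lp.coeFn_add (c k • modeL2 k) (∑ k ∈ F, c k • modeL2 k), ih,
      Lp.coeFn_smul (c k) (modeL2 k), coeFn_modeL2 k] with x h1 h2 h3 h4
    rw [h1, Pi.add_apply, h2, h3, Pi.smul_apply, h4, Finset.sum_insert hk, smul_eq_mul]

theorem norm_trigPoly_le (F : Finset (Fin 2 → ℤ)) (c : (Fin 2 → ℤ) → ℂ) (x : Plane) :
    ‖∑ k ∈ F, c k * mode k x‖ ≤ ∑ k ∈ F, ‖c k‖ :=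
  (norm_sum_le _ _).trans (Finset.sum_le_sum fun k _ => by rw [norm_mul, norm_mode, mul_one])

/-- The embedding of `H²` in `L^∞` with its dependence on `R`: Cauchy–Schwarz against the weights
`(R² + |k|²)²`, whose inverses sum to at most `64 / R²`. -/
theorem sq_sum_norm_le (F : Finset (Fin 2 → ℤ)) (c : (Fin 2 → ℤ) → ℂ) {R : ℝ} (hR : 1 ≤ R) :
    (∑ k ∈ F, ‖c k‖) ^ 2 ≤ 64 / R ^ 2 * ∑ k ∈ F, (R ^ 2 + freqSq k) ^ 2 * ‖c k‖ ^ 2 := by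
  refine (Finset.sum_sq_le_sum_mul_sum_of_sq_le_mul F (r := fun k => ‖c k‖)
    (f := fun k => ((R ^ 2 + freqSq k) ^ 2)⁻¹) (g := fun k => (R ^ 2 + freqSq k) ^ 2 * ‖c k‖ ^ 2)
    (fun k _ => by positivity) (fun k _ => by positivity) fun k _ => ?_).trans ?_
  · have := freqSq_nonneg k
    exact (inv_mul_cancel_left₀ (by positivity) _).ge
  · exact mul_le_mul_of_nonneg_right (lattice_sum_finset hR F)
      (Finset.sum_nonneg fun _ _ => by positivity)

theorem norm_sq_mulOp (g : BoundedContinuousFunction Plane ℂ) (f : L2T) :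
    ‖mulOp g f‖ ^ 2 = ∫ x, ‖g x‖ ^ 2 * ‖f x‖ ^ 2 ∂torusMeasure := by
  rw [norm_sq_eq_integral]
  refine integral_congr_ae ?_
  filter_upwards [coeFn_mulOp g f] with x hx
  rw [hx, norm_mul, mul_pow]

theorem integrable_bcf {E : Type*} [NormedAddCommGroup E] {f : Plane → E} (hf : Continuous f) {C : ℝ}
    (hC : ∀ x, ‖f x‖ ≤ C) : Integrable f torusMeasure :=
  Integrable.of_bound hf.aestronglyMeasurable C (Eventually.of_forall hC)

theorem norm_sq_mulOp_trigSum_le (V : BoundedContinuousFunction Plane ℂ) (F : Finset (Fin 2 → ℤ))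
    (c : (Fin 2 → ℤ) → ℂ) {R : ℝ} (hR : 1 ≤ R) :
    ‖mulOp V (∑ k ∈ F, c k • modeL2 k)‖ ^ 2 ≤
      64 / R ^ 2 * (∑ k ∈ F, (R ^ 2 + freqSq k) ^ 2 * ‖c k‖ ^ 2) *
        ∫ x, ‖V x‖ ^ 2 ∂torusMeasure := by
  rw [norm_sq_mulOp]
  have hV : Integrable (fun x => ‖V x‖ ^ 2) torusMeasure :=
    integrable_bcf (by fun_prop) (C := ‖V‖ ^ 2) fun x => by
      rw [norm_pow, norm_norm]; exact pow_le_pow_left₀ (norm_nonneg _) (V.norm_coe_le_norm x) 2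
  calc _ ≤ ∫ x, (∑ k ∈ F, ‖c k‖) ^ 2 * ‖V x‖ ^ 2 ∂torusMeasure := by
        refine integral_mono_of_nonneg (Eventually.of_forall fun x => by positivity)
          (hV.const_mul _) ?_
        filter_upwards [coeFn_trigSum F c] with x hx
        rw [hx, mul_comm]
        exact mul_le_mul_of_nonneg_right
          (pow_le_pow_left₀ (norm_nonneg _) (norm_trigPoly_le F c x) 2) (by positivity)
    _ ≤ _ := by
        rw [integral_const_mul]
        exact mul_le_mul_of_nonneg_right (sq_sum_norm_le F c hR)
          (integral_nonneg fun _ => by positivity)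

/-- Multiplication of an `H²` function by a square integrable potential. -/
theorem norm_sq_mulOp_le (V : BoundedContinuousFunction Plane ℂ) {f : L2T} (hf : MemH2 f) {R : ℝ}
    (hR : 1 ≤ R) :
    ‖mulOp V f‖ ^ 2 ≤ 64 / R ^ 2 * scaledNorm R f ^ 2 * ∫ x, ‖V x‖ ^ 2 ∂torusMeasure := by
  -- Multiplication by `V` is continuous on `L²` because `V` is bounded, so the bound passes from
  -- Fourier partial sums to `f`; the constant involves `V` only through its `L²` norm.
  have ht := (((mulOp V).continuous.tendsto f).comp (hasSum_coeff_smul_modeL2 f)).norm.pow 2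
  refine le_of_tendsto ht (Eventually.of_forall fun F => ?_)
  refine (norm_sq_mulOp_trigSum_le V F (coeff f) hR).trans ?_
  refine mul_le_mul_of_nonneg_right (mul_le_mul_of_nonneg_left ?_ (by positivity))
    (integral_nonneg fun _ => by positivity)
  rw [scaledNorm, Real.sq_sqrt (tsum_nonneg fun _ => by positivity)]
  exact (summable_scaled hf hR).sum_le_tsum F fun _ _ => by positivity

theorem inner_mulOp_modeL2 (g : BoundedContinuousFunction Plane ℂ) (k l : Fin 2 → ℤ) :
    inner ℂ (mulOp g (modeL2 k)) (mulOp g (modeL2 l)) =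
      (((2 * Real.pi) ^ 2 : ℝ) : ℂ) * coeff (fun x => ((‖g x‖ ^ 2 : ℝ) : ℂ)) (k - l) := by
  rw [coeff, ← mul_assoc, ← Complex.ofReal_mul, mul_inv_cancel₀ (by positivity), Complex.ofReal_one,
    one_mul, L2.inner_def]
  refine integral_congr_ae ?_
  filter_upwards [coeFn_mulOp g (modeL2 k), coeFn_mulOp g (modeL2 l), coeFn_modeL2 k,
    coeFn_modeL2 l] with x h1 h2 h3 h4
  rw [h1, h2, h3, h4, RCLike.inner_apply, map_mul, conj_mode, neg_sub, sub_eq_add_neg, mode_add,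
    Complex.ofReal_pow, ← Complex.mul_conj']
  ring

/-- A Schur test: by `2xy ≤ x² + y²` the product of weights is replaced by the square of either one;
summing `a` over the other index gives at most `B`, and the lattice sum remains. -/
theorem sum_toeplitz_le {a : (Fin 2 → ℤ) → ℝ} {B : ℝ} (ha0 : ∀ n, 0 ≤ a n) (hB : HasSum a B)
    (hB0 : 0 ≤ B) {R : ℝ} (hR : 1 ≤ R) (F : Finset (Fin 2 → ℤ)) :
    ∑ p ∈ F ×ˢ F, a (p.1 - p.2) * ((R ^ 2 + freqSq p.1)⁻¹ * (R ^ 2 + freqSq p.2)⁻¹) ≤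
      64 / R ^ 2 * B := by
  have hrow : ∀ k, ∑ l ∈ F, a (k - l) ≤ B := fun k =>
    sum_le_hasSum (f := fun l => a (k - l)) F (fun _ _ => ha0 _) ((Equiv.subLeft k).hasSum_iff.2 hB)
  have hcol : ∀ l, ∑ k ∈ F, a (k - l) ≤ B := fun l =>
    sum_le_hasSum (f := fun k => a (k - l)) F (fun _ _ => ha0 _) ((Equiv.subRight l).hasSum_iff.2 hB)
  have ha : ∑ p ∈ F ×ˢ F, a (p.1 - p.2) * ((R ^ 2 + freqSq p.1) ^ 2)⁻¹ ≤
      64 / R ^ 2 * B := by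
    rw [Finset.sum_product]
    calc _ = ∑ k ∈ F, ((R ^ 2 + freqSq k) ^ 2)⁻¹ * ∑ l ∈ F, a (k - l) :=
          Finset.sum_congr rfl fun k _ => by
            rw [Finset.mul_sum]; exact Finset.sum_congr rfl fun _ _ => mul_comm _ _
      _ ≤ ∑ k ∈ F, ((R ^ 2 + freqSq k) ^ 2)⁻¹ * B :=
          Finset.sum_le_sum fun k _ => mul_le_mul_of_nonneg_left (hrow k) (by positivity)
      _ ≤ _ := by
          rw [← Finset.sum_mul]
          exact mul_le_mul_of_nonneg_right (lattice_sum_finset hR F) hB0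
  have hb : ∑ p ∈ F ×ˢ F, a (p.1 - p.2) * ((R ^ 2 + freqSq p.2) ^ 2)⁻¹ ≤
      64 / R ^ 2 * B := by
    rw [Finset.sum_product_right]
    calc _ = ∑ l ∈ F, ((R ^ 2 + freqSq l) ^ 2)⁻¹ * ∑ k ∈ F, a (k - l) :=
          Finset.sum_congr rfl fun k _ => by
            rw [Finset.mul_sum]; exact Finset.sum_congr rfl fun _ _ => mul_comm _ _
      _ ≤ ∑ k ∈ F, ((R ^ 2 + freqSq k) ^ 2)⁻¹ * B :=
          Finset.sum_le_sum fun k _ => mul_le_mul_of_nonneg_left (hcol k) (by positivity)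
      _ ≤ _ := by
          rw [← Finset.sum_mul]
          exact mul_le_mul_of_nonneg_right (lattice_sum_finset hR F) hB0
  have hc : ∑ p ∈ F ×ˢ F, a (p.1 - p.2) *
      ((R ^ 2 + freqSq p.1)⁻¹ * (R ^ 2 + freqSq p.2)⁻¹) ≤
      ∑ p ∈ F ×ˢ F, (1 / 2 * (a (p.1 - p.2) * ((R ^ 2 + freqSq p.1) ^ 2)⁻¹) +
        1 / 2 * (a (p.1 - p.2) * ((R ^ 2 + freqSq p.2) ^ 2)⁻¹)) := by
    refine Finset.sum_le_sum fun p _ => ?_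
    rw [← inv_pow, ← inv_pow]
    nlinarith [mul_nonneg (ha0 (p.1 - p.2))
      (sq_nonneg ((R ^ 2 + freqSq p.1)⁻¹ - (R ^ 2 + freqSq p.2)⁻¹))]
  rw [Finset.sum_add_distrib, ← Finset.mul_sum, ← Finset.mul_sum] at hc
  linarith

/-- It plays the role of the embedding of `H¹` in `L⁴`. Expanding the square gives a Toeplitz form
in the Fourier coefficients of `|g|²`, and Parseval for `|g|²` turns their square sum into `∫ |g|⁴`.
-/
theorem norm_sq_mulOp_trigSum_le_of_quartic (g : BoundedContinuousFunction Plane ℂ)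
    (F : Finset (Fin 2 → ℤ)) (c : (Fin 2 → ℤ) → ℂ) {R : ℝ} (hR : 1 ≤ R) :
    (‖mulOp g (∑ k ∈ F, c k • modeL2 k)‖ ^ 2) ^ 2 ≤
      (2 * Real.pi) ^ 2 * (64 / R ^ 2) * (∑ k ∈ F, (R ^ 2 + freqSq k) * ‖c k‖ ^ 2) ^ 2 *
        ∫ x, ‖g x‖ ^ 4 ∂torusMeasure := by
  set q : Plane → ℂ := fun x => ((‖g x‖ ^ 2 : ℝ) : ℂ) with hq
  have hqm : MemLp q 2 torusMeasure := by
    refine MemLp.of_bound (by rw [hq]; fun_prop) (‖g‖ ^ 2) (Eventually.of_forall fun x => ?_)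
    simp only [hq, Complex.norm_real, norm_pow, norm_norm]
    exact pow_le_pow_left₀ (norm_nonneg _) (g.norm_coe_le_norm x) 2
  have hB := hasSum_sq_coeff hqm
  have hI : ∫ x, ‖q x‖ ^ 2 ∂torusMeasure = ∫ x, ‖g x‖ ^ 4 ∂torusMeasure := by
    refine integral_congr_ae (Eventually.of_forall fun x => ?_)
    simp only [hq, Complex.norm_real, norm_pow, norm_norm]
    ring
  rw [hI] at hB
  set B := ((2 * Real.pi) ^ 2)⁻¹ * ∫ x, ‖g x‖ ^ 4 ∂torusMeasure with hBdef
  have hB0 : 0 ≤ B := mul_nonneg (by positivity) (integral_nonneg fun _ => by positivity)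
  have hw : ∀ k, 0 < R ^ 2 + freqSq k := fun k => by have := freqSq_nonneg k; positivity
  -- expansion of the square
  have h1 : ‖mulOp g (∑ k ∈ F, c k • modeL2 k)‖ ^ 2 ≤
      (2 * Real.pi) ^ 2 * ∑ p ∈ F ×ˢ F, ‖c p.1‖ * ‖c p.2‖ * ‖coeff q (p.1 - p.2)‖ := by
    have h2 : ‖mulOp g (∑ k ∈ F, c k • modeL2 k)‖ ^ 2 =
        ‖inner ℂ (mulOp g (∑ k ∈ F, c k • modeL2 k)) (mulOp g (∑ k ∈ F, c k • modeL2 k))‖ := by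
      rw [inner_self_eq_norm_sq_to_K]; simp
    rw [h2]
    simp only [map_sum, map_smul, sum_inner, inner_sum, inner_smul_left, inner_smul_right,
      inner_mulOp_modeL2]
    simp only [Finset.mul_sum]
    rw [Finset.sum_comm, ← Finset.sum_product']
    refine (norm_sum_le _ _).trans (Finset.sum_le_sum fun p _ => le_of_eq ?_)
    rw [norm_mul, norm_mul, norm_mul, RCLike.norm_conj, Complex.norm_real,
      Real.norm_of_nonneg (by positivity)]
    ring
  -- Cauchy-Schwarz
  have h3 : (∑ p ∈ F ×ˢ F, ‖c p.1‖ * ‖c p.2‖ * ‖coeff q (p.1 - p.2)‖) ^ 2 ≤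
      (∑ p ∈ F ×ˢ F, ((R ^ 2 + freqSq p.1) * ‖c p.1‖ ^ 2) * ((R ^ 2 + freqSq p.2) * ‖c p.2‖ ^ 2)) *
      ∑ p ∈ F ×ˢ F, ‖coeff q (p.1 - p.2)‖ ^ 2 *
        ((R ^ 2 + freqSq p.1)⁻¹ * (R ^ 2 + freqSq p.2)⁻¹) := by
    refine Finset.sum_sq_le_sum_mul_sum_of_sq_le_mul _ (fun p _ => ?_) (fun p _ => ?_) fun p _ => ?_
    · have := hw p.1; have := hw p.2; positivity
    · have := hw p.1; have := hw p.2; positivity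
    · have := (hw p.1).ne'; have := (hw p.2).ne'; refine le_of_eq ?_; field_simp
  have h4 : ∑ p ∈ F ×ˢ F, ‖coeff q (p.1 - p.2)‖ ^ 2 *
        ((R ^ 2 + freqSq p.1)⁻¹ * (R ^ 2 + freqSq p.2)⁻¹) ≤ 64 / R ^ 2 * B :=
    sum_toeplitz_le (a := fun n => ‖coeff q n‖ ^ 2) (fun _ => by positivity) hB hB0 hR F
  have h5 : ∑ p ∈ F ×ˢ F, ((R ^ 2 + freqSq p.1) * ‖c p.1‖ ^ 2) * ((R ^ 2 + freqSq p.2) * ‖c p.2‖ ^ 2) =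
      (∑ k ∈ F, (R ^ 2 + freqSq k) * ‖c k‖ ^ 2) ^ 2 := by
    rw [sq (∑ k ∈ F, _), Finset.sum_mul_sum, ← Finset.sum_product']
  calc _ ≤ ((2 * Real.pi) ^ 2 * ∑ p ∈ F ×ˢ F, ‖c p.1‖ * ‖c p.2‖ * ‖coeff q (p.1 - p.2)‖) ^ 2 :=
        pow_le_pow_left₀ (by positivity) h1 2
    _ ≤ ((2 * Real.pi) ^ 2) ^ 2 * ((∑ k ∈ F, (R ^ 2 + freqSq k) * ‖c k‖ ^ 2) ^ 2 *
          (64 / R ^ 2 * B)) := by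
        rw [mul_pow]
        refine mul_le_mul_of_nonneg_left (h3.trans ?_) (by positivity)
        rw [h5]
        exact mul_le_mul_of_nonneg_left h4 (by positivity)
    _ = _ := by rw [hBdef]; field_simp

/-- Multiplication of a derivative of an `H²` function by a coefficient in `L⁴`. -/
theorem norm_mulOp_weakPartial_le (g : BoundedContinuousFunction Plane ℂ) {f : L2T} (hf : MemH2 f)
    (j : Fin 2) {R : ℝ} (hR : 1 ≤ R) :
    (‖mulOp g (weakPartial j f)‖ ^ 2) ^ 2 ≤
      (2 * Real.pi) ^ 2 * (64 / R ^ 2) * (scaledNorm R f ^ 2) ^ 2 *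
        ∫ x, ‖g x‖ ^ 4 ∂torusMeasure := by
  have ht := ((((mulOp g).continuous.tendsto _).comp (hasSum_weakPartial hf j)).norm.pow 2).pow 2
  refine le_of_tendsto ht (Eventually.of_forall fun F => ?_)
  refine (norm_sq_mulOp_trigSum_le_of_quartic g F _ hR).trans ?_
  refine mul_le_mul_of_nonneg_right (mul_le_mul_of_nonneg_left ?_ (by positivity))
    (integral_nonneg fun _ => by positivity)
  refine pow_le_pow_left₀ (Finset.sum_nonneg fun k _ => ?_) ?_ 2
  · have := freqSq_nonneg k; positivity
  rw [scaledNorm, Real.sq_sqrt (tsum_nonneg fun _ => by positivity)]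
  refine le_trans (Finset.sum_le_sum fun k _ => ?_)
    ((summable_scaled hf hR).sum_le_tsum F fun _ _ => by positivity)
  rw [norm_mul, mul_pow, sq (R ^ 2 + _), mul_assoc]
  have h0 := freqSq_nonneg k
  refine mul_le_mul_of_nonneg_left (mul_le_mul_of_nonneg_right ?_ (by positivity)) (by positivity)
  have h1 : ‖Complex.I * (k j : ℂ)‖ ^ 2 = (k j : ℝ) ^ 2 := by simp
  rw [h1]
  nlinarith [sq_le_freqSq k j, sq_nonneg R]

/-! ### Periodic functions and integration by parts on the torus. -/

/-- Functions on the torus, seen as periodic functions on the plane. -/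
def IsPeriodic {E : Type*} (f : Plane → E) : Prop := ∀ (k : Fin 2 → ℤ) (x : Plane), f (x + period k) = f x

theorem isPeriodic_mode (l : Fin 2 → ℤ) : IsPeriodic (mode l) := by
  intro k x
  have h : Complex.I * ((∑ i, (l i : ℝ) * (x + period k) i : ℝ) : ℂ) =
      Complex.I * ((∑ i, (l i : ℝ) * x i : ℝ) : ℂ) +
        ((∑ i, l i * k i : ℤ) : ℂ) * (2 * Real.pi * Complex.I) := by
    simp only [Fin.sum_univ_two, PiLp.add_apply, period]
    push_cast
    ring
  rw [mode, h, Complex.exp_add, Complex.exp_int_mul_two_pi_mul_I, mul_one, mode]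

theorem exists_add_period_mem_cell (x : Plane) : ∃ k, x + period k ∈ cell := by
  have hp : (0 : ℝ) < 2 * Real.pi := by positivity
  refine ⟨fun i => -toIocDiv hp 0 (x i), fun i => ?_⟩
  have h := toIocMod_mem_Ioc hp 0 (x i)
  rw [← self_sub_toIocDiv_zsmul, zero_add] at h
  convert h using 1
  simp only [PiLp.add_apply, period, zsmul_eq_mul]
  push_cast
  ring

theorem isCompact_closure_cell : IsCompact (closure cell) := by
  have hb : Bornology.IsBounded cell := by
    rw [isBounded_iff_forall_norm_le]
    refine ⟨√(∑ _i : Fin 2, (2 * Real.pi) ^ 2), fun x hx => ?_⟩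
    rw [EuclideanSpace.norm_eq]
    refine Real.sqrt_le_sqrt (Finset.sum_le_sum fun i _ => ?_)
    rw [Real.norm_eq_abs, sq_abs]
    exact pow_le_pow_left₀ (hx i).1.le (hx i).2 2
  exact hb.isCompact_closure

theorem IsPeriodic.exists_bound {E : Type*} [NormedAddCommGroup E] {f : Plane → E}
    (hf : IsPeriodic f) (hc : Continuous f) : ∃ C, ∀ x, ‖f x‖ ≤ C := by
  obtain ⟨C, hC⟩ := isCompact_closure_cell.exists_bound_of_continuousOn hc.continuousOn
  refine ⟨C, fun x => ?_⟩
  obtain ⟨k, hk⟩ := exists_add_period_mem_cell x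
  rw [← hf k x]
  exact hC _ (subset_closure hk)

theorem IsPeriodic.fderiv {E : Type*} [NormedAddCommGroup E] [NormedSpace ℝ E] {f : Plane → E}
    (hf : IsPeriodic f) : IsPeriodic (fderiv ℝ f) := by
  intro k x
  rw [← fderiv_comp_add_right]
  congr 1
  funext y
  exact hf k y

theorem integral_cell_eq {E : Type*} [NormedAddCommGroup E] [NormedSpace ℝ E] (f : Plane → E) :
    ∫ x, f x ∂torusMeasure =
      ∫ x : Fin 2 → ℝ in Set.Icc (fun _ => 0) (fun _ => 2 * Real.pi), f (WithLp.toLp 2 x) := by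
  have h := PiLp.volume_preserving_toLp (Fin 2)
  have he : MeasurableEmbedding (WithLp.toLp 2 : (Fin 2 → ℝ) → Plane) :=
    (MeasurableEquiv.toLp 2 (Fin 2 → ℝ)).measurableEmbedding
  rw [torusMeasure, ← h.setIntegral_preimage_emb he]
  have : (WithLp.toLp 2 : (Fin 2 → ℝ) → Plane) ⁻¹' cell =
      Set.univ.pi fun _ => Set.Ioc (0 : ℝ) (2 * Real.pi) := by
    ext x; simp [cell]
  rw [this]
  exact setIntegral_congr_set Measure.univ_pi_Ioc_ae_eq_Icc

/-- The integral of a derivative over the torus vanishes. -/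
theorem integral_fderiv_eq_zero {f : Plane → ℂ} (hf : IsPeriodic f) (hd : ContDiff ℝ 1 f)
    (j : Fin 2) :
    ∫ x, fderiv ℝ f x (EuclideanSpace.single j 1) ∂torusMeasure = 0 := by
  classical
  let L : (Fin 2 → ℝ) →L[ℝ] Plane := ((PiLp.continuousLinearEquiv 2 ℝ fun _ : Fin 2 => ℝ).symm : (Fin 2 → ℝ) →L[ℝ] Plane)
  have hL : ∀ x, L x = WithLp.toLp 2 x := fun x => rfl
  rw [integral_cell_eq]
  -- The divergence theorem on `[0, 2π]²` is applied to the field whose only nonzero component is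
  -- `f` in direction `j`; opposite faces cancel by periodicity.
  let G : Fin 2 → (Fin 2 → ℝ) → ℂ := fun i x => if i = j then f (L x) else 0
  let G' : Fin 2 → (Fin 2 → ℝ) → (Fin 2 → ℝ) →L[ℝ] ℂ := fun i x =>
    if i = j then (fderiv ℝ f (L x)).comp L else 0
  have hfd : Continuous (fderiv ℝ f) := hd.continuous_fderiv one_ne_zero
  have hsum : ∀ x, ∑ i, G' i x (Pi.single i 1) = fderiv ℝ f (L x) (EuclideanSpace.single j 1) := by
    intro x
    rw [Finset.sum_eq_single j]
    · simp only [G', if_true, ContinuousLinearMap.comp_apply]; rfl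
    · intro i _ hij; simp [G', hij]
    · simp
  have key := integral_divergence_of_hasFDerivAt_off_countable' (n := 1) (fun _ => (0 : ℝ)) (fun _ => 2 * Real.pi)
    (fun _ => by positivity) G G' ∅ Set.countable_empty (fun i => ?_) (fun x _ i => ?_) ?_
  · simp only [hsum] at key
    refine key.trans (Finset.sum_eq_zero fun i _ => ?_)
    rw [sub_eq_zero]
    refine integral_congr_ae (Eventually.of_forall fun x => ?_)
    simp only [G]
    split_ifs with hij
    · have : L (i.insertNth (2 * Real.pi) x) = L (i.insertNth 0 x) + period (Pi.single i 1) := by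
        ext l
        simp only [hL, PiLp.add_apply, period]
        rcases Fin.eq_self_or_eq_succAbove i l with rfl | ⟨l, rfl⟩
        · simp
        · simp
      rw [this, hf]
    · rfl
  · simp only [G]
    split_ifs
    · exact (hd.continuous.comp L.continuous).continuousOn
    · exact continuousOn_const
  · simp only [G, G']
    split_ifs
    · exact ((hd.differentiable one_ne_zero).differentiableAt.hasFDerivAt).comp x L.hasFDerivAt
    · exact hasFDerivAt_const _ _
  · simp only [hsum]
    refine Continuous.integrableOn_Icc ?_
    exact (hfd.comp L.continuous).clm_apply continuous_const

/-- A continuous periodic function is a bounded continuous function. -/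
noncomputable def IsPeriodic.toBCF {f : Plane → ℂ} (hf : IsPeriodic f) (hc : Continuous f) :
    BoundedContinuousFunction Plane ℂ :=
  BoundedContinuousFunction.ofNormedAddCommGroup f hc (hf.exists_bound hc).choose
    (hf.exists_bound hc).choose_spec

theorem hasFDerivAt_mode (k : Fin 2 → ℤ) (x : Plane) :
    HasFDerivAt (mode k) ((Complex.I * mode k x) • (Complex.ofRealCLM.comp
      (∑ i, (k i : ℝ) • (EuclideanSpace.proj i : Plane →L[ℝ] ℝ)))) x := by
  have h1 : HasFDerivAt (fun x : Plane => ((∑ i, (k i : ℝ) * x i : ℝ) : ℂ))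
      (Complex.ofRealCLM.comp (∑ i, (k i : ℝ) • (EuclideanSpace.proj i : Plane →L[ℝ] ℝ))) x := by
    have := (Complex.ofRealCLM.comp
      (∑ i, (k i : ℝ) • (EuclideanSpace.proj i : Plane →L[ℝ] ℝ))).hasFDerivAt (x := x)
    convert this using 1
    funext y
    simp [Fin.sum_univ_two]
  have h2 := (h1.const_mul Complex.I).cexp
  refine HasFDerivAt.congr_fderiv (f := mode k) h2 ?_
  rw [smul_smul, mul_comm]
  rfl

theorem fderiv_mode_single (k : Fin 2 → ℤ) (x : Plane) (j : Fin 2) :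
    fderiv ℝ (mode k) x (EuclideanSpace.single j 1) = Complex.I * (k j : ℂ) * mode k x := by
  rw [(hasFDerivAt_mode k x).fderiv]
  simp only [smul_apply, ContinuousLinearMap.comp_apply, smul_eq_mul]
  fin_cases j <;> simp [Fin.sum_univ_two] <;> ring

theorem contDiff_mode (k : Fin 2 → ℤ) {n : WithTop ℕ∞} : ContDiff ℝ n (mode k) := by
  have h : ContDiff ℝ n fun x : Plane => ∑ i, (k i : ℝ) * x i :=
    ContDiff.sum fun i _ => contDiff_const.mul (EuclideanSpace.proj i : Plane →L[ℝ] ℝ).contDiff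
  have h2 : ContDiff ℝ n fun x : Plane => ((∑ i, (k i : ℝ) * x i : ℝ) : ℂ) :=
    Complex.ofRealCLM.contDiff.comp h
  exact (contDiff_const.mul h2).cexp

theorem gradient_apply (Y : Plane → ℝ) (x : Plane) (j : Fin 2) :
    gradient Y x j = fderiv ℝ Y x (EuclideanSpace.single j 1) := by
  rw [← inner_gradient_left, EuclideanSpace.inner_single_right]
  simp

/-! ### The coefficients of the equation and the weight `exp(-2Y)`. -/

/-- The coefficients of the linear equation associated with a `C¹` potential on the torus. -/
structure IsC1Potential (Y : Plane → ℝ) : Prop where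
  periodic : IsPeriodic Y
  contDiff : ContDiff ℝ 1 Y

namespace IsC1Potential

variable {Y : Plane → ℝ} (hY : IsC1Potential Y)
include hY

theorem continuous_gradient : Continuous (gradient Y) :=
  (InnerProductSpace.toDual ℝ Plane).symm.continuous.comp (hY.contDiff.continuous_fderiv one_ne_zero)

theorem periodic_gradient : IsPeriodic (gradient Y) := fun k x => by
  rw [gradient, gradient, hY.periodic.fderiv k x]

theorem exists_grad (j : Fin 2) :
    ∃ g : BoundedContinuousFunction Plane ℂ, ∀ x, g x = ((gradient Y x j : ℝ) : ℂ) := by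
  have hc : Continuous fun x => ((gradient Y x j : ℝ) : ℂ) := by
    have := hY.continuous_gradient
    fun_prop
  exact ⟨IsPeriodic.toBCF (f := fun x => ((gradient Y x j : ℝ) : ℂ))
    (fun k x => by simp only [hY.periodic_gradient k x]) hc, fun x => rfl⟩

/-- The component `∂_j Y` as a bounded continuous function. -/
noncomputable def grad (j : Fin 2) : BoundedContinuousFunction Plane ℂ := (hY.exists_grad j).choose

theorem grad_apply (j : Fin 2) (x : Plane) : hY.grad j x = ((gradient Y x j : ℝ) : ℂ) :=
  (hY.exists_grad j).choose_spec x

theorem exists_pot (C : ℝ) :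
    ∃ g : BoundedContinuousFunction Plane ℂ, ∀ x, g x = ((‖gradient Y x‖ ^ 2 - C : ℝ) : ℂ) := by
  have hc : Continuous fun x => ((‖gradient Y x‖ ^ 2 - C : ℝ) : ℂ) := by
    have := hY.continuous_gradient
    fun_prop
  exact ⟨IsPeriodic.toBCF (f := fun x => ((‖gradient Y x‖ ^ 2 - C : ℝ) : ℂ))
    (fun k x => by simp only [hY.periodic_gradient k x]) hc, fun x => rfl⟩

/-- The potential `|∇Y|² - C` as a bounded continuous function. -/
noncomputable def pot (C : ℝ) : BoundedContinuousFunction Plane ℂ := (hY.exists_pot C).choose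

theorem pot_apply (C : ℝ) (x : Plane) : hY.pot C x = ((‖gradient Y x‖ ^ 2 - C : ℝ) : ℂ) :=
  (hY.exists_pot C).choose_spec x

theorem exists_weight :
    ∃ g : BoundedContinuousFunction Plane ℂ, ∀ x, g x = ((Real.exp (-2 * Y x) : ℝ) : ℂ) := by
  have hc : Continuous fun x => ((Real.exp (-2 * Y x) : ℝ) : ℂ) := by
    have := hY.contDiff.continuous
    fun_prop
  exact ⟨IsPeriodic.toBCF (f := fun x => ((Real.exp (-2 * Y x) : ℝ) : ℂ))
    (fun k x => by simp only [hY.periodic k x]) hc, fun x => rfl⟩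

/-- The density `exp(-2Y)` of the conserved mass. -/
noncomputable def weight : BoundedContinuousFunction Plane ℂ := hY.exists_weight.choose

theorem weight_apply (x : Plane) : hY.weight x = ((Real.exp (-2 * Y x) : ℝ) : ℂ) :=
  hY.exists_weight.choose_spec x

/-- The integral of `∂_j (exp(-2Y) e_n)` vanishes; the product rule then trades a factor `∂_j Y` for
`i n_j / 2`. -/
theorem integral_by_parts (n : Fin 2 → ℤ) (j : Fin 2) :
    ∫ x, hY.weight x * (hY.grad j x * mode n x) ∂torusMeasure =
      Complex.I * (n j : ℂ) / 2 * ∫ x, hY.weight x * mode n x ∂torusMeasure := by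
  have hw : ContDiff ℝ 1 fun x => ((Real.exp (-2 * Y x) : ℝ) : ℂ) :=
    Complex.ofRealCLM.contDiff.comp (contDiff_const.mul hY.contDiff).exp
  have hper : IsPeriodic fun x => ((Real.exp (-2 * Y x) : ℝ) : ℂ) * mode n x := fun k x => by
    simp only [hY.periodic k x, isPeriodic_mode n k x]
  have key := integral_fderiv_eq_zero hper (hw.mul (contDiff_mode n)) j
  have hd : ∀ x, fderiv ℝ (fun x => ((Real.exp (-2 * Y x) : ℝ) : ℂ) * mode n x) x
      (EuclideanSpace.single j 1) =
      Complex.I * (n j : ℂ) * (hY.weight x * mode n x) -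
        2 * (hY.weight x * (hY.grad j x * mode n x)) := by
    intro x
    have h1 : HasFDerivAt (fun x => ((Real.exp (-2 * Y x) : ℝ) : ℂ))
        (Complex.ofRealCLM.comp (Real.exp (-2 * Y x) • ((-2 : ℝ) • fderiv ℝ Y x))) x :=
      Complex.ofRealCLM.hasFDerivAt.comp x
        (((hY.contDiff.differentiable one_ne_zero).differentiableAt.hasFDerivAt.const_mul (-2)).exp)
    have h3 : fderiv ℝ (fun x => ((Real.exp (-2 * Y x) : ℝ) : ℂ) * mode n x) x = _ :=
      (h1.mul (hasFDerivAt_mode n x)).fderiv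
    rw [h3, ← (hasFDerivAt_mode n x).fderiv]
    simp only [add_apply, smul_apply, fderiv_mode_single,
      ContinuousLinearMap.comp_apply, Complex.ofRealCLM_apply, smul_eq_mul, hY.weight_apply,
      hY.grad_apply, gradient_apply]
    push_cast
    ring
  simp only [hd] at key
  rw [integral_sub, integral_const_mul, integral_const_mul, sub_eq_zero] at key
  · rw [div_mul_eq_mul_div, key, mul_div_cancel_left₀ _ two_ne_zero]
  · refine Integrable.const_mul (integrable_bcf (C := ‖hY.weight‖ * 1) ?_ fun x => ?_) _
    · exact hY.weight.continuous.mul (continuous_mode n)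
    · rw [norm_mul, norm_mode]
      exact mul_le_mul_of_nonneg_right (hY.weight.norm_coe_le_norm x) zero_le_one
  · refine Integrable.const_mul (integrable_bcf (C := ‖hY.weight‖ * (‖hY.grad j‖ * 1)) ?_ fun x => ?_) _
    · exact hY.weight.continuous.mul ((hY.grad j).continuous.mul (continuous_mode n))
    · rw [norm_mul, norm_mul, norm_mode]
      have := hY.weight.norm_coe_le_norm x
      have := (hY.grad j).norm_coe_le_norm x
      gcongr

end IsC1Potential

theorem inner_modeL2_mulOp (g : BoundedContinuousFunction Plane ℂ) (k l : Fin 2 → ℤ) :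
    inner ℂ (modeL2 k) (mulOp g (modeL2 l)) = ∫ x, g x * mode (l - k) x ∂torusMeasure := by
  rw [L2.inner_def]
  refine integral_congr_ae ?_
  filter_upwards [coeFn_mulOp g (modeL2 l), coeFn_modeL2 k, coeFn_modeL2 l] with x h1 h2 h3
  rw [h1, h2, h3, RCLike.inner_apply, conj_mode, sub_eq_add_neg, mode_add]
  ring

theorem inner_modeL2_mulOp_mulOp (w g : BoundedContinuousFunction Plane ℂ) (k l : Fin 2 → ℤ) :
    inner ℂ (modeL2 k) (mulOp w (mulOp g (modeL2 l))) =
      ∫ x, w x * (g x * mode (l - k) x) ∂torusMeasure := by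
  rw [L2.inner_def]
  refine integral_congr_ae ?_
  filter_upwards [coeFn_mulOp w (mulOp g (modeL2 l)), coeFn_mulOp g (modeL2 l), coeFn_modeL2 k,
    coeFn_modeL2 l] with x h0 h1 h2 h3
  rw [h0, h1, h2, h3, RCLike.inner_apply, conj_mode, sub_eq_add_neg, mode_add]
  ring

theorem freqSq_cast (k : Fin 2 → ℤ) : (freqSq k : ℂ) = ∑ j, (k j : ℂ) ^ 2 := by
  simp [freqSq]

namespace IsC1Potential

variable {Y : Plane → ℝ} (hY : IsC1Potential Y)
include hY

/-- The identity `Δ - 2∇Y·∇ = exp(2Y) div(exp(-2Y) ∇)` tested on modes: `integral_by_parts` at `n =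
l - k` eliminates the drift, and `-|l|² + l·(l - k) = -k·l`. -/
theorem form_modes (k l : Fin 2 → ℤ) :
    -(freqSq l : ℂ) * inner ℂ (modeL2 k) (mulOp hY.weight (modeL2 l)) -
      2 * ∑ j, Complex.I * (l j : ℂ) *
        inner ℂ (modeL2 k) (mulOp hY.weight (mulOp (hY.grad j) (modeL2 l))) =
    -∑ j, (k j : ℂ) * (l j : ℂ) * inner ℂ (modeL2 k) (mulOp hY.weight (modeL2 l)) := by
  simp only [inner_modeL2_mulOp_mulOp, hY.integral_by_parts, inner_modeL2_mulOp, freqSq_cast,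
    Fin.sum_univ_two, Pi.sub_apply]
  push_cast
  ring_nf
  simp only [Complex.I_sq]
  ring

theorem form_trigSum (F : Finset (Fin 2 → ℤ)) (c : (Fin 2 → ℤ) → ℂ) :
    inner ℂ (∑ k ∈ F, c k • modeL2 k) (mulOp hY.weight
      ((∑ k ∈ F, (-(freqSq k : ℂ) * c k) • modeL2 k) -
        (2 : ℂ) • ∑ j, mulOp (hY.grad j) (∑ k ∈ F, (Complex.I * (k j : ℂ) * c k) • modeL2 k))) =
    -∑ j, inner ℂ (∑ k ∈ F, (Complex.I * (k j : ℂ) * c k) • modeL2 k)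
      (mulOp hY.weight (∑ k ∈ F, (Complex.I * (k j : ℂ) * c k) • modeL2 k)) := by
  have hL : ∀ k ∈ F, inner ℂ (c k • modeL2 k) (mulOp hY.weight
      ((∑ k ∈ F, (-(freqSq k : ℂ) * c k) • modeL2 k) -
        (2 : ℂ) • ∑ j, mulOp (hY.grad j) (∑ k ∈ F, (Complex.I * (k j : ℂ) * c k) • modeL2 k))) =
      ∑ l ∈ F, (starRingEnd ℂ) (c k) * c l *
        (-∑ j, (k j : ℂ) * (l j : ℂ) * inner ℂ (modeL2 k) (mulOp hY.weight (modeL2 l))) := by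
    intro k _
    simp only [fun l => (hY.form_modes k l).symm]
    simp only [map_add, map_sub, map_smul, map_sum, inner_sub_right, inner_smul_left,
      inner_smul_right, inner_sum, Fin.sum_univ_two, inner_add_right]
    rw [← Finset.sum_add_distrib, Finset.mul_sum, ← Finset.sum_sub_distrib]
    refine Finset.sum_congr rfl fun l _ => ?_
    ring
  rw [sum_inner, Finset.sum_congr rfl hL, ← Finset.sum_neg_distrib]
  have hR : ∀ j : Fin 2, -inner ℂ (∑ k ∈ F, (Complex.I * (k j : ℂ) * c k) • modeL2 k)
      (mulOp hY.weight (∑ k ∈ F, (Complex.I * (k j : ℂ) * c k) • modeL2 k)) =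
      ∑ k ∈ F, ∑ l ∈ F, (starRingEnd ℂ) (c k) * c l *
        (-((k j : ℂ) * (l j : ℂ) * inner ℂ (modeL2 k) (mulOp hY.weight (modeL2 l)))) := by
    intro j
    simp only [map_sum, map_smul, sum_inner, inner_sum, inner_smul_left, inner_smul_right, map_mul,
      Complex.conj_I, map_intCast]
    rw [← Finset.sum_neg_distrib]
    simp only [Finset.mul_sum, ← Finset.sum_neg_distrib]
    rw [Finset.sum_comm]
    refine Finset.sum_congr rfl fun k _ => Finset.sum_congr rfl fun l _ => ?_
    ring_nf
    simp only [Complex.I_sq]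
    ring
  simp only [hR, Fin.sum_univ_two, ← Finset.sum_add_distrib]
  refine Finset.sum_congr rfl fun k _ => Finset.sum_congr rfl fun l _ => ?_
  ring

/-- The energy identity. -/
theorem form_eq {f : L2T} (hf : MemH2 f) :
    inner ℂ f (mulOp hY.weight (weakLaplacian f -
      (2 : ℂ) • ∑ j, mulOp (hY.grad j) (weakPartial j f))) =
    -∑ j, inner ℂ (weakPartial j f) (mulOp hY.weight (weakPartial j f)) := by
  have h0 := hasSum_coeff_smul_modeL2 f
  have h1 := hasSum_weakLaplacian hf
  have h2 := fun j => hasSum_weakPartial hf j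
  -- The Fourier series of `f`, of its derivatives and of its Laplacian converge in `L²`, where all
  -- the multiplications are continuous; the identity for partial sums therefore passes to the
  -- limit.
  have hL := Filter.Tendsto.inner (𝕜 := ℂ) h0 (((mulOp hY.weight).continuous.tendsto _).comp
    (Tendsto.sub h1 ((tendsto_finsetSum Finset.univ fun j _ =>
      ((mulOp (hY.grad j)).continuous.tendsto _).comp (h2 j)).const_smul (2 : ℂ))))
  have hR := (tendsto_finsetSum Finset.univ fun j _ => Filter.Tendsto.inner (𝕜 := ℂ) (h2 j)
    (((mulOp hY.weight).continuous.tendsto _).comp (h2 j))).neg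
  refine tendsto_nhds_unique hL (hR.congr fun F => ?_)
  exact (hY.form_trigSum F (coeff f)).symm

end IsC1Potential

theorem inner_mulOp_left {g : BoundedContinuousFunction Plane ℂ}
    (hg : ∀ x, (starRingEnd ℂ) (g x) = g x) (f h : L2T) :
    inner ℂ (mulOp g f) h = inner ℂ f (mulOp g h) := by
  rw [L2.inner_def, L2.inner_def]
  refine integral_congr_ae ?_
  filter_upwards [coeFn_mulOp g f, coeFn_mulOp g h] with x h1 h2
  rw [h1, h2, RCLike.inner_apply, RCLike.inner_apply, map_mul, hg]
  ring

theorem mulOp_comm (g h : BoundedContinuousFunction Plane ℂ) (f : L2T) :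
    mulOp g (mulOp h f) = mulOp h (mulOp g f) := by
  refine Lp.ext ?_
  filter_upwards [coeFn_mulOp g f, coeFn_mulOp h f, coeFn_mulOp g (mulOp h f),
    coeFn_mulOp h (mulOp g f)] with x h1 h2 h3 h4
  rw [h3, h4, h1, h2]
  ring

theorem volume_cell : volume.real cell = (2 * Real.pi) ^ 2 := by
  have h := integral_mode 0
  simp only [mode_zero, if_true, integral_const, torusMeasure, measureReal_restrict_apply_univ,
    Complex.real_smul, mul_one] at h
  exact_mod_cast h

theorem integral_torus_const (c : ℝ) : ∫ _, c ∂torusMeasure = (2 * Real.pi) ^ 2 * c := by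
  rw [integral_const, torusMeasure, measureReal_restrict_apply_univ, volume_cell, smul_eq_mul]

/-! ### Conservation of the weighted mass. -/

namespace IsC1Potential

variable {Y : Plane → ℝ} (hY : IsC1Potential Y)
include hY

theorem conj_weight (x : Plane) : (starRingEnd ℂ) (hY.weight x) = hY.weight x := by
  rw [hY.weight_apply, Complex.conj_ofReal]

theorem conj_pot (C : ℝ) (x : Plane) : (starRingEnd ℂ) (hY.pot C x) = hY.pot C x := by
  rw [hY.pot_apply, Complex.conj_ofReal]

/-- The terms of lower order of the equation. -/
noncomputable def lower (C : ℝ) (f : L2T) : L2T :=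
  -((2 : ℂ) • ∑ j, mulOp (hY.grad j) (weakPartial j f)) + mulOp (hY.pot C) f

/-- The generator of the equation. -/
noncomputable def generator (C : ℝ) (f : L2T) : L2T := weakLaplacian f + hY.lower C f

theorem generator_sub (C : ℝ) {f g : L2T} (hf : MemH2 f) (hg : MemH2 g) :
    hY.generator C (f - g) = hY.generator C f - hY.generator C g := by
  simp only [generator, lower, weakLaplacian_sub hf hg, weakPartial_sub hf hg, map_sub,
    Finset.sum_sub_distrib, smul_sub]
  abel

theorem im_inner_weight_self (f : L2T) : (inner ℂ f (mulOp hY.weight f)).im = 0 := by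
  rw [← Complex.conj_eq_iff_im, inner_conj_symm, inner_mulOp_left hY.conj_weight]

/-- In the weighted inner product the second order part yields minus a sum of weighted squares by
`form_eq`, and the potential is real, so both contributions are real. -/
theorem im_inner_weight_generator (C : ℝ) {f : L2T} (hf : MemH2 f) :
    (inner ℂ f (mulOp hY.weight (hY.generator C f))).im = 0 := by
  have h1 : hY.generator C f = (weakLaplacian f -
      (2 : ℂ) • ∑ j, mulOp (hY.grad j) (weakPartial j f)) + mulOp (hY.pot C) f := by
    rw [generator, lower]; abel
  have h2 : (inner ℂ f (mulOp hY.weight (mulOp (hY.pot C) f))).im = 0 := by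
    rw [← Complex.conj_eq_iff_im, inner_conj_symm, inner_mulOp_left hY.conj_weight,
      inner_mulOp_left (hY.conj_pot C), mulOp_comm]
  rw [h1, map_add, inner_add_right, hY.form_eq hf, Complex.add_im, h2, add_zero, Complex.neg_im,
    Complex.im_sum]
  simp only [hY.im_inner_weight_self, Finset.sum_const_zero, neg_zero]

/-- The conserved mass. -/
noncomputable def mass (f : L2T) : ℝ := (inner ℂ f (mulOp hY.weight f)).re

theorem continuous_mass : Continuous hY.mass :=
  Complex.continuous_re.comp (continuous_id.inner (mulOp hY.weight).continuous)

theorem mass_smul (r : ℝ) (f : L2T) : hY.mass (r • f) = r ^ 2 * hY.mass f := by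
  have : r • f = (r : ℂ) • f := (Complex.coe_smul r f).symm
  rw [mass, mass, this, map_smul, inner_smul_left, inner_smul_right, Complex.conj_ofReal,
    ← mul_assoc, ← Complex.ofReal_mul, Complex.re_ofReal_mul, sq]

theorem mass_eq_integral (f : L2T) :
    hY.mass f = ∫ x, Real.exp (-2 * Y x) * ‖f x‖ ^ 2 ∂torusMeasure := by
  have h1 : inner ℂ f (mulOp hY.weight f) =
      ∫ x, ((Real.exp (-2 * Y x) * ‖f x‖ ^ 2 : ℝ) : ℂ) ∂torusMeasure := by
    rw [L2.inner_def]
    refine integral_congr_ae ?_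
    filter_upwards [coeFn_mulOp hY.weight f] with x hx
    rw [hx, RCLike.inner_apply, hY.weight_apply, mul_assoc, Complex.mul_conj']
    push_cast
    ring
  rw [mass, h1, integral_complex_ofReal, Complex.ofReal_re]

theorem mass_bounds {S : ℝ} (hS : ∀ x, |Y x| ≤ S) (f : L2T) :
    Real.exp (-2 * S) * ‖f‖ ^ 2 ≤ hY.mass f ∧ hY.mass f ≤ Real.exp (2 * S) * ‖f‖ ^ 2 := by
  have hi : Integrable (fun x => ‖f x‖ ^ 2) torusMeasure := (Lp.memLp f).integrable_norm_pow two_ne_zero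
  have hw : Integrable (fun x => Real.exp (-2 * Y x) * ‖f x‖ ^ 2) torusMeasure := by
    refine hi.bdd_mul (c := Real.exp (2 * S)) ?_ (Eventually.of_forall fun x => ?_)
    · exact (Real.continuous_exp.comp (continuous_const.mul hY.contDiff.continuous)).aestronglyMeasurable
    · rw [Real.norm_of_nonneg (Real.exp_pos _).le]
      exact Real.exp_le_exp.2 (by linarith [neg_le_of_abs_le (hS x)])
  rw [hY.mass_eq_integral, norm_sq_eq_integral, ← integral_const_mul, ← integral_const_mul]
  constructor
  · refine integral_mono (hi.const_mul _) hw fun x => ?_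
    exact mul_le_mul_of_nonneg_right (Real.exp_le_exp.2 (by linarith [le_of_abs_le (hS x)]))
      (by positivity)
  · refine integral_mono hw (hi.const_mul _) fun x => ?_
    exact mul_le_mul_of_nonneg_right (Real.exp_le_exp.2 (by linarith [neg_le_of_abs_le (hS x)]))
      (by positivity)

theorem norm_le_of_mass_eq {S : ℝ} (hS : ∀ x, |Y x| ≤ S) {f g : L2T} (h : hY.mass f = hY.mass g) :
    ‖f‖ ≤ Real.exp (2 * S) * ‖g‖ := by
  have h1 := (hY.mass_bounds hS f).1
  have h2 := (hY.mass_bounds hS g).2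
  refine le_of_sq_le_sq ?_ (by positivity)
  have h3 : Real.exp (-2 * S) * Real.exp (2 * S) = 1 := by
    rw [← Real.exp_add]; ring_nf; exact Real.exp_zero
  have h4 : Real.exp (-2 * S) * ‖f‖ ^ 2 ≤ Real.exp (2 * S) * ‖g‖ ^ 2 := by linarith
  have h5 := mul_le_mul_of_nonneg_left h4 (Real.exp_pos (2 * S)).le
  calc ‖f‖ ^ 2 = Real.exp (2 * S) * (Real.exp (-2 * S) * ‖f‖ ^ 2) := by
        rw [← mul_assoc, mul_comm (Real.exp (2 * S)), h3, one_mul]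
    _ ≤ _ := h5
    _ = _ := by ring

/-- A curve in `H²` with `i u' = generator u`. -/
def Evolves (C T : ℝ) (u : ℝ → L2T) : Prop :=
  ∀ t ∈ Set.Icc 0 T, MemH2 (u t) ∧
    ∃ w : L2T, HasDerivWithinAt u w (Set.Icc 0 T) t ∧ Complex.I • w = hY.generator C (u t)

theorem evolves_of_isSolution {C T : ℝ} {v : ℝ → L2T} (hv : IsSolution Y C T v) :
    hY.Evolves C T v := by
  intro t ht
  obtain ⟨w, hw, he⟩ := hv.equation t ht
  refine ⟨hv.memH2 t ht, w, hw, Lp.ext ?_⟩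
  rw [generator, lower, Fin.sum_univ_two]
  filter_upwards [he, Lp.coeFn_smul Complex.I w,
    Lp.coeFn_add (weakLaplacian (v t)) (-((2 : ℂ) • (mulOp (hY.grad 0) (weakPartial 0 (v t)) +
      mulOp (hY.grad 1) (weakPartial 1 (v t)))) + mulOp (hY.pot C) (v t)),
    Lp.coeFn_add (-((2 : ℂ) • (mulOp (hY.grad 0) (weakPartial 0 (v t)) +
      mulOp (hY.grad 1) (weakPartial 1 (v t))))) (mulOp (hY.pot C) (v t)),
    Lp.coeFn_neg ((2 : ℂ) • (mulOp (hY.grad 0) (weakPartial 0 (v t)) +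
      mulOp (hY.grad 1) (weakPartial 1 (v t)))),
    Lp.coeFn_smul (2 : ℂ) (mulOp (hY.grad 0) (weakPartial 0 (v t)) +
      mulOp (hY.grad 1) (weakPartial 1 (v t))),
    Lp.coeFn_add (mulOp (hY.grad 0) (weakPartial 0 (v t))) (mulOp (hY.grad 1) (weakPartial 1 (v t))),
    coeFn_mulOp (hY.grad 0) (weakPartial 0 (v t)), coeFn_mulOp (hY.grad 1) (weakPartial 1 (v t)),
    coeFn_mulOp (hY.pot C) (v t)] with x h0 h1 h2 h3 h4 h5 h6 h7 h8 h9
  rw [h1, Pi.smul_apply, smul_eq_mul, h0, h2, Pi.add_apply, h3, Pi.add_apply, h4, Pi.neg_apply, h5,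
    Pi.smul_apply, h6, Pi.add_apply, h7, h8, h9, hY.grad_apply, hY.grad_apply, hY.pot_apply,
    Fin.sum_univ_two, smul_eq_mul]
  ring

/-- The derivative of `⟨u, exp(-2Y) u⟩` is `2 Re(-i ⟨u, exp(-2Y) G u⟩) = 2 Im ⟨u, exp(-2Y) G u⟩`,
which vanishes. -/
theorem mass_eq_of_evolves {C T : ℝ} {u : ℝ → L2T} (hu : hY.Evolves C T u) {t : ℝ}
    (ht : t ∈ Set.Icc 0 T) : hY.mass (u t) = hY.mass (u 0) := by
  have hd : ∀ s ∈ Set.Icc 0 T,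
      HasDerivWithinAt (fun s => inner ℂ (u s) (mulOp hY.weight (u s))) 0 (Set.Icc 0 T) s := by
    intro s hs
    obtain ⟨hm, w, hw, he⟩ := hu s hs
    have h1 : HasDerivWithinAt (fun s => mulOp hY.weight (u s)) (mulOp hY.weight w) (Set.Icc 0 T) s :=
      (((mulOp hY.weight).restrictScalars ℝ).hasFDerivAt).comp_hasDerivWithinAt s hw
    have h2 := hw.inner ℂ h1
    refine h2.congr_deriv ?_
    have hwe : w = -Complex.I • hY.generator C (u s) := by
      rw [← he, smul_smul]; simp
    have h3 : inner ℂ w (mulOp hY.weight (u s)) =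
        (starRingEnd ℂ) (inner ℂ (u s) (mulOp hY.weight w)) := by
      rw [inner_conj_symm, inner_mulOp_left hY.conj_weight]
    rw [h3, Complex.add_conj, hwe, map_smul, inner_smul_right]
    have h4 := hY.im_inner_weight_generator C hm
    simp [h4]
  have := constant_of_derivWithin_zero (fun s hs => (hd s hs).differentiableWithinAt)
    (fun s hs => (hd s (Set.Ico_subset_Icc_self hs)).derivWithin
      (uniqueDiffOn_Icc (hs.1.trans_lt hs.2) s (Set.Ico_subset_Icc_self hs))) t ht
  rw [mass, mass, this]

/-- Invariance in time and linearity. Mass conservation for these differences gives it for the time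
derivative, with no need for a second time derivative or for `u'` to lie in `H²`. -/
theorem Evolves.shift_sub {C T : ℝ} {u : ℝ → L2T} (hu : hY.Evolves C T u) {h : ℝ} (h0 : 0 ≤ h) :
    hY.Evolves C (T - h) fun s => u (s + h) - u s := by
  intro s hs
  have hs1 : s + h ∈ Set.Icc 0 T := ⟨by linarith [hs.1], by linarith [hs.2]⟩
  have hs2 : s ∈ Set.Icc 0 T := ⟨hs.1, by linarith [hs.2]⟩
  obtain ⟨hm1, w1, hw1, he1⟩ := hu _ hs1
  obtain ⟨hm2, w2, hw2, he2⟩ := hu _ hs2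
  refine ⟨hm1.sub hm2, w1 - w2, ?_, ?_⟩
  · have hmaps : Set.MapsTo (fun s => s + h) (Set.Icc 0 (T - h)) (Set.Icc 0 T) :=
      fun x hx => ⟨by linarith [hx.1], by linarith [hx.2]⟩
    have h1 := HasDerivWithinAt.scomp s hw1 ((hasDerivWithinAt_id s (Set.Icc 0 (T - h))).add_const h) hmaps
    rw [one_smul] at h1
    exact h1.sub (hw2.mono fun x hx => ⟨hx.1, by linarith [hx.2]⟩)
  · rw [smul_sub, he1, he2, hY.generator_sub C hm1 hm2]

/-- The mass of the time derivative is conserved. -/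
theorem mass_deriv_eq {C T : ℝ} {u : ℝ → L2T} (hu : hY.Evolves C T u) {t : ℝ}
    (ht : t ∈ Set.Ioc 0 T) {w w₀ : L2T} (hw : HasDerivWithinAt u w (Set.Icc 0 T) t)
    (hw₀ : HasDerivWithinAt u w₀ (Set.Icc 0 T) 0) : hY.mass w = hY.mass w₀ := by
  rw [hasDerivWithinAt_iff_tendsto_slope] at hw hw₀
  have hsmall : ∀ᶠ h in 𝓝[>] (0 : ℝ), h ∈ Set.Ioo 0 t := Ioo_mem_nhdsGT ht.1
  -- The derivative at `t` is taken from the left, which allows `t = T`, and the one at `0` from the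
  -- right, with the same step `h`. By `shift_sub` the increments `u(t) - u(t - h)` and `u(h) -
  -- u(0)` have equal mass.
  have ha : Tendsto (fun h : ℝ => t - h) (𝓝[>] 0) (𝓝[Set.Icc 0 T \ {t}] t) := by
    refine tendsto_nhdsWithin_iff.2 ⟨?_, ?_⟩
    · have : Tendsto (fun h : ℝ => t - h) (𝓝 0) (𝓝 (t - 0)) := by
        exact (continuous_const.sub continuous_id).tendsto 0
      rw [sub_zero] at this
      exact this.mono_left nhdsWithin_le_nhds
    · filter_upwards [hsmall] with h hh
      exact ⟨⟨by linarith [hh.2], by linarith [hh.1, ht.2]⟩, fun he => by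
        have : t - h = t := he
        linarith [hh.1]⟩
  have hb : Tendsto (fun h : ℝ => h) (𝓝[>] 0) (𝓝[Set.Icc 0 T \ {0}] 0) := by
    refine tendsto_nhdsWithin_iff.2 ⟨tendsto_id.mono_left nhdsWithin_le_nhds, ?_⟩
    filter_upwards [hsmall] with h hh
    exact ⟨⟨hh.1.le, hh.2.le.trans ht.2⟩, hh.1.ne'⟩
  have h1 := (hY.continuous_mass.tendsto w).comp (hw.comp ha)
  have h2 := (hY.continuous_mass.tendsto w₀).comp (hw₀.comp hb)
  refine tendsto_nhds_unique h1 (h2.congr' ?_)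
  filter_upwards [hsmall] with h hh
  have key := hY.mass_eq_of_evolves (Evolves.shift_sub hY hu hh.1.le) (t := t - h)
    ⟨by linarith [hh.2], by linarith [ht.2]⟩
  simp only [sub_add_cancel, zero_add] at key
  simp only [Function.comp_apply, slope_def_module, hY.mass_smul]
  rw [sub_zero, ← key]
  have e1 : t - h - t = -h := by ring
  have e2 : u (t - h) - u t = (-1 : ℝ) • (u t - u (t - h)) := by rw [neg_one_smul, neg_sub]
  rw [e1, e2, hY.mass_smul, inv_neg]
  ring

/-! ### The deterministic `H²` estimate. -/

/-- The constant is `655360 = 40 · 64 · 4⁴`: since `(2π)² ≤ 40`, it makes each product `∂_j Y ∂_j f`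
at most `1/4` of `scaledNorm R f`, and it is more than enough to keep the potential term below
`1/2`. The total is `3/2` of `scaledNorm`, and `scaledNorm_le` doubles this to the factor `3`. -/
theorem norm_lower_le {C : ℝ} {f : L2T} (hf : MemH2 f) {R : ℝ} (hR : 1 ≤ R)
    (hRH : 655360 * ((∫ x, ‖gradient Y x‖ ^ 4 ∂torusMeasure) + C ^ 2) ≤ R ^ 2) :
    ‖hY.lower C f‖ ≤ 3 * (R ^ 2 * ‖f‖ + h2Norm f) := by
  set H := ∫ x, ‖gradient Y x‖ ^ 4 ∂torusMeasure with hH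
  have hH0 : 0 ≤ H := integral_nonneg fun _ => by positivity
  have hpi : (2 * Real.pi) ^ 2 ≤ 40 := by nlinarith [Real.pi_lt_d2, Real.pi_pos]
  have hgc := hY.continuous_gradient
  have hgper : IsPeriodic fun x => ‖gradient Y x‖ := fun k x => by
    simp only [hY.periodic_gradient k x]
  obtain ⟨B, hB⟩ := hgper.exists_bound hgc.norm
  simp only [norm_norm] at hB
  have hi4 : Integrable (fun x => ‖gradient Y x‖ ^ 4) torusMeasure :=
    integrable_bcf (by fun_prop) (C := B ^ 4) fun x => by
      rw [norm_pow, norm_norm]; exact pow_le_pow_left₀ (norm_nonneg _) (hB x) 4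
  have hQ := scaledNorm_nonneg R f
  have hR2 : 0 < R ^ 2 := by positivity
  have h1 : ∀ j, ‖mulOp (hY.grad j) (weakPartial j f)‖ ≤ 1 / 4 * scaledNorm R f := by
    intro j
    have h2 := norm_mulOp_weakPartial_le (hY.grad j) hf j hR
    have h3 : ∫ x, ‖hY.grad j x‖ ^ 4 ∂torusMeasure ≤ H := by
      refine integral_mono_of_nonneg (Eventually.of_forall fun _ => by positivity) hi4
        (Eventually.of_forall fun x => ?_)
      simp only [hY.grad_apply, Complex.norm_real]
      exact pow_le_pow_left₀ (norm_nonneg _) (PiLp.norm_apply_le (gradient Y x) j) 4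
    have h4 : (‖mulOp (hY.grad j) (weakPartial j f)‖ ^ 2) ^ 2 ≤ ((1 / 4 * scaledNorm R f) ^ 2) ^ 2 := by
      refine h2.trans ?_
      calc _ ≤ 40 * (64 / R ^ 2) * (scaledNorm R f ^ 2) ^ 2 * H := by gcongr
        _ = 2560 * H / R ^ 2 * (scaledNorm R f ^ 2) ^ 2 := by ring
        _ ≤ 1 / 256 * (scaledNorm R f ^ 2) ^ 2 := by
            refine mul_le_mul_of_nonneg_right ?_ (by positivity)
            rw [div_le_iff₀ hR2]
            nlinarith [sq_nonneg C]
        _ = _ := by ring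
    exact le_of_sq_le_sq (le_of_sq_le_sq h4 (by positivity)) (by positivity)
  have h5 : ‖mulOp (hY.pot C) f‖ ≤ 1 / 2 * scaledNorm R f := by
    refine le_of_sq_le_sq ((norm_sq_mulOp_le (hY.pot C) hf hR).trans ?_) (by positivity)
    have h6 : ∫ x, ‖hY.pot C x‖ ^ 2 ∂torusMeasure ≤ 80 * (H + C ^ 2) := by
      calc _ ≤ ∫ x, (2 * ‖gradient Y x‖ ^ 4 + 2 * C ^ 2) ∂torusMeasure := by
            refine integral_mono_of_nonneg (Eventually.of_forall fun _ => by positivity)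
              ((hi4.const_mul 2).add (integrable_const _)) (Eventually.of_forall fun x => ?_)
            simp only [hY.pot_apply, Complex.norm_real, Real.norm_eq_abs, sq_abs]
            nlinarith [sq_nonneg (‖gradient Y x‖ ^ 2 + C)]
        _ = 2 * H + (2 * Real.pi) ^ 2 * (2 * C ^ 2) := by
            rw [integral_add (hi4.const_mul 2) (integrable_const _), integral_const_mul,
              integral_torus_const]
        _ ≤ _ := by nlinarith [sq_nonneg C]
    calc _ ≤ 64 / R ^ 2 * scaledNorm R f ^ 2 * (80 * (H + C ^ 2)) := by gcongr
      _ = 5120 * (H + C ^ 2) / R ^ 2 * scaledNorm R f ^ 2 := by ring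
      _ ≤ 1 / 4 * scaledNorm R f ^ 2 := by
          refine mul_le_mul_of_nonneg_right ?_ (by positivity)
          rw [div_le_iff₀ hR2]
          nlinarith [sq_nonneg C]
      _ = _ := by ring
  have h7 : ‖hY.lower C f‖ ≤ 2 * (‖mulOp (hY.grad 0) (weakPartial 0 f)‖ +
      ‖mulOp (hY.grad 1) (weakPartial 1 f)‖) + ‖mulOp (hY.pot C) f‖ := by
    rw [lower, Fin.sum_univ_two]
    refine (norm_add_le _ _).trans (add_le_add ?_ le_rfl)
    rw [norm_neg, norm_smul, Complex.norm_ofNat]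
    exact mul_le_mul_of_nonneg_left (norm_add_le _ _) zero_le_two
  have h8 := scaledNorm_le hf hR
  linarith [h1 0, h1 1]

/-- The deterministic a priori estimate. -/
theorem h2Norm_le_of_isSolution {C T S : ℝ} (hS : ∀ x, |Y x| ≤ S) {v : ℝ → L2T}
    (hv : IsSolution Y C T v) {t : ℝ} (ht : t ∈ Set.Icc 0 T) :
    h2Norm (v t) ≤ Real.exp (2 * S) * (11 * h2Norm (v 0) + 7 * (655360 *
      ((∫ x, ‖gradient Y x‖ ^ 4 ∂torusMeasure) + C ^ 2) + 1) * ‖v 0‖) := by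
  set H := ∫ x, ‖gradient Y x‖ ^ 4 ∂torusMeasure with hH
  have hH0 : 0 ≤ H := integral_nonneg fun _ => by positivity
  have hS0 : 0 ≤ S := (abs_nonneg _).trans (hS 0)
  have he1 : 1 ≤ Real.exp (2 * S) := Real.one_le_exp (by positivity)
  set R := √(655360 * (H + C ^ 2) + 1) with hRdef
  have hR2 : R ^ 2 = 655360 * (H + C ^ 2) + 1 := Real.sq_sqrt (by positivity)
  have hR : 1 ≤ R := Real.one_le_sqrt.2 (by nlinarith [sq_nonneg C])
  have hev := hY.evolves_of_isSolution hv
  have h0 : (0 : ℝ) ∈ Set.Icc 0 T := ⟨le_rfl, ht.1.trans ht.2⟩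
  obtain ⟨hm0, w0, hw0, heq0⟩ := hev 0 h0
  obtain ⟨hmt, w, hw, heq⟩ := hev t ht
  have hpi := Real.pi_gt_three
  have hpi' := Real.pi_lt_four
  have hRH : 655360 * (H + C ^ 2) ≤ R ^ 2 := by linarith
  -- the mass controls the norms
  have hvt : ‖v t‖ ≤ Real.exp (2 * S) * ‖v 0‖ := hY.norm_le_of_mass_eq hS (hY.mass_eq_of_evolves hev ht)
  have hwt : ‖w‖ ≤ Real.exp (2 * S) * ‖w0‖ := by
    -- `mass_deriv_eq` needs `t > 0`. At `t = 0` both derivatives are determined by the equation and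
    -- have the same norm.
    rcases ht.1.eq_or_lt with rfl | hpos
    · have hn : ‖w‖ = ‖w0‖ := by
        have := congrArg norm (heq.trans heq0.symm)
        simpa [norm_smul] using this
      rw [hn]
      exact le_mul_of_one_le_left (norm_nonneg _) he1
    · exact hY.norm_le_of_mass_eq hS (hY.mass_deriv_eq hev ⟨hpos, ht.2⟩ hw hw0)
  have hlap : ‖weakLaplacian (v t)‖ ≤ ‖w‖ + ‖hY.lower C (v t)‖ := by
    have : weakLaplacian (v t) = Complex.I • w - hY.lower C (v t) := by rw [heq, generator]; abel
    rw [this]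
    refine (norm_sub_le _ _).trans_eq ?_
    rw [norm_smul, Complex.norm_I, one_mul]
  have hw0n : ‖w0‖ ≤ ‖weakLaplacian (v 0)‖ + ‖hY.lower C (v 0)‖ := by
    have : ‖w0‖ = ‖Complex.I • w0‖ := by rw [norm_smul, Complex.norm_I, one_mul]
    rw [this, heq0, generator]
    exact norm_add_le _ _
  have hl0 := hY.norm_lower_le (C := C) hm0 hR hRH
  have hlt := hY.norm_lower_le (C := C) hmt hR hRH
  have hn0 := norm_weakLaplacian_le hm0
  have hh := h2Norm_le hmt
  have hh0 := h2Norm_nonneg (v 0)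
  have hht := h2Norm_nonneg (v t)
  have hR1 : 1 ≤ R ^ 2 := one_le_pow₀ hR
  have hvR : ‖v t‖ ≤ R ^ 2 * ‖v t‖ := le_mul_of_one_le_left (norm_nonneg _) hR1
  -- Absorption: with `h` the `H²` norm, `2π h ≤ ‖v‖ + ‖w‖ + 3R² ‖v‖ + 3h`, and `2π ≥ 6` leaves `3h`
  -- on the left.
  have hmain : h2Norm (v t) ≤ ‖w‖ + 4 * (R ^ 2 * ‖v t‖) := by
    rw [inv_mul_eq_div, le_div_iff₀ (by positivity)] at hh
    have hb : 6 * h2Norm (v t) ≤ h2Norm (v t) * (2 * Real.pi) := by nlinarith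
    nlinarith [norm_nonneg w, norm_nonneg (v t), mul_nonneg (sq_nonneg R) (norm_nonneg (v t))]
  -- Here `11 = 8 + 3`: `2π ≤ 8` from the Laplacian and `3` from the lower order terms.
  have hw0' : ‖w0‖ ≤ 11 * h2Norm (v 0) + 3 * (R ^ 2 * ‖v 0‖) := by nlinarith
  rw [← hR2]
  calc h2Norm (v t) ≤ ‖w‖ + 4 * (R ^ 2 * ‖v t‖) := hmain
    _ ≤ Real.exp (2 * S) * (11 * h2Norm (v 0) + 3 * (R ^ 2 * ‖v 0‖)) +
        4 * (R ^ 2 * (Real.exp (2 * S) * ‖v 0‖)) :=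
      add_le_add (hwt.trans (mul_le_mul_of_nonneg_left hw0' (by positivity))) (by gcongr)
    _ = _ := by ring

end IsC1Potential

open scoped FourierTransform SchwartzMap

/-! ### Periodization and Fourier coefficients -/

theorem period_zero : period 0 = 0 := by ext i; simp [period]

theorem eq_of_add_period_mem_cell {x : Plane} {k l : Fin 2 → ℤ} (hk : x + period k ∈ cell)
    (hl : x + period l ∈ cell) : k = l := by
  funext i
  have h1 := hk i
  have h2 := hl i
  simp only [PiLp.add_apply, period, Set.mem_Ioc] at h1 h2
  have hpi := Real.pi_pos
  have h3 : (k i : ℝ) < l i + 1 := by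
    by_contra h; push Not at h; nlinarith [h1.1, h1.2, h2.1, h2.2]
  have h4 : (l i : ℝ) < k i + 1 := by
    by_contra h; push Not at h; nlinarith [h1.1, h1.2, h2.1, h2.2]
  have h5 : k i < l i + 1 := by exact_mod_cast h3
  have h6 : l i < k i + 1 := by exact_mod_cast h4
  omega

theorem finite_support_add_period {E : Type*} [Zero E] {f : Plane → E} (hc : HasCompactSupport f) :
    {k : Fin 2 → ℤ | ∃ x ∈ cell, f (x + period k) ≠ 0}.Finite := by
  obtain ⟨R, hR⟩ := hc.isCompact.isBounded.exists_norm_le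
  obtain ⟨R', hR'⟩ := isCompact_closure_cell.isBounded.exists_norm_le
  refine (finite_period_norm_le (R + R')).subset ?_
  rintro k ⟨x, hx, hne⟩
  have h1 : ‖x + period k‖ ≤ R := hR _ (subset_tsupport _ hne)
  have h2 : ‖x‖ ≤ R' := hR' _ (subset_closure hx)
  have h3 : period k = (x + period k) - x := by abel
  rw [Set.mem_ofPred_eq, h3]
  exact (norm_sub_le _ _).trans (add_le_add h1 h2)

/-- Unfolding of an integral over the plane. -/
theorem integral_cell_periodize {f : Plane → ℂ} (hf : Continuous f) (hc : HasCompactSupport f) :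
    ∫ x, ∑ᶠ k : Fin 2 → ℤ, f (x + period k) ∂torusMeasure = ∫ x, f x := by
  set K := (finite_support_add_period hc).toFinset with hK
  let s : (Fin 2 → ℤ) → Set Plane := fun k => (fun x => x + period (-k)) ⁻¹' cell
  have hsm : ∀ k, MeasurableSet (s k) := fun k =>
    (measurable_add_const _) measurableSet_cell
  have hsd : Pairwise (Function.onFun Disjoint s) := by
    intro k l hkl
    refine Set.disjoint_left.2 fun x hx hx' => hkl ?_
    exact neg_injective (eq_of_add_period_mem_cell hx hx')
  have hsU : ⋃ k, s k = Set.univ := by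
    refine Set.eq_univ_of_forall fun x => ?_
    obtain ⟨k, hk⟩ := exists_add_period_mem_cell x
    exact Set.mem_iUnion.2 ⟨-k, by simpa [s] using hk⟩
  have hint : Integrable f := hf.integrable_of_hasCompactSupport hc
  have hsi : ∀ k, ∫ x in s k, f x = ∫ x, f (x + period k) ∂torusMeasure := by
    intro k
    have hmp := measurePreserving_add_right (volume : Measure Plane) (period (-k))
    have h := hmp.setIntegral_preimage_emb (measurableEmbedding_addRight _)
      (fun x => f (x + period k)) cell
    rw [torusMeasure, ← h]
    refine setIntegral_congr_fun (hsm k) fun x _ => ?_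
    rw [add_assoc, ← period_add, neg_add_cancel, period_zero, add_zero]
  have hzero : ∀ k ∉ K, ∀ x ∈ cell, f (x + period k) = 0 := by
    intro k hk x hx
    by_contra hne
    exact hk ((Set.Finite.mem_toFinset _).2 ⟨x, hx, hne⟩)
  have hR : ∫ x, f x = ∑ k ∈ K, ∫ x, f (x + period k) ∂torusMeasure := by
    rw [← setIntegral_univ, ← hsU, integral_iUnion hsm hsd hint.integrableOn]
    simp only [hsi]
    refine tsum_eq_sum fun k hk => ?_
    rw [torusMeasure, setIntegral_congr_fun measurableSet_cell (hzero k hk), integral_zero]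
  have hL : ∀ x ∈ cell, ∑ᶠ k : Fin 2 → ℤ, f (x + period k) = ∑ k ∈ K, f (x + period k) := by
    intro x hx
    refine finsum_eq_sum_of_support_subset _ fun k hk => ?_
    by_contra hkK
    exact hk (hzero k hkK x hx)
  rw [hR, ← integral_finsetSum, torusMeasure]
  · exact setIntegral_congr_fun measurableSet_cell hL
  · intro k _
    exact ((hint.comp_add_right (period k))).restrict

/-- A mode is periodic and can be moved inside the periodization; unfolding the cell integral then
gives an integral over the plane. -/
theorem coeff_periodize {f : Plane → ℝ} (hf : Continuous f) (hc : HasCompactSupport f)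
    (m : Fin 2 → ℤ) :
    coeff (fun x => (periodize f x : ℂ)) m =
      ((((2 * Real.pi) ^ 2)⁻¹ : ℝ) : ℂ) * ∫ x, mode (-m) x * f x := by
  have hc' : HasCompactSupport fun x => mode (-m) x * (f x : ℂ) :=
    HasCompactSupport.mul_left (hc.comp_left (g := fun y : ℝ => (y : ℂ)) Complex.ofReal_zero)
  have hcont : Continuous fun x => mode (-m) x * (f x : ℂ) :=
    (continuous_mode _).mul (Complex.continuous_ofReal.comp hf)
  rw [coeff, ← integral_cell_periodize hcont hc']
  congr 1
  refine integral_congr_ae ?_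
  rw [torusMeasure]
  filter_upwards [ae_restrict_mem measurableSet_cell] with x hx
  have hfin : (Function.support fun k : Fin 2 → ℤ => f (x + period k)).Finite :=
    (finite_support_add_period hc).subset fun k hk => ⟨x, hx, hk⟩
  have e : ∀ k, mode (-m) (x + period k) * (f (x + period k) : ℂ) =
      mode (-m) x * (f (x + period k) : ℂ) := fun k => by rw [isPeriodic_mode]
  simp only [e]
  rw [periodize]
  rw [← mul_finsum]
  congr 1
  exact Complex.ofRealHom.toAddMonoidHom.map_finsum hfin

/-- The Fourier coefficients of the periodized mollifier. -/
noncomputable def mollCoeff (ρ : Mollifier) (ε : ℝ) (m : Fin 2 → ℤ) : ℂ :=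
  coeff (fun x => (periodize (ρ.scaled ε) x : ℂ)) m

/-- Rescaling `x` puts all the dependence on `ε` into the frequency: up to normalization this is the
Fourier transform of `ρ` at `ε m`. -/
theorem mollCoeff_eq (ρ : Mollifier) {ε : ℝ} (hε : 0 < ε) (m : Fin 2 → ℤ) :
    mollCoeff ρ ε m = ((((2 * Real.pi) ^ 2)⁻¹ : ℝ) : ℂ) *
      ∫ x : Plane, Complex.exp (-Complex.I * ((ε * ∑ i, (m i : ℝ) * x i : ℝ) : ℂ)) * ρ.toFun x := by
  rw [mollCoeff, coeff_periodize (ρ.contDiff_scaled ε).continuous (ρ.hasCompactSupport_scaled ε)]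
  congr 1
  have h := Measure.integral_comp_inv_smul (volume : Measure Plane)
    (fun x => Complex.exp (-Complex.I * ((ε * ∑ i, (m i : ℝ) * x i : ℝ) : ℂ)) * (ρ.toFun x : ℂ)) ε
  rw [finrank_euclideanSpace_fin, abs_of_pos (by positivity)] at h
  have h2 : ∀ x : Plane, mode (-m) x * ((ρ.scaled ε x : ℝ) : ℂ) = (((ε ^ 2)⁻¹ : ℝ) : ℂ) *
      (Complex.exp (-Complex.I * ((ε * ∑ i, (m i : ℝ) * (ε⁻¹ • x) i : ℝ) : ℂ)) *
        (ρ.toFun (ε⁻¹ • x) : ℂ)) := by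
    intro x
    have : ε * ∑ i, (m i : ℝ) * (ε⁻¹ • x) i = ∑ i, (m i : ℝ) * x i := by
      simp only [Fin.sum_univ_two, PiLp.smul_apply, smul_eq_mul]
      field_simp
    rw [this, Mollifier.scaled, mode]
    simp only [Fin.sum_univ_two, Pi.neg_apply]
    push_cast
    ring_nf
  simp only [h2]
  rw [integral_const_mul, h, Complex.real_smul, ← mul_assoc, ← Complex.ofReal_mul,
    inv_mul_cancel₀ (by positivity), Complex.ofReal_one, one_mul]

/-- Uniform decay of the Fourier coefficients of the mollifier. -/
theorem exists_mollCoeff_le (ρ : Mollifier) (N : ℕ) :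
    ∃ C, 0 ≤ C ∧ ∀ ε : ℝ, 0 < ε → ∀ m, (1 + ε ^ 2 * freqSq m) ^ N * ‖mollCoeff ρ ε m‖ ≤ C := by
  have hcs : HasCompactSupport fun x => (ρ.toFun x : ℂ) :=
    ρ.hasCompactSupport.comp_left (g := fun y : ℝ => (y : ℂ)) Complex.ofReal_zero
  let f : 𝓢(Plane, ℂ) := hcs.toSchwartzMap (Complex.ofRealCLM.contDiff.comp ρ.smooth)
  have hf : ∀ x, f x = (ρ.toFun x : ℂ) := fun x => rfl
  -- The Fourier transform of `ρ` is a Schwartz function. Its decay at `w = ε m / (2π)` depends on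
  -- `ε` and `m` only through `ε m`, whence the uniformity in `ε`.
  obtain ⟨C, hC⟩ : ∃ C, ∀ w, (1 + ‖w‖) ^ (2 * N) * ‖𝓕 f w‖ ≤ C :=
    ⟨_, fun w => by
      simpa using SchwartzMap.one_add_le_sup_seminorm_apply (𝕜 := ℝ) (m := (2 * N, 0)) (k := 2 * N)
        (n := 0) le_rfl le_rfl (𝓕 f) w⟩
  have hC0 : 0 ≤ C := le_trans (by positivity) (hC 0)
  refine ⟨(2 * Real.pi) ^ (2 * N) * C, by positivity, fun ε hε m => ?_⟩
  set w : Plane := WithLp.toLp 2 fun i => ε * (m i : ℝ) / (2 * Real.pi) with hw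
  have hF : 𝓕 f w = ∫ x : Plane,
      Complex.exp (-Complex.I * ((ε * ∑ i, (m i : ℝ) * x i : ℝ) : ℂ)) * ρ.toFun x := by
    rw [SchwartzMap.fourier_coe, Real.fourier_eq']
    refine integral_congr_ae (Eventually.of_forall fun x => ?_)
    simp only [hf, smul_eq_mul]
    congr 2
    have : inner ℝ x w = ε * (∑ i, (m i : ℝ) * x i) / (2 * Real.pi) := by
      simp only [PiLp.inner_apply, hw, Fin.sum_univ_two, RCLike.inner_apply, conj_trivial]
      ring
    rw [this]
    push_cast
    have hpi : (Real.pi : ℂ) ≠ 0 := by exact_mod_cast Real.pi_ne_zero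
    field_simp
  have hn : ‖w‖ ^ 2 = ε ^ 2 * freqSq m / (2 * Real.pi) ^ 2 := by
    rw [EuclideanSpace.norm_eq, Real.sq_sqrt (Finset.sum_nonneg fun _ _ => sq_nonneg _)]
    simp only [hw, Fin.sum_univ_two, freqSq, Real.norm_eq_abs, sq_abs]
    ring
  have hpi1 : 1 ≤ 2 * Real.pi := by linarith [Real.pi_gt_three]
  have hle : 1 + ε ^ 2 * freqSq m ≤ ((2 * Real.pi) * (1 + ‖w‖)) ^ 2 := by
    have h1 : ε ^ 2 * freqSq m = (2 * Real.pi) ^ 2 * ‖w‖ ^ 2 := by rw [hn]; field_simp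
    rw [h1]
    nlinarith [norm_nonneg w, one_le_pow₀ hpi1 (n := 2), mul_nonneg (sq_nonneg (2 * Real.pi)) (norm_nonneg w)]
  have hr : ‖mollCoeff ρ ε m‖ ≤ ‖𝓕 f w‖ := by
    rw [mollCoeff_eq ρ hε, ← hF, norm_mul, Complex.norm_real, Real.norm_of_nonneg (by positivity)]
    exact mul_le_of_le_one_left (norm_nonneg _) (inv_le_one_of_one_le₀ (one_le_pow₀ hpi1))
  have h0 := freqSq_nonneg m
  calc _ ≤ (((2 * Real.pi) * (1 + ‖w‖)) ^ 2) ^ N * ‖𝓕 f w‖ := by gcongr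
    _ = (2 * Real.pi) ^ (2 * N) * ((1 + ‖w‖) ^ (2 * N) * ‖𝓕 f w‖) := by
        rw [← pow_mul, mul_pow, mul_assoc]
    _ ≤ _ := mul_le_mul_of_nonneg_left (hC w) (by positivity)

/-! ### Absolutely convergent Fourier series -/

theorem summable_smul_mode {a : (Fin 2 → ℤ) → ℂ} (ha : Summable fun m => ‖a m‖) (x : Plane) :
    Summable fun m => a m * mode m x :=
  Summable.of_norm (by simpa only [norm_mul, norm_mode, mul_one] using ha)

theorem continuous_tsum_mode {a : (Fin 2 → ℤ) → ℂ} (ha : Summable fun m => ‖a m‖) :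
    Continuous fun x => ∑' m, a m * mode m x :=
  continuous_tsum (fun m => continuous_const.mul (continuous_mode m)) ha
    fun m x => by rw [norm_mul, norm_mode, mul_one]

theorem coeff_tsum_mode {a : (Fin 2 → ℤ) → ℂ} (ha : Summable fun m => ‖a m‖) (k : Fin 2 → ℤ) :
    coeff (fun x => ∑' m, a m * mode m x) k = a k := by
  have h1 : ∀ x, mode (-k) x * ∑' m, a m * mode m x = ∑' m, a m * mode (m - k) x := fun x => by
    rw [← tsum_mul_left]
    refine tsum_congr fun m => ?_
    rw [sub_eq_add_neg, mode_add]; ring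
  have h2 : ∑' m, ∫ x, a m * mode (m - k) x ∂torusMeasure =
      ∫ x, ∑' m, a m * mode (m - k) x ∂torusMeasure := by
    refine integral_tsum_of_summable_integral_norm (fun m => ?_) ?_
    · exact (integrable_bcf (continuous_mode _) (C := 1) fun x => (norm_mode _ x).le).const_mul _
    · simp only [norm_mul, norm_mode, mul_one, integral_torus_const]
      exact ha.mul_left _
  rw [coeff]
  simp only [h1]
  rw [← h2]
  simp only [integral_const_mul, integral_mode, sub_eq_zero]
  rw [tsum_eq_single k fun m hm => by simp [hm]]
  simp only [if_true]
  rw [mul_left_comm, ← Complex.ofReal_mul, inv_mul_cancel₀ (by positivity), Complex.ofReal_one, mul_one]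

/-- With this, almost everywhere equality of continuous functions on the cell becomes equality at
every point, boundary included. -/
theorem cell_subset_closure_interior : cell ⊆ closure (interior cell) := by
  have hconv : Convex ℝ cell := by
    intro x hx y hy a b ha hb hab i
    exact (convex_Ioc (0 : ℝ) (2 * Real.pi)) (hx i) (hy i) ha hb hab
  have hne : (interior cell).Nonempty := by
    refine ⟨WithLp.toLp 2 fun _ => Real.pi, mem_interior.2 ⟨{x | ∀ i, x i ∈ Set.Ioo (0 : ℝ) (2 * Real.pi)},
      fun x hx i => Set.Ioo_subset_Ioc_self (hx i), ?_, fun i => ⟨Real.pi_pos, by linarith [Real.pi_pos]⟩⟩⟩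
    have : {x : Plane | ∀ i, x i ∈ Set.Ioo (0 : ℝ) (2 * Real.pi)} =
        ⋂ i, (fun x : Plane => x i) ⁻¹' Set.Ioo (0 : ℝ) (2 * Real.pi) := by ext x; simp
    rw [this]
    exact isOpen_iInter_of_finite fun i => isOpen_Ioo.preimage (by fun_prop)
  rw [hconv.closure_interior_eq_closure_of_nonempty_interior hne]
  exact subset_closure

/-- A continuous periodic function with summable Fourier coefficients is the sum of its Fourier
series. -/
theorem IsPeriodic.eq_tsum_coeff {f : Plane → ℂ} (hf : IsPeriodic f) (hc : Continuous f)
    (hs : Summable fun m => ‖coeff f m‖) (x : Plane) : f x = ∑' m, coeff f m * mode m x := by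
  set g : Plane → ℂ := fun x => ∑' m, coeff f m * mode m x with hg
  have hgc : Continuous g := continuous_tsum_mode hs
  have hgp : IsPeriodic g := fun k x => by simp only [hg, isPeriodic_mode _ k x]
  obtain ⟨C, hC⟩ := hf.exists_bound hc
  obtain ⟨D, hD⟩ := hgp.exists_bound hgc
  have hfm : MemLp f 2 torusMeasure := MemLp.of_bound hc.aestronglyMeasurable C (Eventually.of_forall hC)
  have hgm : MemLp g 2 torusMeasure := MemLp.of_bound hgc.aestronglyMeasurable D (Eventually.of_forall hD)
  have heq : hfm.toLp = hgm.toLp := eq_of_coeff_eq fun k => by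
    rw [coeff_congr_ae hfm.coeFn_toLp, coeff_congr_ae hgm.coeFn_toLp, coeff_tsum_mode hs]
  have hae : f =ᵐ[volume.restrict cell] g := (MemLp.toLp_eq_toLp_iff hfm hgm).1 heq
  have hon := Measure.eqOn_of_ae_eq hae hc.continuousOn hgc.continuousOn cell_subset_closure_interior
  obtain ⟨k, hk⟩ := exists_add_period_mem_cell x
  rw [← hf k x]
  exact (hon hk).trans (hgp k x)

/-! ### Rapidly decaying Fourier series -/

theorem norm_iteratedDeriv_cexp_I (n : ℕ) (t : ℝ) :
    ‖iteratedDeriv n (fun t : ℝ => Complex.exp (Complex.I * t)) t‖ = 1 := by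
  have h : iteratedDeriv n (fun t : ℝ => Complex.exp (Complex.I * t)) =
      fun t : ℝ => Complex.I ^ n * Complex.exp (Complex.I * t) := by
    induction n with
    | zero => simp
    | succ n ih =>
      rw [iteratedDeriv_succ, ih]
      funext t
      have h1 : HasDerivAt (fun t : ℝ => Complex.exp (Complex.I * t))
          (Complex.exp (Complex.I * t) * (Complex.I * 1)) t :=
        ((Complex.ofRealCLM.hasDerivAt (x := t)).const_mul Complex.I).cexp
      rw [(h1.const_mul _).deriv]
      ring
  rw [h, norm_mul, norm_pow, Complex.norm_I, one_pow, one_mul, mul_comm, Complex.norm_exp_ofReal_mul_I]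

theorem norm_iteratedFDeriv_mode_le (m : Fin 2 → ℤ) (n : ℕ) (x : Plane) :
    ‖iteratedFDeriv ℝ n (mode m) x‖ ≤ (1 + freqSq m) ^ n := by
  let L : Plane →L[ℝ] ℝ := ∑ i, (m i : ℝ) • (EuclideanSpace.proj i : Plane →L[ℝ] ℝ)
  have hL : ∀ x, L x = ∑ i, (m i : ℝ) * x i := fun x => by simp [L, Fin.sum_univ_two]
  have hcomp : mode m = (fun t : ℝ => Complex.exp (Complex.I * t)) ∘ L := by
    funext x
    rw [mode, Function.comp_apply, hL]
  have hsm : ContDiff ℝ n (fun t : ℝ => Complex.exp (Complex.I * t)) :=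
    (contDiff_const.mul Complex.ofRealCLM.contDiff).cexp
  have hLn : ‖L‖ ≤ 1 + freqSq m := by
    refine ContinuousLinearMap.opNorm_le_bound _ (by have := freqSq_nonneg m; positivity) fun x => ?_
    have h0 := freqSq_nonneg m
    rw [hL, Real.norm_eq_abs]
    refine abs_le_of_sq_le_sq ?_ (by positivity)
    have h1 : ‖x‖ ^ 2 = x 0 ^ 2 + x 1 ^ 2 := by
      rw [EuclideanSpace.norm_sq_eq, Fin.sum_univ_two]; simp
    have h2 : freqSq m = (m 0 : ℝ) ^ 2 + (m 1 : ℝ) ^ 2 := by rw [freqSq, Fin.sum_univ_two]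
    rw [mul_pow, h1, Fin.sum_univ_two]
    have h3 : freqSq m ≤ (1 + freqSq m) ^ 2 := by nlinarith
    calc _ ≤ freqSq m * (x 0 ^ 2 + x 1 ^ 2) := by
          rw [h2]; nlinarith [sq_nonneg ((m 0 : ℝ) * x 1 - m 1 * x 0)]
      _ ≤ _ := mul_le_mul_of_nonneg_right h3 (by positivity)
  rw [hcomp, ContinuousLinearMap.iteratedFDeriv_comp_right L hsm x le_rfl]
  refine (ContinuousMultilinearMap.norm_compContinuousLinearMap_le _ _).trans ?_
  rw [norm_iteratedFDeriv_eq_norm_iteratedDeriv, norm_iteratedDeriv_cexp_I, one_mul,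
    Finset.prod_const, Finset.card_univ, Fintype.card_fin]
  exact pow_le_pow_left₀ (norm_nonneg _) hLn n

/-- Fourier coefficients of smooth functions. -/
def RapidDecay (b : (Fin 2 → ℤ) → ℂ) : Prop :=
  ∀ n : ℕ, Summable fun m => (1 + freqSq m) ^ n * ‖b m‖

theorem one_le_one_add_freqSq (m : Fin 2 → ℤ) : 1 ≤ 1 + freqSq m := by
  linarith [freqSq_nonneg m]

namespace RapidDecay

variable {b : (Fin 2 → ℤ) → ℂ}

theorem summable_norm (hb : RapidDecay b) : Summable fun m => ‖b m‖ := by simpa using hb 0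

theorem of_norm_le (hb : RapidDecay b) {c : (Fin 2 → ℤ) → ℂ} (h : ∀ m, ‖c m‖ ≤ ‖b m‖) :
    RapidDecay c := fun n =>
  Summable.of_nonneg_of_le (fun m => by have := freqSq_nonneg m; positivity)
    (fun m => mul_le_mul_of_nonneg_left (h m) (by have := freqSq_nonneg m; positivity)) (hb n)

theorem of_bound {c : (Fin 2 → ℤ) → ℂ} {C : ℝ} {N : ℕ} (hb : RapidDecay b)
    (h : ∀ m, ‖c m‖ ≤ C * (1 + freqSq m) ^ N * ‖b m‖) : RapidDecay c := fun n =>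
  Summable.of_nonneg_of_le (fun m => by have := freqSq_nonneg m; positivity)
    (fun m => by
      have := freqSq_nonneg m
      calc _ ≤ (1 + freqSq m) ^ n * (C * (1 + freqSq m) ^ N * ‖b m‖) :=
            mul_le_mul_of_nonneg_left (h m) (by positivity)
        _ = C * ((1 + freqSq m) ^ (n + N) * ‖b m‖) := by ring) ((hb (n + N)).mul_left C)

theorem norm_iteratedFDeriv_term_le (b : (Fin 2 → ℤ) → ℂ) (n : ℕ) (m : Fin 2 → ℤ) (x : Plane) :
    ‖iteratedFDeriv ℝ n (fun y => b m * mode m y) x‖ ≤ (1 + freqSq m) ^ n * ‖b m‖ := by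
  have : (fun y => b m * mode m y) = b m • mode m := rfl
  rw [this, iteratedFDeriv_const_smul_apply (contDiff_mode m).contDiffAt, norm_smul, mul_comm]
  exact mul_le_mul_of_nonneg_right (norm_iteratedFDeriv_mode_le m n x) (norm_nonneg _)

theorem contDiff_tsum (hb : RapidDecay b) :
    ContDiff ℝ (⊤ : ℕ∞) fun x => ∑' m, b m * mode m x :=
  _root_.contDiff_tsum (fun m => contDiff_const.mul (contDiff_mode m)) (fun n _ => hb n)
    fun n m x _ => norm_iteratedFDeriv_term_le b n m x

theorem norm_iteratedFDeriv_tsum_le (hb : RapidDecay b) (n : ℕ) (x : Plane) :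
    ‖iteratedFDeriv ℝ n (fun x => ∑' m, b m * mode m x) x‖ ≤ ∑' m, (1 + freqSq m) ^ n * ‖b m‖ := by
  rw [iteratedFDeriv_tsum_apply (N := (⊤ : ℕ∞)) (v := fun n m => (1 + freqSq m) ^ n * ‖b m‖)
    (fun m => contDiff_const.mul (contDiff_mode m)) (fun n _ => hb n)
    (fun n m x _ => norm_iteratedFDeriv_term_le b n m x) le_top]
  exact tsum_of_norm_bounded (hb n).hasSum fun m => norm_iteratedFDeriv_term_le b n m x

theorem norm_iteratedFDeriv_re_tsum_le (hb : RapidDecay b) (n : ℕ) (x : Plane) :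
    ‖iteratedFDeriv ℝ n (fun x => (∑' m, b m * mode m x).re) x‖ ≤
      ∑' m, (1 + freqSq m) ^ n * ‖b m‖ := by
  have h1 : (fun x => (∑' m, b m * mode m x).re) =
      Complex.reCLM ∘ fun x => ∑' m, b m * mode m x := rfl
  rw [h1, ContinuousLinearMap.iteratedFDeriv_comp_left Complex.reCLM
    (hb.contDiff_tsum.contDiffAt (x := x)) (by exact_mod_cast le_top)]
  refine (ContinuousLinearMap.norm_compContinuousMultilinearMap_le _ _).trans ?_
  rw [Complex.reCLM_norm, one_mul]
  exact hb.norm_iteratedFDeriv_tsum_le n x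

end RapidDecay

theorem rapidDecay_ite (b : (Fin 2 → ℤ) → ℂ) (F : Finset (Fin 2 → ℤ)) [DecidablePred (· ∈ F)] :
    RapidDecay fun m => if m ∈ F then b m else 0 := fun n =>
  summable_of_ne_finset_zero (s := F) fun m hm => by simp [hm]

/-! ### Pairing a distribution with trigonometric polynomials -/

/-- The real part of a trigonometric polynomial, as a test function. -/
noncomputable def trigTest (F : Finset (Fin 2 → ℤ)) (a : (Fin 2 → ℤ) → ℂ) : TestFn :=
  ⟨fun y => (∑ m ∈ F, a m * mode m y).re,
    Complex.reCLM.contDiff.comp (ContDiff.sum fun m _ => contDiff_const.mul (contDiff_mode m)),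
    fun k x => by simp only [isPeriodic_mode _ k x]⟩

theorem trigTest_apply (F : Finset (Fin 2 → ℤ)) (a : (Fin 2 → ℤ) → ℂ) (y : Plane) :
    (trigTest F a : Plane → ℝ) y = (∑ m ∈ F, a m * mode m y).re := rfl

/-- The pairing of a distribution with a Fourier mode. -/
noncomputable def pairing (ξ : TorusDistribution) (m : Fin 2 → ℤ) : ℂ :=
  -- Distributions act on real functions, so the pairing with `e_m` is assembled from `Re e_m =
  -- cos(m·x)` and `Re(-i e_m) = sin(m·x)`.
  ξ.toLin (trigTest {m} fun _ => 1) + Complex.I * ξ.toLin (trigTest {m} fun _ => -Complex.I)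

theorem toLin_trigTest (ξ : TorusDistribution) (F : Finset (Fin 2 → ℤ)) (a : (Fin 2 → ℤ) → ℂ) :
    ξ.toLin (trigTest F a) = (∑ m ∈ F, a m * pairing ξ m).re := by
  have h : trigTest F a = ∑ m ∈ F, ((a m).re • trigTest {m} (fun _ => 1) -
      (a m).im • trigTest {m} (fun _ => -Complex.I)) := by
    refine Subtype.ext (funext fun y => ?_)
    rw [trigTest_apply, Complex.re_sum, AddSubmonoidClass.coe_finsetSum, Finset.sum_apply]
    refine Finset.sum_congr rfl fun m _ => ?_
    rw [AddSubgroupClass.coe_sub, Pi.sub_apply, Submodule.coe_smul, Submodule.coe_smul,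
      Pi.smul_apply, Pi.smul_apply, trigTest_apply, trigTest_apply]
    simp
  rw [h, map_sum, Complex.re_sum]
  refine Finset.sum_congr rfl fun m _ => ?_
  rw [map_sub, map_smul, map_smul, pairing]
  simp

/-- Derivatives of order `n` of a mode are bounded by `(1 + |m|²)ⁿ`, so continuity in a `C^N` norm
becomes a weighted `ℓ¹` bound on Fourier coefficients. Here `N` and `C` depend on the realization;
the bound serves only for convergence, never for moments. -/
theorem exists_abs_toLin_le (ξ : TorusDistribution) :
    ∃ (N : ℕ) (C : ℝ), 0 ≤ C ∧ ∀ b, RapidDecay b → ∀ φ : TestFn,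
      (∀ y, (φ : Plane → ℝ) y = (∑' m, b m * mode m y).re) →
      |ξ.toLin φ| ≤ C * ∑' m, (1 + freqSq m) ^ N * ‖b m‖ := by
  obtain ⟨N, C, h⟩ := ξ.continuous_toLin
  refine ⟨N, |C|, abs_nonneg _, fun b hb φ hφ => ?_⟩
  have h0 : 0 ≤ ∑' m, (1 + freqSq m) ^ N * ‖b m‖ :=
    tsum_nonneg fun m => by have := freqSq_nonneg m; positivity
  refine (h φ (∑' m, (1 + freqSq m) ^ N * ‖b m‖) fun n hn x => ?_).trans
    (mul_le_mul_of_nonneg_right (le_abs_self C) h0)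
  have : (φ : Plane → ℝ) = fun y => (∑' m, b m * mode m y).re := funext hφ
  rw [this]
  refine (hb.norm_iteratedFDeriv_re_tsum_le n x).trans ((hb n).tsum_le_tsum (fun m => ?_) (hb N))
  exact mul_le_mul_of_nonneg_right (pow_le_pow_right₀ (one_le_one_add_freqSq m) hn) (norm_nonneg _)

theorem exists_norm_pairing_le (ξ : TorusDistribution) :
    ∃ (N : ℕ) (C : ℝ), 0 ≤ C ∧ ∀ m, ‖pairing ξ m‖ ≤ C * (1 + freqSq m) ^ N := by
  classical
  obtain ⟨N, C, hC, h⟩ := exists_abs_toLin_le ξ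
  have key : ∀ (m : Fin 2 → ℤ) (c : ℂ), ‖c‖ = 1 →
      |ξ.toLin (trigTest {m} fun _ => c)| ≤ C * (1 + freqSq m) ^ N := by
    intro m c hc
    refine (h _ (rapidDecay_ite (fun _ => c) {m}) _ fun y => ?_).trans_eq ?_
    · rw [trigTest_apply, Finset.sum_singleton, tsum_eq_single m fun k hk => by simp [hk]]
      simp
    · rw [tsum_eq_single m fun k hk => by simp [hk]]
      simp [hc]
  refine ⟨N, 2 * C, by positivity, fun m => ?_⟩
  have h1 := key m 1 norm_one
  have h2 := key m (-Complex.I) (by simp)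
  rw [pairing]
  refine (norm_add_le _ _).trans ?_
  rw [norm_mul, Complex.norm_I, one_mul, Complex.norm_real, Complex.norm_real, Real.norm_eq_abs,
    Real.norm_eq_abs]
  linarith

/-- The value of a distribution at a rapidly decaying real Fourier series. -/
theorem hasSum_toLin (ξ : TorusDistribution) {b : (Fin 2 → ℤ) → ℂ} (hb : RapidDecay b) {φ : TestFn}
    (hφ : ∀ y, ((φ : Plane → ℝ) y : ℂ) = ∑' m, b m * mode m y) :
    HasSum (fun m => b m * pairing ξ m) (ξ.toLin φ : ℂ) := by
  classical
  obtain ⟨N, C, hC, h⟩ := exists_abs_toLin_le ξ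
  let rem : Finset (Fin 2 → ℤ) → (Fin 2 → ℤ) → ℂ := fun F m => if m ∈ F then 0 else b m
  have hrem : ∀ F, RapidDecay (rem F) := fun F => hb.of_norm_le fun m => by
    simp only [rem]; split_ifs <;> simp
  have hsplit : ∀ F y, ∑' m, rem F m * mode m y =
      (φ : Plane → ℝ) y - ∑ m ∈ F, b m * mode m y := by
    intro F y
    have hs1 := summable_smul_mode (hrem F).summable_norm y
    have hs2 := summable_smul_mode (rapidDecay_ite b F).summable_norm y
    have h3 : ∑ m ∈ F, b m * mode m y = ∑' m, (if m ∈ F then b m else 0) * mode m y := by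
      rw [tsum_eq_sum (s := F) fun m hm => by simp [hm]]
      exact Finset.sum_congr rfl fun m hm => by simp [hm]
    rw [hφ, h3, eq_sub_iff_add_eq, ← hs1.tsum_add hs2]
    refine tsum_congr fun m => ?_
    simp only [rem]; split_ifs <;> simp
  have htail : Tendsto (fun F : Finset (Fin 2 → ℤ) => C * ∑' m, (1 + freqSq m) ^ N * ‖rem F m‖)
      atTop (𝓝 0) := by
    have h1 := (tendsto_tsum_compl_atTop_zero fun m => (1 + freqSq m) ^ N * ‖b m‖).const_mul C
    rw [mul_zero] at h1
    refine h1.congr fun F => ?_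
    congr 1
    rw [← tsum_subtype_eq_of_support_subset (s := {m | m ∉ F})]
    · refine tsum_congr fun m => ?_
      have : (m : Fin 2 → ℤ) ∉ F := m.2
      simp [rem, this]
    · intro m hm hmF
      simp [rem, hmF] at hm
  have hre : ∀ F, |ξ.toLin φ - (∑ m ∈ F, b m * pairing ξ m).re| ≤
      C * ∑' m, (1 + freqSq m) ^ N * ‖rem F m‖ := by
    intro F
    rw [← toLin_trigTest, ← map_sub]
    refine h _ (hrem F) _ fun y => ?_
    rw [hsplit, AddSubgroupClass.coe_sub, Pi.sub_apply, trigTest_apply]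
    simp
  -- Since `φ` is real, the imaginary part of a partial sum comes from the remainder alone; it is
  -- the pairing with coefficients `-i b_m`, because `Re(-i z) = Im z`.
  have him : ∀ F, |(∑ m ∈ F, b m * pairing ξ m).im| ≤
      C * ∑' m, (1 + freqSq m) ^ N * ‖rem F m‖ := by
    intro F
    have e1 : (∑ m ∈ F, b m * pairing ξ m).im = ξ.toLin (trigTest F fun m => -Complex.I * b m) := by
      rw [toLin_trigTest, Complex.im_sum, Complex.re_sum]
      refine Finset.sum_congr rfl fun m _ => ?_
      simp only [neg_mul, Complex.neg_re, mul_assoc, Complex.I_mul_re, neg_neg]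
    rw [e1]
    have hI : RapidDecay fun m => Complex.I * rem F m := (hrem F).of_norm_le fun m => by simp
    refine (h _ hI _ fun y => ?_).trans_eq ?_
    · simp only [mul_assoc]
      rw [tsum_mul_left, hsplit, trigTest_apply]
      simp only [mul_assoc]
      rw [← Finset.mul_sum]
      simp
    · simp
  rw [HasSum, tendsto_iff_norm_sub_tendsto_zero]
  refine squeeze_zero (fun _ => norm_nonneg _) (fun F => ?_)
    (by simpa using htail.add htail)
  refine (Complex.norm_le_abs_re_add_abs_im _).trans (add_le_add ?_ ?_)
  · rw [Complex.sub_re, Complex.ofReal_re, abs_sub_comm]; exact hre F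
  · rw [Complex.sub_im, Complex.ofReal_im, sub_zero]; exact him F

theorem summable_inv_one_add_freqSq_sq :
    Summable fun m : Fin 2 → ℤ => ((1 + freqSq m) ^ 2)⁻¹ := by
  simpa using (lattice_sum le_rfl).1

theorem rapidDecay_mollCoeff (ρ : Mollifier) {ε : ℝ} (hε : ε ∈ Set.Ioo (0 : ℝ) 1) :
    RapidDecay (mollCoeff ρ ε) := by
  intro n
  obtain ⟨C, hC0, hC⟩ := exists_mollCoeff_le ρ (n + 2)
  refine Summable.of_nonneg_of_le (fun m => by have := freqSq_nonneg m; positivity) (fun m => ?_)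
    (summable_inv_one_add_freqSq_sq.mul_left ((ε ^ 2)⁻¹ ^ (n + 2) * C))
  have h0 := freqSq_nonneg m
  have h1 : 1 + freqSq m ≤ (ε ^ 2)⁻¹ * (1 + ε ^ 2 * freqSq m) := by
    have hε2 : 0 < ε ^ 2 := pow_pos hε.1 2
    have h2 : 1 ≤ (ε ^ 2)⁻¹ := (one_le_inv₀ hε2).2 (pow_le_one₀ hε.1.le hε.2.le)
    rw [mul_add, mul_one, inv_mul_cancel_left₀ hε2.ne']
    linarith
  rw [le_mul_inv_iff₀ (by positivity)]
  calc _ = (1 + freqSq m) ^ (n + 2) * ‖mollCoeff ρ ε m‖ := by ring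
    _ ≤ ((ε ^ 2)⁻¹ * (1 + ε ^ 2 * freqSq m)) ^ (n + 2) * ‖mollCoeff ρ ε m‖ := by gcongr
    _ = (ε ^ 2)⁻¹ ^ (n + 2) * ((1 + ε ^ 2 * freqSq m) ^ (n + 2) * ‖mollCoeff ρ ε m‖) := by
        rw [mul_pow, mul_assoc]
    _ ≤ _ := mul_le_mul_of_nonneg_left (hC ε hε.1 m) (by positivity)

theorem RapidDecay.neg {b : (Fin 2 → ℤ) → ℂ} (hb : RapidDecay b) : RapidDecay fun m => b (-m) := by
  intro n
  have := (Equiv.neg (Fin 2 → ℤ)).summable_iff.2 (hb n)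
  refine this.congr fun m => ?_
  simp [freqSq_neg]

/-- The Fourier coefficients of the mollified Green function. -/
noncomputable def green (ρ : Mollifier) (ε : ℝ) (m : Fin 2 → ℤ) : ℂ :=
  -- At `m = 0` the convention `0⁻¹ = 0` removes the mean, in agreement with `invLaplacian`. The
  -- sign of the frequency makes this the factor in front of `pairing ξ m`.
  -((freqSq m : ℂ)⁻¹ * mollCoeff ρ ε (-m))

theorem freqSq_zero : freqSq 0 = 0 := by simp [freqSq]

theorem norm_inv_freqSq_le (m : Fin 2 → ℤ) : ‖(freqSq m : ℂ)⁻¹‖ ≤ 1 := by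
  rw [norm_inv, Complex.norm_real, Real.norm_of_nonneg (freqSq_nonneg m)]
  rcases eq_or_ne m 0 with rfl | hm
  · simp [freqSq_zero]
  · exact inv_le_one_of_one_le₀ (one_le_freqSq hm)

theorem rapidDecay_green (ρ : Mollifier) {ε : ℝ} (hε : ε ∈ Set.Ioo (0 : ℝ) 1) :
    RapidDecay (green ρ ε) :=
  (rapidDecay_mollCoeff ρ hε).neg.of_norm_le fun m => by
    rw [green, norm_neg, norm_mul]
    exact mul_le_of_le_one_left (norm_nonneg _) (norm_inv_freqSq_le m)

theorem RapidDecay.mul_pairing {b : (Fin 2 → ℤ) → ℂ} (hb : RapidDecay b) (ξ : TorusDistribution) :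
    RapidDecay fun m => b m * pairing ξ m := by
  obtain ⟨N, C, _, h⟩ := exists_norm_pairing_le ξ
  refine hb.of_bound (C := C) (N := N) fun m => ?_
  rw [norm_mul, mul_comm]
  exact mul_le_mul_of_nonneg_right (h m) (norm_nonneg _)

/-- The kernel `y ↦ ρ_ε(x - y)` is expanded in its Fourier series and paired with the noise term by
term. -/
theorem mollified_eq (ρ : Mollifier) {ε : ℝ} (hε : ε ∈ Set.Ioo (0 : ℝ) 1) (ξ : TorusDistribution)
    (x : Plane) :
    (mollified ρ ε ξ x : ℂ) = ∑' k, mollCoeff ρ ε k * pairing ξ (-k) * mode k x := by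
  have hr := rapidDecay_mollCoeff ρ hε
  have hper : IsPeriodic fun y => (periodize (ρ.scaled ε) y : ℂ) := fun k y => by
    simp only [periodize_add_period]
  have hcont : Continuous fun y => (periodize (ρ.scaled ε) y : ℂ) :=
    Complex.continuous_ofReal.comp
      (contDiff_periodize (ρ.contDiff_scaled ε) (ρ.hasCompactSupport_scaled ε)).continuous
  have hb : RapidDecay fun m => mollCoeff ρ ε (-m) * mode (-m) x :=
    hr.neg.of_norm_le fun m => by rw [norm_mul, norm_mode, mul_one]
  have h := hasSum_toLin ξ hb (φ := kernel ρ ε x) fun y => by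
    have h1 := hper.eq_tsum_coeff hcont hr.summable_norm (x - y)
    refine h1.trans ?_
    rw [← (Equiv.neg (Fin 2 → ℤ)).tsum_eq]
    refine tsum_congr fun m => ?_
    have h2 : mode (-m) (x - y) = mode (-m) x * mode m y := by
      simp only [mode, ← Complex.exp_add, Fin.sum_univ_two, Pi.neg_apply, PiLp.sub_apply]
      congr 1; push_cast; ring
    rw [Equiv.neg_apply, h2, mollCoeff, mul_assoc]
  rw [mollified, ← h.tsum_eq, ← (Equiv.neg (Fin 2 → ℤ)).tsum_eq]
  refine tsum_congr fun m => ?_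
  rw [Equiv.neg_apply, neg_neg]
  ring

/-- The Fourier coefficients of the potential. -/
noncomputable def potCoeff (ρ : Mollifier) (ε : ℝ) (ξ : TorusDistribution) (m : Fin 2 → ℤ) : ℂ :=
  green ρ ε (-m) * pairing ξ (-m)

theorem rapidDecay_potCoeff (ρ : Mollifier) {ε : ℝ} (hε : ε ∈ Set.Ioo (0 : ℝ) 1)
    (ξ : TorusDistribution) : RapidDecay (potCoeff ρ ε ξ) :=
  ((rapidDecay_green ρ hε).mul_pairing ξ).neg

theorem potential_eq (ρ : Mollifier) {ε : ℝ} (hε : ε ∈ Set.Ioo (0 : ℝ) 1) (ξ : TorusDistribution)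
    (x : Plane) :
    potential ρ ε ξ x = (∑' m, potCoeff ρ ε ξ m * mode m x).re := by
  have hs : Summable fun k => ‖mollCoeff ρ ε k * pairing ξ (-k)‖ := by
    have := ((rapidDecay_mollCoeff ρ hε).neg.mul_pairing ξ).neg.summable_norm
    simpa only [neg_neg] using this
  have hc : ∀ k, coeff (fun y => (mollified ρ ε ξ y : ℂ)) k = mollCoeff ρ ε k * pairing ξ (-k) := by
    intro k
    simp only [mollified_eq ρ hε ξ]
    exact coeff_tsum_mode hs k
  rw [potential, invLaplacian]
  congr 1
  refine tsum_congr fun m => ?_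
  rw [hc, potCoeff, green, neg_neg, freqSq_neg]
  split_ifs with hm
  · simp [hm, freqSq_zero]
  · ring

theorem RapidDecay.fderiv_tsum_single {b : (Fin 2 → ℤ) → ℂ} (hb : RapidDecay b) (x : Plane) (j : Fin 2) :
    fderiv ℝ (fun x => ∑' m, b m * mode m x) x (EuclideanSpace.single j 1) =
      ∑' m, Complex.I * (m j : ℂ) * b m * mode m x := by
  have hd : ∀ m, Differentiable ℝ fun y => b m * mode m y := fun m =>
    (contDiff_const.mul (contDiff_mode m (n := 1))).differentiable one_ne_zero
  have hbd : ∀ m x, ‖fderiv ℝ (fun y => b m * mode m y) x‖ ≤ (1 + freqSq m) ^ 1 * ‖b m‖ := by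
    intro m x
    rw [← norm_iteratedFDeriv_one]
    exact RapidDecay.norm_iteratedFDeriv_term_le b 1 m x
  have h := hasFDerivAt_tsum (hb 1) (fun m x => (hd m x).hasFDerivAt) hbd (x₀ := 0)
    (summable_smul_mode hb.summable_norm 0) x
  have hsum : Summable fun m => fderiv ℝ (fun y => b m * mode m y) x :=
    Summable.of_norm_bounded (hb 1) fun m => hbd m x
  rw [h.fderiv]
  have h2 := (ContinuousLinearMap.apply ℝ ℂ (EuclideanSpace.single j (1 : ℝ) : Plane)).map_tsum hsum
  simp only [ContinuousLinearMap.apply_apply] at h2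
  rw [h2]
  refine tsum_congr fun m => ?_
  rw [fderiv_const_mul ((contDiff_mode m (n := 1)).differentiable one_ne_zero _), smul_apply,
    fderiv_mode_single, smul_eq_mul]
  ring

theorem isC1Potential_potential (ρ : Mollifier) {ε : ℝ} (hε : ε ∈ Set.Ioo (0 : ℝ) 1)
    (ξ : TorusDistribution) : IsC1Potential (potential ρ ε ξ) := by
  have h : potential ρ ε ξ = fun x => (∑' m, potCoeff ρ ε ξ m * mode m x).re :=
    funext (potential_eq ρ hε ξ)
  constructor
  · intro k x
    simp only [h, isPeriodic_mode _ k x]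
  · rw [h]
    exact Complex.reCLM.contDiff.comp ((rapidDecay_potCoeff ρ hε ξ).contDiff_tsum.of_le
      (by exact_mod_cast le_top))

/-- Reindexing a Fourier series of the potential by the pairings with the noise. -/
theorem tsum_potCoeff_eq (ρ : Mollifier) (ε : ℝ) (ξ : TorusDistribution) (g : (Fin 2 → ℤ) → ℂ) :
    ∑' m, g m * potCoeff ρ ε ξ m = ∑' m, g (-m) * green ρ ε m * pairing ξ m := by
  rw [← (Equiv.neg (Fin 2 → ℤ)).tsum_eq]
  refine tsum_congr fun m => ?_
  rw [Equiv.neg_apply, potCoeff, neg_neg, mul_assoc]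

theorem gradient_potential (ρ : Mollifier) {ε : ℝ} (hε : ε ∈ Set.Ioo (0 : ℝ) 1)
    (ξ : TorusDistribution) (x : Plane) (j : Fin 2) :
    gradient (potential ρ ε ξ) x j =
      (∑' m, Complex.I * (m j : ℂ) * mode m x * potCoeff ρ ε ξ m).re := by
  have h : potential ρ ε ξ = Complex.reCLM ∘ fun x => ∑' m, potCoeff ρ ε ξ m * mode m x :=
    funext (potential_eq ρ hε ξ)
  have hr := rapidDecay_potCoeff ρ hε ξ
  have hd : DifferentiableAt ℝ (fun x => ∑' m, potCoeff ρ ε ξ m * mode m x) x :=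
    (hr.contDiff_tsum.differentiable (by simp)) x
  rw [gradient_apply, h, (Complex.reCLM.hasFDerivAt.comp x hd.hasFDerivAt).fderiv,
    ContinuousLinearMap.comp_apply, hr.fderiv_tsum_single, Complex.reCLM_apply]
  congr 1
  refine tsum_congr fun m => ?_
  ring

/-! ### Gaussian moments -/

/-- The exponential cancels half of the Gaussian exponent; what remains is a Gaussian of variance
`2v` with the normalization of variance `v`, off by `√2`. -/
theorem lintegral_exp_sq_gaussianReal {v : ℝ≥0} (hv : v ≠ 0) :
    ∫⁻ x, ENNReal.ofReal (Real.exp (x ^ 2 / (4 * v))) ∂gaussianReal 0 v = ENNReal.ofReal (√2) := by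
  have hv0 : (0 : ℝ) < v := by positivity
  rw [gaussianReal_of_var_ne_zero 0 hv, lintegral_withDensity_eq_lintegral_mul _
    (measurable_gaussianPDF 0 v) (by fun_prop)]
  have h : ∀ x, (gaussianPDF 0 v * fun x => ENNReal.ofReal (Real.exp (x ^ 2 / (4 * v)))) x =
      ENNReal.ofReal ((√(2 * Real.pi * v))⁻¹ * Real.exp (-(4 * v : ℝ)⁻¹ * x ^ 2)) := by
    intro x
    rw [Pi.mul_apply, gaussianPDF, ← ENNReal.ofReal_mul (gaussianPDFReal_nonneg 0 v x), gaussianPDFReal,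
      mul_assoc, ← Real.exp_add]
    congr 3
    field_simp
    ring
  simp only [h]
  rw [← ofReal_integral_eq_lintegral_ofReal
    ((integrable_exp_neg_mul_sq (by positivity)).const_mul _)
    (Eventually.of_forall fun x => by positivity), integral_const_mul, integral_gaussian]
  congr 1
  rw [← Real.sqrt_inv, ← Real.sqrt_mul (by positivity)]
  congr 1
  field_simp
  ring

/-- From `tⁿ / n! ≤ exp t` at `t = x² / (4v)` and the preceding exponential moment. -/
theorem lintegral_pow_gaussianReal_le (v : ℝ≥0) (n : ℕ) :
    ∫⁻ x, ‖x‖ₑ ^ (2 * n) ∂gaussianReal 0 v ≤ ENNReal.ofReal (√2 * (4 * v) ^ n * n.factorial) := by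
  have h1 : (1 : ℝ) ≤ √2 := Real.one_le_sqrt.2 one_le_two
  rcases eq_or_ne v 0 with rfl | hv
  · rw [gaussianReal_zero_var, lintegral_dirac]
    rcases eq_or_ne n 0 with rfl | hn
    · simp
    · simp [hn]
  · have hv0 : (0 : ℝ) < v := by positivity
    calc _ ≤ ∫⁻ x, ENNReal.ofReal ((4 * v) ^ n * n.factorial) *
          ENNReal.ofReal (Real.exp (x ^ 2 / (4 * v))) ∂gaussianReal 0 v := by
          refine lintegral_mono fun x => ?_
          rw [← ENNReal.ofReal_mul (by positivity), ← ofReal_norm, ← ENNReal.ofReal_pow (norm_nonneg _)]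
          refine ENNReal.ofReal_le_ofReal ?_
          have h2 := Real.pow_div_factorial_le_exp (x ^ 2 / (4 * v)) (by positivity) n
          rw [div_le_iff₀ (by positivity), div_pow, div_le_iff₀ (by positivity)] at h2
          rw [pow_mul, Real.norm_eq_abs, sq_abs]
          linarith
      _ = _ := by
          rw [lintegral_const_mul _ (by fun_prop), lintegral_exp_sq_gaussianReal hv,
            ← ENNReal.ofReal_mul (by positivity)]
          congr 1
          ring

theorem norm_sq_trigSum (F : Finset (Fin 2 → ℤ)) (a : (Fin 2 → ℤ) → ℂ) :
    ∫ x, ‖∑ m ∈ F, a m * mode m x‖ ^ 2 ∂torusMeasure = (2 * Real.pi) ^ 2 * ∑ m ∈ F, ‖a m‖ ^ 2 := by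
  classical
  have h1 : ∫ x, ‖∑ m ∈ F, a m * mode m x‖ ^ 2 ∂torusMeasure = ‖(∑ m ∈ F, a m • modeL2 m : L2T)‖ ^ 2 := by
    rw [norm_sq_eq_integral]
    refine integral_congr_ae ?_
    filter_upwards [coeFn_trigSum F a] with x hx
    rw [hx]
  have hc : ∀ k, coeff (∑ m ∈ F, a m • modeL2 m : L2T) k = if k ∈ F then a k else 0 := by
    intro k
    rw [coeff_eq_inner, inner_sum, Finset.mul_sum]
    have : ∀ m ∈ F, (((2 * Real.pi) ^ 2 : ℝ) : ℂ)⁻¹ * inner ℂ (modeL2 k) (a m • modeL2 m) =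
        if k = m then a m else 0 := by
      intro m _
      rw [inner_smul_right, mul_left_comm, ← coeff_eq_inner, coeff_modeL2]
      split_ifs <;> simp
    rw [Finset.sum_congr rfl this, Finset.sum_ite_eq]
  rw [h1, norm_sq_eq_tsum, tsum_eq_sum (s := F) fun m hm => by rw [hc, if_neg hm]; simp]
  congr 1
  exact Finset.sum_congr rfl fun m hm => by rw [hc, if_pos hm]

theorem integral_sq_sub_average_le {φ : Plane → ℝ} (hφ : Continuous φ) {C : ℝ} (hC : ∀ x, ‖φ x‖ ≤ C) :
    centeredSq φ ≤ ∫ x, φ x ^ 2 ∂torusMeasure := by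
  have h1 : Integrable φ torusMeasure := integrable_bcf hφ hC
  have h2 : Integrable (fun x => φ x ^ 2) torusMeasure :=
    integrable_bcf (by fun_prop) (C := C ^ 2) fun x => by
      rw [norm_pow]; exact pow_le_pow_left₀ (norm_nonneg _) (hC x) 2
  have h3 : centeredSq φ = ∫ x, φ x ^ 2 ∂torusMeasure - (2 * Real.pi) ^ 2 * average φ ^ 2 := by
    have e : ∀ x, (φ x - average φ) ^ 2 = φ x ^ 2 - 2 * average φ * φ x + average φ ^ 2 :=
      fun x => by ring
    have e2 : ∫ x, φ x ∂torusMeasure = (2 * Real.pi) ^ 2 * average φ := by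
      rw [average, mul_inv_cancel_left₀ (by positivity)]
    simp only [centeredSq, e]
    have h4 : Integrable (fun x => φ x ^ 2 - 2 * average φ * φ x) torusMeasure :=
      h2.sub (h1.const_mul _)
    rw [integral_add h4 (integrable_const _), integral_sub h2 (h1.const_mul _),
      integral_const_mul, integral_torus_const, e2]
    ring
  rw [h3]
  have : 0 ≤ (2 * Real.pi) ^ 2 * average φ ^ 2 := by positivity
  linarith

/-- Neither subtracting the average nor taking the real part increases the `L²` norm. Only this
upper bound on the variance of the noise enters the moment estimates. -/
theorem centeredSq_trigTest_le (F : Finset (Fin 2 → ℤ)) (a : (Fin 2 → ℤ) → ℂ) :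
    centeredSq (trigTest F a : Plane → ℝ) ≤ (2 * Real.pi) ^ 2 * ∑ m ∈ F, ‖a m‖ ^ 2 := by
  have hc : Continuous fun x => ∑ m ∈ F, a m * mode m x :=
    continuous_finsetSum _ fun m _ => continuous_const.mul (continuous_mode m)
  have hbd := norm_trigPoly_le F a
  have hre : ∀ x, ‖(trigTest F a : Plane → ℝ) x‖ ≤ ‖∑ m ∈ F, a m * mode m x‖ := fun x =>
    Complex.abs_re_le_norm _
  refine (integral_sq_sub_average_le (Complex.continuous_re.comp hc)
    fun x => (hre x).trans (hbd x)).trans ?_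
  rw [← norm_sq_trigSum]
  refine integral_mono_of_nonneg (Eventually.of_forall fun x => sq_nonneg _)
    (integrable_bcf (by fun_prop) (C := (∑ m ∈ F, ‖a m‖) ^ 2) fun x => ?_)
    (Eventually.of_forall fun x => ?_)
  · rw [norm_pow, norm_norm]; exact pow_le_pow_left₀ (norm_nonneg _) (hbd x) 2
  · simp only
    rw [← sq_abs, ← Real.norm_eq_abs]
    exact pow_le_pow_left₀ (norm_nonneg _) (hre x) 2

section Moments

variable {Ω : Type*} [MeasurableSpace Ω] {μ : Measure Ω} {ξ : Ω → TorusDistribution}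

theorem measurable_pairing (hξ : IsWhiteNoise μ ξ) (m : Fin 2 → ℤ) :
    Measurable fun ω => pairing (ξ ω) m :=
  (Complex.measurable_ofReal.comp (hξ.measurable _)).add
    (measurable_const.mul (Complex.measurable_ofReal.comp (hξ.measurable _)))

theorem lintegral_toLin_pow_le (hξ : IsWhiteNoise μ ξ) (F : Finset (Fin 2 → ℤ))
    (a : (Fin 2 → ℤ) → ℂ) {V : ℝ} (hV : (2 * Real.pi) ^ 2 * ∑ m ∈ F, ‖a m‖ ^ 2 ≤ V) (n : ℕ) :
    ∫⁻ ω, ‖(ξ ω).toLin (trigTest F a)‖ₑ ^ (2 * n) ∂μ ≤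
      ENNReal.ofReal (√2 * (4 * V) ^ n * n.factorial) := by
  have h1 : ∫⁻ ω, ‖(ξ ω).toLin (trigTest F a)‖ₑ ^ (2 * n) ∂μ =
      ∫⁻ x, ‖x‖ₑ ^ (2 * n) ∂(μ.map fun ω => (ξ ω).toLin (trigTest F a)) :=
    (lintegral_map (measurable_enorm.pow_const _) (hξ.measurable _)).symm
  rw [h1, hξ.law]
  refine (lintegral_pow_gaussianReal_le _ n).trans (ENNReal.ofReal_le_ofReal ?_)
  have h2 : ((centeredSq (trigTest F a : Plane → ℝ)).toNNReal : ℝ) ≤ V := by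
    rw [Real.coe_toNNReal']
    exact max_le ((centeredSq_trigTest_le F a).trans hV) (le_trans (by positivity) hV)
  gcongr

/-- Moments of finite linear combinations of Fourier modes of the noise. -/
theorem lintegral_sum_pairing_pow_le (hξ : IsWhiteNoise μ ξ) (F : Finset (Fin 2 → ℤ))
    (a : (Fin 2 → ℤ) → ℂ) {V : ℝ} (hV : (2 * Real.pi) ^ 2 * ∑ m ∈ F, ‖a m‖ ^ 2 ≤ V) (n : ℕ) :
    ∫⁻ ω, ‖∑ m ∈ F, a m * pairing (ξ ω) m‖ₑ ^ (2 * n) ∂μ ≤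
      ENNReal.ofReal (4 * (8 * V) ^ n * n.factorial) := by
  have hV0 : 0 ≤ V := le_trans (by positivity) hV
  have hb := lintegral_toLin_pow_le hξ F (fun m => -Complex.I * a m) (V := V) (by simpa using hV) n
  have ha := lintegral_toLin_pow_le hξ F a hV n
  -- The real and imaginary parts of the sum are each a single Gaussian variable, the second with
  -- coefficients `-i a_m`. The factor `2ⁿ` from splitting turns `(4V)ⁿ` into `(8V)ⁿ`.
  have hpt : ∀ ω, ‖∑ m ∈ F, a m * pairing (ξ ω) m‖ₑ ^ (2 * n) ≤
      2 ^ n * (‖(ξ ω).toLin (trigTest F a)‖ₑ ^ (2 * n) +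
        ‖(ξ ω).toLin (trigTest F fun m => -Complex.I * a m)‖ₑ ^ (2 * n)) := by
    intro ω
    set z := ∑ m ∈ F, a m * pairing (ξ ω) m with hz
    have e1 : (ξ ω).toLin (trigTest F a) = z.re := toLin_trigTest _ _ _
    have e2 : (ξ ω).toLin (trigTest F fun m => -Complex.I * a m) = z.im := by
      rw [toLin_trigTest, hz, Complex.im_sum, Complex.re_sum]
      refine Finset.sum_congr rfl fun m _ => ?_
      simp only [neg_mul, Complex.neg_re, mul_assoc, Complex.I_mul_re, neg_neg]
    rw [e1, e2]
    simp only [← ofReal_norm, ← ENNReal.ofReal_pow (norm_nonneg _)]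
    rw [← ENNReal.ofReal_add (by positivity) (by positivity)]
    have e3 : (2 : ℝ≥0∞) ^ n = ENNReal.ofReal (2 ^ n) := by
      rw [ENNReal.ofReal_pow (by norm_num)]; simp
    rw [e3, ← ENNReal.ofReal_mul (by positivity)]
    refine ENNReal.ofReal_le_ofReal ?_
    have h1 := add_pow_le (sq_nonneg z.re) (sq_nonneg z.im) n
    have h2 : (2 : ℝ) ^ (n - 1) ≤ 2 ^ n := pow_le_pow_right₀ one_le_two (Nat.sub_le _ _)
    rw [pow_mul, ← Complex.normSq_eq_norm_sq, Complex.normSq_apply, ← sq, ← sq, pow_mul, pow_mul,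
      Real.norm_eq_abs, Real.norm_eq_abs, sq_abs, sq_abs]
    exact h1.trans (mul_le_mul_of_nonneg_right h2 (by positivity))
  calc _ ≤ ∫⁻ ω, 2 ^ n * (‖(ξ ω).toLin (trigTest F a)‖ₑ ^ (2 * n) +
        ‖(ξ ω).toLin (trigTest F fun m => -Complex.I * a m)‖ₑ ^ (2 * n)) ∂μ := lintegral_mono hpt
    _ = 2 ^ n * (∫⁻ ω, ‖(ξ ω).toLin (trigTest F a)‖ₑ ^ (2 * n) ∂μ +
        ∫⁻ ω, ‖(ξ ω).toLin (trigTest F fun m => -Complex.I * a m)‖ₑ ^ (2 * n) ∂μ) := by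
        rw [lintegral_const_mul' _ _ (by finiteness),
          lintegral_add_left ((hξ.measurable _).enorm.pow_const _)]
    _ ≤ 2 ^ n * (ENNReal.ofReal (√2 * (4 * V) ^ n * n.factorial) +
        ENNReal.ofReal (√2 * (4 * V) ^ n * n.factorial)) := by gcongr
    _ ≤ _ := by
        have e3 : (2 : ℝ≥0∞) ^ n = ENNReal.ofReal (2 ^ n) := by
          rw [ENNReal.ofReal_pow (by norm_num)]; simp
        rw [← ENNReal.ofReal_add (by positivity) (by positivity), e3,
          ← ENNReal.ofReal_mul (by positivity)]
        refine ENNReal.ofReal_le_ofReal ?_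
        have hs : √2 ≤ 2 := Real.sqrt_le_iff.2 ⟨by norm_num, by norm_num⟩
        have e4 : (8 * V) ^ n = 2 ^ n * (4 * V) ^ n := by rw [← mul_pow]; ring_nf
        rw [e4]
        calc _ = (2 * √2) * (2 ^ n * (4 * V) ^ n * n.factorial) := by ring
          _ ≤ (2 * 2) * (2 ^ n * (4 * V) ^ n * n.factorial) := by gcongr
          _ = _ := by ring

theorem summable_mul_pairing {a : (Fin 2 → ℤ) → ℂ} (ha : RapidDecay a) (ξ : TorusDistribution) :
    Summable fun m => a m * pairing ξ m :=
  (ha.mul_pairing ξ).summable_norm.of_norm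

/-- Moments of Fourier series of the noise. -/
theorem lintegral_tsum_pairing_pow_le (hξ : IsWhiteNoise μ ξ) {a : (Fin 2 → ℤ) → ℂ}
    (ha : RapidDecay a) {V : ℝ}
    (hV : ∀ F : Finset (Fin 2 → ℤ), (2 * Real.pi) ^ 2 * ∑ m ∈ F, ‖a m‖ ^ 2 ≤ V) (n : ℕ) :
    ∫⁻ ω, ‖∑' m, a m * pairing (ξ ω) m‖ₑ ^ (2 * n) ∂μ ≤
      ENNReal.ofReal (4 * (8 * V) ^ n * n.factorial) := by
  -- Fatou's lemma along a sequence of finite sets exhausting the frequencies; `V` bounds the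
  -- variance of every partial sum.
  obtain ⟨u, hu⟩ := exists_seq_tendsto (atTop : Filter (Finset (Fin 2 → ℤ)))
  have hlim : ∀ ω, Tendsto (fun i => ‖∑ m ∈ u i, a m * pairing (ξ ω) m‖ₑ ^ (2 * n)) atTop
      (𝓝 (‖∑' m, a m * pairing (ξ ω) m‖ₑ ^ (2 * n))) := by
    intro ω
    have h1 := (summable_mul_pairing ha (ξ ω)).hasSum.comp hu
    exact ((ENNReal.continuous_pow (2 * n)).tendsto _).comp ((continuous_enorm.tendsto _).comp h1)
  have hmeas : ∀ i, Measurable fun ω => ‖∑ m ∈ u i, a m * pairing (ξ ω) m‖ₑ ^ (2 * n) := fun i =>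
    ((Finset.measurable_fun_sum _ fun m _ => (measurable_pairing hξ m).const_mul _).enorm).pow_const _
  calc _ = ∫⁻ ω, liminf (fun i => ‖∑ m ∈ u i, a m * pairing (ξ ω) m‖ₑ ^ (2 * n)) atTop ∂μ :=
        lintegral_congr fun ω => (hlim ω).liminf_eq.symm
    _ ≤ liminf (fun i => ∫⁻ ω, ‖∑ m ∈ u i, a m * pairing (ξ ω) m‖ₑ ^ (2 * n) ∂μ) atTop :=
        lintegral_liminf_le hmeas
    _ ≤ _ := by
        refine liminf_le_of_frequently_le' (Frequently.of_forall fun i => ?_)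
        exact lintegral_sum_pairing_pow_le hξ (u i) a (hV _) n

end Moments

/-! ### Random Fourier series -/

/-- The convolution of a distribution with the kernel of Fourier coefficients `b`. -/
noncomputable def noiseSeries (b : (Fin 2 → ℤ) → ℂ) (ξ : TorusDistribution) (x : Plane) : ℂ :=
  ∑' m, b m * mode (-m) x * pairing ξ m

theorem RapidDecay.mul_mode {b : (Fin 2 → ℤ) → ℂ} (hb : RapidDecay b) (x : Plane) :
    RapidDecay fun m => b m * mode (-m) x :=
  hb.of_norm_le fun m => by rw [norm_mul, norm_mode, mul_one]

theorem norm_noiseSeries_le {b : (Fin 2 → ℤ) → ℂ} (hb : RapidDecay b) (ξ : TorusDistribution)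
    (x : Plane) : ‖noiseSeries b ξ x‖ ≤ ∑' m, ‖b m * pairing ξ m‖ := by
  refine tsum_of_norm_bounded (hb.mul_pairing ξ).summable_norm.hasSum fun m => ?_
  rw [norm_mul, norm_mul, norm_mode, mul_one, norm_mul]

theorem continuous_noiseSeries {b : (Fin 2 → ℤ) → ℂ} (hb : RapidDecay b) (ξ : TorusDistribution) :
    Continuous (noiseSeries b ξ) := by
  refine continuous_tsum (fun m => ?_) (hb.mul_pairing ξ).summable_norm fun m x => ?_
  · exact (continuous_const.mul (continuous_mode _)).mul continuous_const
  · rw [norm_mul, norm_mul, norm_mode, mul_one, norm_mul]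

section Measurable

variable {Ω : Type*} [MeasurableSpace Ω] {μ : Measure Ω} {ξ : Ω → TorusDistribution}

theorem measurable_noiseSeries (hξ : IsWhiteNoise μ ξ) {b : (Fin 2 → ℤ) → ℂ} (hb : RapidDecay b) :
    Measurable fun p : Ω × Plane => noiseSeries b (ξ p.1) p.2 := by
  refine measurable_of_tendsto_metrizable' (atTop : Filter (Finset (Fin 2 → ℤ)))
    (f := fun F p => ∑ m ∈ F, b m * mode (-m) p.2 * pairing (ξ p.1) m) (fun F => ?_) ?_
  · refine Finset.measurable_fun_sum _ fun m _ => ?_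
    exact (measurable_const.mul ((continuous_mode _).measurable.comp measurable_snd)).mul
      ((measurable_pairing hξ m).comp measurable_fst)
  · exact tendsto_pi_nhds.2 fun p => (summable_mul_pairing (hb.mul_mode p.2) (ξ p.1)).hasSum

theorem lintegral_noiseSeries_pow_le (hξ : IsWhiteNoise μ ξ) {b : (Fin 2 → ℤ) → ℂ}
    (hb : RapidDecay b) {V : ℝ}
    (hV : ∀ F : Finset (Fin 2 → ℤ), (2 * Real.pi) ^ 2 * ∑ m ∈ F, ‖b m‖ ^ 2 ≤ V) (x : Plane) (n : ℕ) :
    ∫⁻ ω, ‖noiseSeries b (ξ ω) x‖ₑ ^ (2 * n) ∂μ ≤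
      ENNReal.ofReal (4 * (8 * V) ^ n * n.factorial) :=
  lintegral_tsum_pairing_pow_le hξ (hb.mul_mode x)
    (fun F => by simpa only [norm_mul, norm_mode, mul_one] using hV F) n

/-- Moments of an integral of a random function with uniformly bounded moments. -/
theorem lintegral_lintegral_pow_le {E : Type*} [MeasurableSpace E] {ν : Measure E}
    [IsFiniteMeasure ν] [SFinite μ] {g : Ω → E → ℝ≥0∞} (hg : Measurable (Function.uncurry g)) {n : ℕ}
    (hn : n ≠ 0) {B : ℝ≥0∞} (hB : ∀ e, ∫⁻ ω, g ω e ^ n ∂μ ≤ B) :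
    ∫⁻ ω, (∫⁻ e, g ω e ∂ν) ^ n ∂μ ≤ ν Set.univ ^ n * B := by
  have hn1 : (1 : ℝ) ≤ n := by exact_mod_cast Nat.one_le_iff_ne_zero.2 hn
  -- Jensen's inequality for the finite measure `ν`; exchanging the integrals then leaves the
  -- moments at fixed `e`.
  have hJ : ∀ ω, (∫⁻ e, g ω e ∂ν) ^ n ≤ ν Set.univ ^ (n - 1) * ∫⁻ e, g ω e ^ n ∂ν := by
    intro ω
    have hm : Measurable (g ω) := hg.comp measurable_prodMk_left
    have h1 := eLpNorm'_le_eLpNorm'_mul_rpow_measure_univ one_pos hn1 (μ := ν)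
      hm.aestronglyMeasurable
    simp only [eLpNorm', enorm_eq_self, ENNReal.rpow_one, div_one, ENNReal.rpow_natCast] at h1
    refine (pow_le_pow_left₀ zero_le h1 n).trans_eq ?_
    have hn0 : (n : ℝ) ≠ 0 := by exact_mod_cast hn
    rw [mul_pow, ← ENNReal.rpow_mul_natCast, ← ENNReal.rpow_mul_natCast, one_div,
      inv_mul_cancel₀ hn0, ENNReal.rpow_one, sub_mul, one_mul, inv_mul_cancel₀ hn0, mul_comm,
      ← ENNReal.rpow_natCast, Nat.cast_sub (Nat.one_le_iff_ne_zero.2 hn), Nat.cast_one]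
  calc _ ≤ ∫⁻ ω, ν Set.univ ^ (n - 1) * ∫⁻ e, g ω e ^ n ∂ν ∂μ := lintegral_mono hJ
    _ = ν Set.univ ^ (n - 1) * ∫⁻ e, ∫⁻ ω, g ω e ^ n ∂μ ∂ν := by
        rw [lintegral_const_mul' _ _ (by finiteness), lintegral_lintegral_swap]
        exact (hg.pow_const n).aemeasurable
    _ ≤ ν Set.univ ^ (n - 1) * ∫⁻ e, B ∂ν := by gcongr; exact hB _
    _ = _ := by
        rw [lintegral_const, mul_comm B, ← mul_assoc, ← pow_succ, Nat.sub_add_cancel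
          (Nat.one_le_iff_ne_zero.2 hn)]

end Measurable

/-! ### Bernstein's inequality -/

theorem freqSq_add_le (k l : Fin 2 → ℤ) : freqSq (k + l) ≤ 2 * freqSq k + 2 * freqSq l := by
  simp only [freqSq, Fin.sum_univ_two, Pi.add_apply, Int.cast_add]
  nlinarith [sq_nonneg ((k 0 : ℝ) - l 0), sq_nonneg ((k 1 : ℝ) - l 1)]

/-- Bernstein's inequality for trigonometric polynomials. -/
theorem norm_trigPoly_pow_four_le (F : Finset (Fin 2 → ℤ)) (c : (Fin 2 → ℤ) → ℂ) {N : ℝ} (hN : 1 ≤ N)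
    (hF : ∀ m ∈ F, freqSq m ≤ N) (x : Plane) :
    ‖∑ m ∈ F, c m * mode m x‖ ^ 4 ≤
      1024 * N * ∫ y, ‖∑ m ∈ F, c m * mode m y‖ ^ 4 ∂torusMeasure := by
  classical
  -- The `L²`–`L^∞` bound is applied to the square of the polynomial, whose frequencies satisfy
  -- `|n|² ≤ 4N`; taking `R² = 4N` makes all the weights comparable.
  set G := (F ×ˢ F).image fun p => p.1 + p.2 with hG
  set d : (Fin 2 → ℤ) → ℂ := fun n => ∑ p ∈ F ×ˢ F with p.1 + p.2 = n, c p.1 * c p.2 with hd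
  have hsq : ∀ y, (∑ m ∈ F, c m * mode m y) ^ 2 = ∑ n ∈ G, d n * mode n y := by
    intro y
    rw [sq, Finset.sum_mul_sum, ← Finset.sum_product', hG,
      ← Finset.sum_fiberwise_of_maps_to (g := fun p : (Fin 2 → ℤ) × (Fin 2 → ℤ) => p.1 + p.2)
        (fun p hp => Finset.mem_image_of_mem _ hp)]
    refine Finset.sum_congr rfl fun n _ => ?_
    rw [hd, Finset.sum_mul]
    refine Finset.sum_congr rfl fun p hp => ?_
    rw [← (Finset.mem_filter.1 hp).2, mode_add]
    ring
  have h4 : ∀ y, ‖∑ m ∈ F, c m * mode m y‖ ^ 4 = ‖∑ n ∈ G, d n * mode n y‖ ^ 2 := by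
    intro y
    rw [← hsq, norm_pow, ← pow_mul]
  simp only [h4]
  have hR : 1 ≤ 2 * √N := by nlinarith [Real.one_le_sqrt.2 hN]
  have hR2 : (2 * √N) ^ 2 = 4 * N := by rw [mul_pow, Real.sq_sqrt (by linarith)]; ring
  have hGn : ∀ n ∈ G, freqSq n ≤ 4 * N := by
    intro n hn
    obtain ⟨p, hp, rfl⟩ := Finset.mem_image.1 hn
    have := freqSq_add_le p.1 p.2
    linarith [hF _ (Finset.mem_product.1 hp).1, hF _ (Finset.mem_product.1 hp).2]
  have hpi : (1 : ℝ) ≤ (2 * Real.pi) ^ 2 := by nlinarith [Real.pi_gt_three]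
  rw [norm_sq_trigSum]
  calc _ ≤ (∑ n ∈ G, ‖d n‖) ^ 2 := pow_le_pow_left₀ (norm_nonneg _) (norm_trigPoly_le G d x) 2
    _ ≤ 64 / (2 * √N) ^ 2 * ∑ n ∈ G, ((2 * √N) ^ 2 + freqSq n) ^ 2 * ‖d n‖ ^ 2 :=
        sq_sum_norm_le G d hR
    _ ≤ 64 / (4 * N) * ∑ n ∈ G, (8 * N) ^ 2 * ‖d n‖ ^ 2 := by
        rw [hR2]
        gcongr with n hn
        · have := freqSq_nonneg n; linarith
        · linarith [hGn n hn]
    _ = 1024 * N * (1 * ∑ n ∈ G, ‖d n‖ ^ 2) := by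
        rw [← Finset.mul_sum]; field_simp; ring
    _ ≤ _ := by gcongr

/-! ### Dyadic blocks and the supremum of the potential -/

/-- The index `j` of the block `256 ^ j ≤ |m|² < 256 ^ (j + 1)` that contains `m`. -/
def blockIndex (m : Fin 2 → ℤ) : ℕ := Nat.log 256 (m 0 ^ 2 + m 1 ^ 2).natAbs

theorem natAbs_eq_freqSq (m : Fin 2 → ℤ) : ((m 0 ^ 2 + m 1 ^ 2).natAbs : ℝ) = freqSq m := by
  have h : (0 : ℤ) ≤ m 0 ^ 2 + m 1 ^ 2 := by positivity
  rw [Nat.cast_natAbs, abs_of_nonneg h, freqSq, Fin.sum_univ_two]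
  push_cast
  rfl

theorem freqSq_lt_pow_blockIndex (m : Fin 2 → ℤ) : freqSq m < 256 ^ (blockIndex m + 1) := by
  rw [← natAbs_eq_freqSq]
  exact_mod_cast Nat.lt_pow_succ_log_self (by norm_num) _

theorem pow_blockIndex_le_freqSq {m : Fin 2 → ℤ} (hm : m ≠ 0) : 256 ^ blockIndex m ≤ freqSq m := by
  rw [← natAbs_eq_freqSq]
  have h := one_le_freqSq hm
  rw [← natAbs_eq_freqSq] at h
  have h0 : (m 0 ^ 2 + m 1 ^ 2).natAbs ≠ 0 := by
    have : 1 ≤ (m 0 ^ 2 + m 1 ^ 2).natAbs := by exact_mod_cast h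
    omega
  exact_mod_cast Nat.pow_log_le_self 256 h0

theorem pow_blockIndex_le (m : Fin 2 → ℤ) : 256 ^ blockIndex m ≤ 1 + freqSq m := by
  rcases eq_or_ne m 0 with rfl | hm
  · simp [blockIndex, freqSq_zero]
  · linarith [pow_blockIndex_le_freqSq hm]

theorem finite_blockIndex (j : ℕ) : {m | blockIndex m = j}.Finite := by
  refine (Set.finite_Icc (fun _ : Fin 2 => -(256 ^ (j + 1) : ℤ)) (fun _ => 256 ^ (j + 1))).subset ?_
  intro m hm
  have h1 := freqSq_lt_pow_blockIndex m
  rw [show blockIndex m = j from hm] at h1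
  have h2 : ∀ i, |m i| ≤ 256 ^ (j + 1) := fun i => by
    have h3 : ((m i ^ 2 : ℤ) : ℝ) < ((256 ^ (j + 1) : ℤ) : ℝ) := by
      push_cast; exact (sq_le_freqSq m i).trans_lt h1
    have h4 : m i ^ 2 < 256 ^ (j + 1) := by exact_mod_cast h3
    have h5 := Int.le_self_sq |m i|
    rw [sq_abs] at h5
    linarith
  exact ⟨fun i => (abs_le.1 (h2 i)).1, fun i => (abs_le.1 (h2 i)).2⟩

/-- The Fourier coefficients of the `j`-th block of the mollified Green function, times `16 ^ j`. -/
noncomputable def blockGreen (ρ : Mollifier) (ε : ℝ) (j : ℕ) (m : Fin 2 → ℤ) : ℂ :=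
  if blockIndex m = j then 16 ^ j * green ρ ε m else 0

theorem norm_blockGreen_le (ρ : Mollifier) (ε : ℝ) (j : ℕ) (m : Fin 2 → ℤ) :
    ‖blockGreen ρ ε j m‖ ≤ (1 + freqSq m) * ‖green ρ ε m‖ := by
  have h0 := freqSq_nonneg m
  rw [blockGreen]
  split_ifs with h
  · rw [norm_mul, norm_pow, Complex.norm_ofNat]
    refine mul_le_mul_of_nonneg_right ?_ (norm_nonneg _)
    subst h
    exact (pow_le_pow_left₀ (by norm_num) (by norm_num) _).trans (pow_blockIndex_le m)
  · rw [norm_zero]; positivity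

theorem rapidDecay_blockGreen (ρ : Mollifier) {ε : ℝ} (hε : ε ∈ Set.Ioo (0 : ℝ) 1) (j : ℕ) :
    RapidDecay (blockGreen ρ ε j) :=
  (rapidDecay_green ρ hε).of_bound (C := 1) (N := 1) fun m => by
    simpa using norm_blockGreen_le ρ ε j m

theorem exists_norm_green_le (ρ : Mollifier) :
    ∃ C, 0 ≤ C ∧ ∀ ε > 0, ∀ m, ‖green ρ ε m‖ ≤ C * (freqSq m)⁻¹ := by
  obtain ⟨C, hC0, hC⟩ := exists_mollCoeff_le ρ 0
  refine ⟨C, hC0, fun ε hε m => ?_⟩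
  rw [green, norm_neg, norm_mul, norm_inv, Complex.norm_real, Real.norm_of_nonneg (freqSq_nonneg m),
    mul_comm]
  have := hC ε hε (-m)
  rw [pow_zero, one_mul] at this
  exact mul_le_mul_of_nonneg_right this (inv_nonneg.2 (freqSq_nonneg m))

/-- In block `j` there are `O(256^j)` modes with Green coefficients `O(256^(-j))`, so the factor
`16^j` brings the variance to order one, uniformly in `ε` and `j`. -/
theorem exists_blockGreen_variance_le (ρ : Mollifier) :
    ∃ V : ℝ, 0 ≤ V ∧ ∀ ε > 0, ∀ (j : ℕ) (F : Finset (Fin 2 → ℤ)),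
      (2 * Real.pi) ^ 2 * ∑ m ∈ F, ‖blockGreen ρ ε j m‖ ^ 2 ≤ V := by
  obtain ⟨C, hC0, hC⟩ := exists_norm_green_le ρ
  refine ⟨(2 * Real.pi) ^ 2 * (256 * C ^ 2), by positivity, fun ε hε j F => ?_⟩
  refine mul_le_mul_of_nonneg_left ?_ (by positivity)
  have hR : (1 : ℝ) ≤ 16 ^ j := one_le_pow₀ (by norm_num)
  have hR2 : ((16 : ℝ) ^ j) ^ 2 = 256 ^ j := by rw [← pow_mul, mul_comm, pow_mul]; norm_num
  have hterm : ∀ m ∈ F, ‖blockGreen ρ ε j m‖ ^ 2 ≤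
      4 * C ^ 2 * 256 ^ j * (((16 ^ j) ^ 2 + freqSq m) ^ 2)⁻¹ := by
    intro m _
    have h0 := freqSq_nonneg m
    rw [blockGreen]
    split_ifs with h
    · rcases eq_or_ne m 0 with rfl | hm
      · have : green ρ ε 0 = 0 := by simp [green, freqSq_zero]
        rw [this, mul_zero, norm_zero, zero_pow two_ne_zero]
        positivity
      · have h1 := pow_blockIndex_le_freqSq hm
        have h3 := one_le_freqSq hm
        rw [h] at h1
        rw [norm_mul, norm_pow, Complex.norm_ofNat, mul_pow, hR2]
        have h2 : (freqSq m)⁻¹ ≤ 2 * (256 ^ j + freqSq m)⁻¹ := by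
          rw [inv_le_iff_one_le_mul₀ (by linarith), mul_right_comm, ← div_eq_mul_inv,
            le_div_iff₀ (by positivity)]
          linarith
        calc _ ≤ 256 ^ j * (C * (2 * (256 ^ j + freqSq m)⁻¹)) ^ 2 := by
              gcongr
              exact (hC ε hε m).trans (mul_le_mul_of_nonneg_left h2 hC0)
          _ = _ := by rw [mul_pow, mul_pow, inv_pow]; ring
    · rw [norm_zero, zero_pow two_ne_zero]; positivity
  calc _ ≤ ∑ m ∈ F, 4 * C ^ 2 * 256 ^ j * (((16 ^ j) ^ 2 + freqSq m) ^ 2)⁻¹ :=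
        Finset.sum_le_sum hterm
    _ = 4 * C ^ 2 * 256 ^ j * ∑ m ∈ F, (((16 ^ j) ^ 2 + freqSq m) ^ 2)⁻¹ := by rw [Finset.mul_sum]
    _ ≤ 4 * C ^ 2 * 256 ^ j * (64 / (16 ^ j) ^ 2) := by
        gcongr
        exact lattice_sum_finset hR F
    _ = _ := by rw [hR2]; field_simp; ring

/-- The measure `∑ 16 ^ (-j) δ_j` on the block indices. -/
noncomputable def blockMeasure : Measure ℕ :=
  Measure.sum fun j => (16⁻¹ : ℝ≥0∞) ^ j • Measure.dirac j

instance : IsFiniteMeasure blockMeasure := by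
  refine ⟨?_⟩
  rw [blockMeasure, Measure.sum_apply _ MeasurableSet.univ]
  simp only [Measure.smul_apply, measure_univ, smul_eq_mul, mul_one, ENNReal.tsum_geometric]
  rw [ENNReal.inv_lt_top, tsub_pos_iff_lt, ENNReal.inv_lt_one]
  norm_num

/-- A weighted fourth power of a Besov norm of the potential, which bounds its supremum. -/
noncomputable def supEnergy (ρ : Mollifier) (ε : ℝ) (ξ : TorusDistribution) : ℝ≥0∞ :=
  ∫⁻ p, ‖noiseSeries (blockGreen ρ ε p.1) ξ p.2‖ₑ ^ 4 ∂(blockMeasure.prod torusMeasure)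

theorem supEnergy_lt_top (ρ : Mollifier) {ε : ℝ} (hε : ε ∈ Set.Ioo (0 : ℝ) 1) (ξ : TorusDistribution) :
    supEnergy ρ ε ξ < ⊤ := by
  set B := ∑' m, (1 + freqSq m) * ‖green ρ ε m * pairing ξ m‖ with hB
  have hsum : Summable fun m => (1 + freqSq m) * ‖green ρ ε m * pairing ξ m‖ := by
    simpa using ((rapidDecay_green ρ hε).mul_pairing ξ) 1
  have hbd : ∀ p : ℕ × Plane, ‖noiseSeries (blockGreen ρ ε p.1) ξ p.2‖ₑ ^ 4 ≤ ENNReal.ofReal B ^ 4 := by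
    intro p
    refine pow_le_pow_left₀ zero_le ?_ 4
    rw [← ofReal_norm]
    refine ENNReal.ofReal_le_ofReal ((norm_noiseSeries_le (rapidDecay_blockGreen ρ hε p.1) ξ p.2).trans ?_)
    refine Summable.tsum_le_tsum (fun m => ?_)
      ((rapidDecay_blockGreen ρ hε p.1).mul_pairing ξ).summable_norm hsum
    rw [norm_mul, norm_mul, ← mul_assoc]
    exact mul_le_mul_of_nonneg_right (norm_blockGreen_le ρ ε p.1 m) (norm_nonneg _)
  calc _ ≤ ∫⁻ _, ENNReal.ofReal B ^ 4 ∂(blockMeasure.prod torusMeasure) := lintegral_mono hbd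
    _ < ⊤ := by rw [lintegral_const]; finiteness

theorem le_supEnergy (ρ : Mollifier) {ε : ℝ} (hε : ε ∈ Set.Ioo (0 : ℝ) 1) (ξ : TorusDistribution)
    (j : ℕ) :
    (16⁻¹ : ℝ≥0∞) ^ j * ∫⁻ x, ‖noiseSeries (blockGreen ρ ε j) ξ x‖ₑ ^ 4 ∂torusMeasure ≤
      supEnergy ρ ε ξ := by
  have hm : Measurable fun p : ℕ × Plane => ‖noiseSeries (blockGreen ρ ε p.1) ξ p.2‖ₑ ^ 4 :=
    measurable_from_prod_countable_right fun j =>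
      (continuous_noiseSeries (rapidDecay_blockGreen ρ hε j) ξ).measurable.enorm.pow_const 4
  rw [supEnergy, lintegral_prod _ hm.aemeasurable, blockMeasure, lintegral_sum_measure]
  simp only [lintegral_smul_measure, lintegral_dirac, smul_eq_mul]
  exact ENNReal.le_tsum j

theorem norm_noiseSeries_blockGreen_pow_four_le (ρ : Mollifier) {ε : ℝ}
    (hε : ε ∈ Set.Ioo (0 : ℝ) 1) (ξ : TorusDistribution) (j : ℕ) (x : Plane) :
    ‖noiseSeries (blockGreen ρ ε j) ξ x‖ ^ 4 ≤ 2 ^ 18 * 4096 ^ j * (supEnergy ρ ε ξ).toReal := by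
  set F := (finite_blockIndex j).toFinset.image fun m => -m with hF
  have hser : ∀ y, noiseSeries (blockGreen ρ ε j) ξ y =
      ∑ m ∈ F, blockGreen ρ ε j (-m) * pairing ξ (-m) * mode m y := by
    intro y
    rw [hF, Finset.sum_image fun a _ b _ h => neg_injective h, noiseSeries,
      tsum_eq_sum (s := (finite_blockIndex j).toFinset)]
    · refine Finset.sum_congr rfl fun m _ => ?_
      rw [neg_neg]; ring
    · intro m hm
      rw [Set.Finite.mem_toFinset, Set.mem_ofPred_eq] at hm
      rw [blockGreen, if_neg hm]; ring
  have hFN : ∀ m ∈ F, freqSq m ≤ 256 ^ (j + 1) := by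
    intro m hm
    obtain ⟨k, hk, rfl⟩ := Finset.mem_image.1 hm
    rw [Set.Finite.mem_toFinset, Set.mem_ofPred_eq] at hk
    rw [freqSq_neg, ← hk]
    exact (freqSq_lt_pow_blockIndex k).le
  have h1 := norm_trigPoly_pow_four_le F (fun m => blockGreen ρ ε j (-m) * pairing ξ (-m))
    (one_le_pow₀ (by norm_num : (1 : ℝ) ≤ 256)) hFN x
  simp only [← hser] at h1
  have h2 : ∫ y, ‖noiseSeries (blockGreen ρ ε j) ξ y‖ ^ 4 ∂torusMeasure =
      (∫⁻ y, ‖noiseSeries (blockGreen ρ ε j) ξ y‖ₑ ^ 4 ∂torusMeasure).toReal := by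
    have hc : Continuous fun y => ‖noiseSeries (blockGreen ρ ε j) ξ y‖ ^ 4 :=
      (continuous_noiseSeries (rapidDecay_blockGreen ρ hε j) ξ).norm.pow 4
    rw [integral_eq_lintegral_of_nonneg_ae (Eventually.of_forall fun y => by positivity)
      hc.aestronglyMeasurable]
    congr 1
    refine lintegral_congr fun y => ?_
    rw [ENNReal.ofReal_pow (norm_nonneg _), ofReal_norm]
  have h3 := ENNReal.toReal_mono (supEnergy_lt_top ρ hε ξ).ne (le_supEnergy ρ hε ξ j)
  rw [ENNReal.toReal_mul, ENNReal.toReal_pow, ENNReal.toReal_inv, ENNReal.toReal_ofNat, ← h2, inv_pow,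
    inv_mul_le_iff₀ (by positivity)] at h3
  refine h1.trans ?_
  calc _ ≤ 1024 * 256 ^ (j + 1) * (16 ^ j * (supEnergy ρ ε ξ).toReal) := by gcongr
    _ = _ := by
      have : (4096 : ℝ) ^ j = 256 ^ j * 16 ^ j := by rw [← mul_pow]; norm_num
      rw [this, pow_succ]; ring

/-- Bernstein's inequality costs `256^(j + 1)` and the weight in `supEnergy` costs `16^j`, so the
normalized block is at most `32 · 8^j` times the fourth root of the energy. Undoing the factor
`16^j` leaves `32 · 2^(-j)`, which sums to `64`. -/
theorem abs_potential_le (ρ : Mollifier) {ε : ℝ} (hε : ε ∈ Set.Ioo (0 : ℝ) 1) (ξ : TorusDistribution)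
    (x : Plane) : |potential ρ ε ξ x| ≤ 64 * (supEnergy ρ ε ξ).toReal ^ (4⁻¹ : ℝ) := by
  set u := (supEnergy ρ ε ξ).toReal ^ (4⁻¹ : ℝ) with hu
  have hu0 : 0 ≤ u := by positivity
  have hu4 : u ^ 4 = (supEnergy ρ ε ξ).toReal := by
    rw [hu, ← Real.rpow_natCast, ← Real.rpow_mul ENNReal.toReal_nonneg]; norm_num
  have hb : ∀ j, ‖noiseSeries (blockGreen ρ ε j) ξ x‖ ≤ 16 ^ j * (32 * 2⁻¹ ^ j * u) := by
    intro j
    refine (pow_le_pow_iff_left₀ (norm_nonneg _) (by positivity) (n := 4) (by norm_num)).1 ?_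
    refine (norm_noiseSeries_blockGreen_pow_four_le ρ hε ξ j x).trans ?_
    rw [mul_pow, mul_pow, mul_pow, hu4, ← mul_assoc, ← mul_assoc]
    refine mul_le_mul_of_nonneg_right ?_ ENNReal.toReal_nonneg
    have e : ((16 : ℝ) ^ j) ^ 4 * (32 : ℝ) ^ 4 * (2⁻¹ ^ j) ^ 4 = 2 ^ 20 * 4096 ^ j := by
      rw [← pow_mul, ← pow_mul, mul_comm j 4, pow_mul, pow_mul, mul_right_comm, ← mul_pow]
      norm_num
      ring
    rw [e]
    have : (0 : ℝ) ≤ 4096 ^ j := by positivity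
    nlinarith
  have hser : potential ρ ε ξ x = (noiseSeries (green ρ ε) ξ x).re := by
    rw [potential_eq ρ hε, noiseSeries]
    congr 1
    have := tsum_potCoeff_eq ρ ε ξ fun m => mode m x
    simp only [mul_comm (mode _ x)] at this
    exact this
  have hfib := (summable_mul_pairing ((rapidDecay_green ρ hε).mul_mode x) ξ).hasSum.tsum_fiberwise
    blockIndex
  have hterm : ∀ j, ∑' m : blockIndex ⁻¹' {j}, green ρ ε m * mode (-(m : Fin 2 → ℤ)) x * pairing ξ m =
      (16 ^ j)⁻¹ * noiseSeries (blockGreen ρ ε j) ξ x := by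
    intro j
    rw [tsum_subtype (blockIndex ⁻¹' {j}) fun m => green ρ ε m * mode (-m) x * pairing ξ m, noiseSeries,
      ← tsum_mul_left]
    refine tsum_congr fun m => ?_
    by_cases hm : blockIndex m = j
    · rw [Set.indicator_of_mem (by exact hm), blockGreen, if_pos hm]
      field_simp
    · rw [Set.indicator_of_notMem (by exact hm), blockGreen, if_neg hm]
      ring
  simp only [hterm] at hfib
  rw [hser]
  refine (Complex.abs_re_le_norm _).trans ?_
  rw [noiseSeries, ← hfib.tsum_eq]
  have hgeo := ((hasSum_geometric_of_lt_one (r := (2 : ℝ)⁻¹) (by norm_num) (by norm_num)).mul_left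
    32).mul_right u
  refine (tsum_of_norm_bounded hgeo fun j => ?_).trans_eq (by norm_num)
  rw [norm_mul, norm_inv, norm_pow, Complex.norm_ofNat, inv_mul_le_iff₀ (by positivity)]
  exact hb j

/-! ### Exponential moments of the bound on the supremum. -/

theorem factorial_two_mul_le (n : ℕ) : ((2 * n).factorial : ℝ) ≤ 4 ^ n * (n.factorial : ℝ) ^ 2 := by
  have h1 := Nat.choose_mul_factorial_mul_factorial (n := 2 * n) (k := n) (by omega)
  have h2 : (2 * n).choose n ≤ 2 ^ (2 * n) := Nat.choose_le_two_pow _ _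
  rw [show 2 * n - n = n by omega, mul_assoc, ← sq] at h1
  rw [pow_mul] at h2
  calc ((2 * n).factorial : ℝ) = ((2 * n).choose n : ℝ) * (n.factorial : ℝ) ^ 2 := by
        rw [← h1]; push_cast; ring
    _ ≤ _ := by
        gcongr
        exact_mod_cast h2

theorem hasSum_pow_div_factorial (s : ℝ) : HasSum (fun n : ℕ => s ^ n / n.factorial) (Real.exp s) := by
  rw [Real.exp_eq_exp_ℝ]
  exact NormedSpace.expSeries_div_hasSum_exp s

/-- Let `a` be the left side and `b = 2^(-n)`: either `a ≤ b`, or `a ≤ a⁴ / b³`. This replaces the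
powers of `s` in the exponential series by powers of `s⁴`, so that fractional moments of the energy
are avoided. -/
theorem pow_div_factorial_le (s : ℝ) (n : ℕ) :
    s ^ n / n.factorial ≤ (1 / 2) ^ n + 8 ^ n * (s ^ 4) ^ n / (n.factorial : ℝ) ^ 4 := by
  set a := s ^ n / n.factorial with ha
  set b : ℝ := (1 / 2) ^ n with hb
  have hb0 : 0 < b := by positivity
  have e : 8 ^ n * (s ^ 4) ^ n / (n.factorial : ℝ) ^ 4 = a ^ 4 / b ^ 3 := by
    have : b ^ 3 * 8 ^ n = 1 := by
      rw [hb, ← pow_mul, mul_comm n 3, pow_mul, ← mul_pow]; norm_num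
    have h4 : (s ^ 4) ^ n = (s ^ n) ^ 4 := pow_right_comm s 4 n
    rw [eq_div_iff (by positivity), h4, mul_div_assoc, ← div_pow, ← ha, mul_right_comm, mul_comm (8 ^ n),
      this, one_mul]
  rw [e]
  rcases le_total a b with h | h
  · have : 0 ≤ a ^ 4 / b ^ 3 := div_nonneg (by positivity) (by positivity)
    linarith
  · have : a ≤ a ^ 4 / b ^ 3 := by
      rw [le_div_iff₀ (by positivity)]
      have h2 : b ^ 3 ≤ a ^ 3 := pow_le_pow_left₀ hb0.le h 3
      have h3 : a * b ^ 3 ≤ a * a ^ 3 := mul_le_mul_of_nonneg_left h2 (hb0.le.trans h)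
      linarith [show a ^ 4 = a * a ^ 3 by ring]
    linarith

section Moments

variable {Ω : Type*} [MeasurableSpace Ω] {μ : Measure Ω} {ξ : Ω → TorusDistribution}

/-- Exponential moments of a fourth root from moments that grow like those of the fourth power of a
Gaussian. -/
theorem lintegral_exp_rpow_le [IsProbabilityMeasure μ] {X : Ω → ℝ≥0∞} (hX : Measurable X) {A : ℝ}
    (hA : 0 ≤ A)
    (h : ∀ n : ℕ, ∫⁻ ω, X ω ^ n ∂μ ≤ ENNReal.ofReal (4 * A ^ n * (2 * n).factorial)) {l : ℝ}
    (hl : 0 ≤ l) :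
    ∫⁻ ω, ENNReal.ofReal (Real.exp (l * (X ω).toReal ^ (4⁻¹ : ℝ))) ∂μ ≤
      ENNReal.ofReal (2 + 4 * Real.exp (32 * l ^ 4 * A)) := by
  set c : ℕ → ℝ := fun n => (8 * l ^ 4) ^ n / (n.factorial : ℝ) ^ 4 with hc
  have hc0 : ∀ n, 0 ≤ c n := fun n => by positivity
  have hpt : ∀ ω, ENNReal.ofReal (Real.exp (l * (X ω).toReal ^ (4⁻¹ : ℝ))) ≤
      ENNReal.ofReal 2 + ∑' n, ENNReal.ofReal (c n) * X ω ^ n := by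
    intro ω
    set s := l * (X ω).toReal ^ (4⁻¹ : ℝ) with hs
    have hs4 : s ^ 4 = l ^ 4 * (X ω).toReal := by
      rw [hs, mul_pow, ← Real.rpow_natCast (_ ^ (4⁻¹ : ℝ)), ← Real.rpow_mul ENNReal.toReal_nonneg]
      norm_num
    have hterm : ∀ n : ℕ, ENNReal.ofReal (s ^ n / n.factorial) ≤
        ENNReal.ofReal ((1 / 2) ^ n) + ENNReal.ofReal (c n) * X ω ^ n := by
      intro n
      refine (ENNReal.ofReal_le_ofReal (pow_div_factorial_le s n)).trans ?_
      rw [ENNReal.ofReal_add (by positivity) (by positivity)]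
      gcongr
      have : 8 ^ n * (s ^ 4) ^ n / (n.factorial : ℝ) ^ 4 = c n * (X ω).toReal ^ n := by
        rw [hc, hs4]; simp only [mul_pow]; ring
      rw [this, ENNReal.ofReal_mul (hc0 n), ENNReal.ofReal_pow ENNReal.toReal_nonneg]
      gcongr
      exact ENNReal.ofReal_toReal_le
    calc ENNReal.ofReal (Real.exp s) ≤ ∑' n : ℕ, ENNReal.ofReal (s ^ n / n.factorial) := by
          have hs0 : 0 ≤ s := by positivity
          have h1 := hasSum_pow_div_factorial s
          rw [← ENNReal.ofReal_tsum_of_nonneg (fun n => by positivity) h1.summable, h1.tsum_eq]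
      _ ≤ ∑' n, (ENNReal.ofReal ((1 / 2) ^ n) + ENNReal.ofReal (c n) * X ω ^ n) :=
          ENNReal.tsum_le_tsum hterm
      _ = _ := by
          rw [ENNReal.tsum_add, ← ENNReal.ofReal_tsum_of_nonneg (fun n => by positivity)
            summable_geometric_two, tsum_geometric_two]
  have hZ := hasSum_pow_div_factorial (32 * l ^ 4 * A)
  calc _ ≤ ∫⁻ ω, (ENNReal.ofReal 2 + ∑' n, ENNReal.ofReal (c n) * X ω ^ n) ∂μ := lintegral_mono hpt
    _ = ENNReal.ofReal 2 + ∑' n, ENNReal.ofReal (c n) * ∫⁻ ω, X ω ^ n ∂μ := by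
        rw [lintegral_add_left measurable_const, lintegral_const, measure_univ, mul_one,
          lintegral_tsum fun n => ((hX.pow_const n).const_mul _).aemeasurable]
        congr 1
        exact tsum_congr fun n => lintegral_const_mul _ (hX.pow_const n)
    _ ≤ ENNReal.ofReal 2 + ∑' n : ℕ, ENNReal.ofReal (4 * ((32 * l ^ 4 * A) ^ n / n.factorial)) := by
        gcongr with n
        refine (mul_le_mul_right (h n) _).trans ?_
        rw [← ENNReal.ofReal_mul (hc0 n)]
        refine ENNReal.ofReal_le_ofReal ?_
        -- The moments grow like `(2n)! ≤ 4ⁿ (n!)²`, against `(n!)⁴` in the denominator, so the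
        -- series converges for every `l`; the constant is `32 = 8 · 4`.
        have h1 := factorial_two_mul_le n
        have h2 : (1 : ℝ) ≤ n.factorial := by exact_mod_cast n.factorial_pos
        have e : (32 * l ^ 4 * A) ^ n = (8 * l ^ 4) ^ n * A ^ n * 4 ^ n := by
          rw [← mul_pow, ← mul_pow]; ring_nf
        calc c n * (4 * A ^ n * (2 * n).factorial)
            ≤ c n * (4 * A ^ n * (4 ^ n * (n.factorial : ℝ) ^ 2)) := by
              have := hc0 n
              gcongr
          _ = 4 * ((32 * l ^ 4 * A) ^ n / (n.factorial : ℝ) ^ 2) := by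
              rw [e, hc]; field_simp
          _ ≤ _ := by
              gcongr
              exact le_self_pow₀ h2 two_ne_zero
    _ = _ := by
        rw [← ENNReal.ofReal_tsum_of_nonneg (fun n => by positivity) (hZ.mul_left 4).summable,
          (hZ.mul_left 4).tsum_eq, ← ENNReal.ofReal_add (by positivity) (by positivity)]

theorem measurable_supEnergy_integrand (hξ : IsWhiteNoise μ ξ) (ρ : Mollifier) {ε : ℝ}
    (hε : ε ∈ Set.Ioo (0 : ℝ) 1) :
    Measurable fun p : Ω × (ℕ × Plane) => ‖noiseSeries (blockGreen ρ ε p.2.1) (ξ p.1) p.2.2‖ₑ ^ 4 := by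
  have h : Measurable fun q : ℕ × (Ω × Plane) =>
      ‖noiseSeries (blockGreen ρ ε q.1) (ξ q.2.1) q.2.2‖ₑ ^ 4 :=
    measurable_from_prod_countable_right fun j =>
      (measurable_noiseSeries hξ (rapidDecay_blockGreen ρ hε j)).enorm.pow_const 4
  have e : Measurable fun p : Ω × (ℕ × Plane) => (p.2.1, (p.1, p.2.2)) := by fun_prop
  have := h.comp e
  simpa only [Function.comp_def] using this

theorem exists_lintegral_supEnergy_pow_le [IsProbabilityMeasure μ] (hξ : IsWhiteNoise μ ξ)
    (ρ : Mollifier) :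
    ∃ A : ℝ, 0 ≤ A ∧ ∀ ε ∈ Set.Ioo (0 : ℝ) 1, ∀ n : ℕ, ∫⁻ ω, supEnergy ρ ε (ξ ω) ^ n ∂μ ≤
      ENNReal.ofReal (4 * A ^ n * (2 * n).factorial) := by
  obtain ⟨V, hV0, hV⟩ := exists_blockGreen_variance_le ρ
  set a := ((blockMeasure.prod torusMeasure) Set.univ).toReal with ha
  have ha0 : 0 ≤ a := ENNReal.toReal_nonneg
  refine ⟨a * (8 * V) ^ 2, by positivity, fun ε hε n => ?_⟩
  rcases eq_or_ne n 0 with rfl | hn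
  · simp
  have h := lintegral_lintegral_pow_le (ν := blockMeasure.prod torusMeasure)
    (g := fun ω p => ‖noiseSeries (blockGreen ρ ε p.1) (ξ ω) p.2‖ₑ ^ 4)
    (measurable_supEnergy_integrand hξ ρ hε) hn (B := ENNReal.ofReal (4 * (8 * V) ^ (2 * n) * (2 * n).factorial))
    (μ := μ) fun p => by
      have := lintegral_noiseSeries_pow_le hξ (rapidDecay_blockGreen ρ hε p.1) (hV ε hε.1 p.1) p.2
        (2 * n)
      simpa only [← pow_mul, show 4 * n = 2 * (2 * n) by ring] using this
  refine h.trans_eq ?_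
  rw [← ENNReal.ofReal_toReal (measure_ne_top (blockMeasure.prod torusMeasure) Set.univ), ← ha,
    ← ENNReal.ofReal_pow ha0, ← ENNReal.ofReal_mul (by positivity)]
  congr 1
  rw [mul_pow a, ← pow_mul (8 * V)]
  ring

end Moments

/-! ### The gradient of the potential -/

/-- The Fourier coefficients of the partial derivatives of the mollified Green function. -/
noncomputable def gradGreen (ρ : Mollifier) (ε : ℝ) (j : Fin 2) (m : Fin 2 → ℤ) : ℂ :=
  -(Complex.I * (m j : ℂ)) * green ρ ε m

theorem norm_gradGreen_sq_le (ρ : Mollifier) (ε : ℝ) (j : Fin 2) (m : Fin 2 → ℤ) :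
    ‖gradGreen ρ ε j m‖ ^ 2 ≤ (freqSq m)⁻¹ * ‖mollCoeff ρ ε (-m)‖ ^ 2 := by
  have h0 := freqSq_nonneg m
  rw [gradGreen, green, norm_mul, norm_neg, norm_neg, norm_mul, norm_mul, Complex.norm_I, one_mul,
    norm_inv, Complex.norm_real, Real.norm_of_nonneg h0, Complex.norm_intCast, mul_pow, mul_pow, sq_abs]
  rcases h0.eq_or_lt with h | h
  · rw [← h]; simp
  · calc _ ≤ freqSq m * ((freqSq m)⁻¹ ^ 2 * ‖mollCoeff ρ ε (-m)‖ ^ 2) := by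
          gcongr
          exact sq_le_freqSq m j
      _ = _ := by field_simp

theorem rapidDecay_gradGreen (ρ : Mollifier) {ε : ℝ} (hε : ε ∈ Set.Ioo (0 : ℝ) 1) (j : Fin 2) :
    RapidDecay (gradGreen ρ ε j) :=
  (rapidDecay_green ρ hε).of_bound (C := 1) (N := 1) fun m => by
    rw [gradGreen, norm_mul, norm_neg, norm_mul, Complex.norm_I, Complex.norm_intCast, one_mul, one_mul,
      pow_one]
    refine mul_le_mul_of_nonneg_right ?_ (norm_nonneg _)
    have := sq_le_freqSq m j
    rw [← sq_abs] at this
    nlinarith [sq_nonneg (|(m j : ℝ)| - 1)]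

/-- The variance is controlled by the sum of `|m|⁻²` with a cut-off at `|m| ≈ 1/ε`, which diverges
logarithmically. All powers of `|ln ε|` in the result originate here. -/
theorem exists_gradGreen_variance_le (ρ : Mollifier) :
    ∃ V : ℝ, 0 ≤ V ∧ ∀ ε ∈ Set.Ioo 0 (Real.exp (-1)), ∀ (j : Fin 2) (F : Finset (Fin 2 → ℤ)),
      (2 * Real.pi) ^ 2 * ∑ m ∈ F, ‖gradGreen ρ ε j m‖ ^ 2 ≤ V * |Real.log ε| := by
  obtain ⟨C, hC0, hC⟩ := exists_mollCoeff_le ρ 1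
  refine ⟨(2 * Real.pi) ^ 2 * (C ^ 2 * 640), by positivity, fun ε hε j F => ?_⟩
  rw [mul_assoc]
  refine mul_le_mul_of_nonneg_left ?_ (by positivity)
  have hlog : Real.log ε < -1 := (Real.log_lt_iff_lt_exp hε.1).2 hε.2
  have hε1 : 1 ≤ ε⁻¹ := by
    rw [one_le_inv₀ hε.1]
    exact hε.2.le.trans (Real.exp_le_one_iff.2 (by norm_num))
  rw [abs_of_neg (by linarith)]
  -- As `N = n + 1 ≥ 1/ε`, the decay factor `(1 + ε²q)⁻¹` of the mollifier is at most `N² / (q +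
  -- N²)`, the cut-off in `log_lattice_sum_finset`.
  set n := ⌊ε⁻¹⌋₊ with hn
  have hterm : ∀ m ∈ F.erase 0, ‖gradGreen ρ ε j m‖ ^ 2 ≤
      C ^ 2 * ((freqSq m)⁻¹ - (freqSq m + ((n : ℝ) + 1) ^ 2)⁻¹) := by
    intro m hm
    have hq : 0 < freqSq m := one_pos.trans_le (one_le_freqSq (Finset.ne_of_mem_erase hm))
    refine (norm_gradGreen_sq_le ρ ε j m).trans ?_
    set q := freqSq m
    set N : ℝ := (n : ℝ) + 1
    have hN : 1 ≤ N * ε := by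
      rw [← div_le_iff₀ hε.1, one_div]
      exact (Nat.lt_floor_add_one _).le
    have hN0 : 0 < N := by positivity
    have hε0 := hε.1
    have h1 := hC ε hε.1 (-m)
    rw [pow_one, freqSq_neg] at h1
    have h2 : ‖mollCoeff ρ ε (-m)‖ ^ 2 * (1 + ε ^ 2 * q) ≤ C ^ 2 := by
      calc _ ≤ ‖mollCoeff ρ ε (-m)‖ ^ 2 * (1 + ε ^ 2 * q) ^ 2 := by
            gcongr
            exact le_self_pow₀ (le_add_of_nonneg_right (by positivity)) two_ne_zero
        _ = ((1 + ε ^ 2 * q) * ‖mollCoeff ρ ε (-m)‖) ^ 2 := by ring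
        _ ≤ _ := by gcongr
    have h3 : (1 + ε ^ 2 * q)⁻¹ ≤ N ^ 2 * (q + N ^ 2)⁻¹ := by
      rw [← div_eq_mul_inv, le_div_iff₀ (by positivity), inv_mul_le_iff₀ (by positivity)]
      have : 1 ≤ (N * ε) ^ 2 := one_le_pow₀ hN
      nlinarith
    have h4 : q⁻¹ - (q + N ^ 2)⁻¹ = q⁻¹ * (N ^ 2 * (q + N ^ 2)⁻¹) := by
      field_simp
      ring
    rw [h4]
    calc _ ≤ q⁻¹ * (C ^ 2 * (1 + ε ^ 2 * q)⁻¹) := by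
          gcongr
          rwa [← div_eq_mul_inv, le_div_iff₀ (by positivity)]
      _ ≤ q⁻¹ * (C ^ 2 * (N ^ 2 * (q + N ^ 2)⁻¹)) := by gcongr
      _ = _ := by ring
  have h0 : ‖gradGreen ρ ε j 0‖ ^ 2 = 0 := by simp [gradGreen]
  have hharm : (harmonic n : ℝ) ≤ 1 + -Real.log ε := by
    have := harmonic_floor_le_one_add_log ε⁻¹ hε1
    rwa [Real.log_inv] at this
  rw [← Finset.sum_erase F h0]
  calc _ ≤ ∑ m ∈ F.erase 0, C ^ 2 * ((freqSq m)⁻¹ - (freqSq m + ((n : ℝ) + 1) ^ 2)⁻¹) :=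
        Finset.sum_le_sum hterm
    _ = C ^ 2 * ∑ m ∈ F.erase 0, ((freqSq m)⁻¹ - (freqSq m + ((n : ℝ) + 1) ^ 2)⁻¹) := by
        rw [Finset.mul_sum]
    _ ≤ C ^ 2 * (256 + 192 * (harmonic n : ℝ)) := by
        gcongr
        exact log_lattice_sum_finset n _ fun k hk => Finset.ne_of_mem_erase hk
    -- `256 + 192 (1 + |ln ε|) ≤ 640 |ln ε|`, because `|ln ε| ≥ 1` for `ε < e⁻¹`.
    _ ≤ C ^ 2 * (640 * -Real.log ε) := by
        gcongr
        linarith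
    _ = _ := by ring

theorem add_pow_le_two_pow_mul (a b : ℝ≥0∞) (n : ℕ) : (a + b) ^ n ≤ 2 ^ n * (a ^ n + b ^ n) := by
  wlog h : a ≤ b generalizing a b
  · rw [add_comm, add_comm (a ^ n)]
    exact this b a (le_of_not_ge h)
  calc (a + b) ^ n ≤ (2 * b) ^ n := by rw [two_mul]; gcongr
    _ = 2 ^ n * b ^ n := mul_pow _ _ _
    _ ≤ _ := by gcongr; exact le_add_self

theorem gradient_potential_eq (ρ : Mollifier) {ε : ℝ} (hε : ε ∈ Set.Ioo (0 : ℝ) 1)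
    (ξ : TorusDistribution) (x : Plane) (j : Fin 2) :
    gradient (potential ρ ε ξ) x j = (noiseSeries (gradGreen ρ ε j) ξ x).re := by
  rw [gradient_potential ρ hε, noiseSeries,
    tsum_potCoeff_eq ρ ε ξ fun m => Complex.I * (m j : ℂ) * mode m x]
  congr 1
  refine tsum_congr fun m => ?_
  rw [gradGreen, Pi.neg_apply, Int.cast_neg]
  ring

theorem norm_gradient_potential_sq_le (ρ : Mollifier) {ε : ℝ} (hε : ε ∈ Set.Ioo (0 : ℝ) 1)
    (ξ : TorusDistribution) (x : Plane) :
    ‖gradient (potential ρ ε ξ) x‖ ^ 2 ≤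
      ‖noiseSeries (gradGreen ρ ε 0) ξ x‖ ^ 2 + ‖noiseSeries (gradGreen ρ ε 1) ξ x‖ ^ 2 := by
  rw [EuclideanSpace.norm_sq_eq, Fin.sum_univ_two, gradient_potential_eq ρ hε,
    gradient_potential_eq ρ hε]
  gcongr <;> exact Complex.abs_re_le_norm _

/-- The fourth power of the `L⁴` norm of the complexified gradient of the potential. -/
noncomputable def gradEnergy (ρ : Mollifier) (ε : ℝ) (ξ : TorusDistribution) : ℝ≥0∞ :=
  ∫⁻ x, (‖noiseSeries (gradGreen ρ ε 0) ξ x‖ₑ ^ 4 + ‖noiseSeries (gradGreen ρ ε 1) ξ x‖ₑ ^ 4)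
    ∂torusMeasure

theorem gradEnergy_lt_top (ρ : Mollifier) {ε : ℝ} (hε : ε ∈ Set.Ioo (0 : ℝ) 1) (ξ : TorusDistribution) :
    gradEnergy ρ ε ξ < ⊤ := by
  set B : Fin 2 → ℝ := fun j => ∑' m, ‖gradGreen ρ ε j m * pairing ξ m‖ with hB
  have hbd : ∀ j x, ‖noiseSeries (gradGreen ρ ε j) ξ x‖ₑ ^ 4 ≤ ENNReal.ofReal (B j) ^ 4 := by
    intro j x
    refine pow_le_pow_left₀ zero_le ?_ 4
    rw [← ofReal_norm]
    exact ENNReal.ofReal_le_ofReal (norm_noiseSeries_le (rapidDecay_gradGreen ρ hε j) ξ x)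
  calc _ ≤ ∫⁻ _, (ENNReal.ofReal (B 0) ^ 4 + ENNReal.ofReal (B 1) ^ 4) ∂torusMeasure :=
        lintegral_mono fun x => add_le_add (hbd 0 x) (hbd 1 x)
    _ < ⊤ := by rw [lintegral_const]; finiteness

theorem integral_norm_gradient_pow_four_le (ρ : Mollifier) {ε : ℝ} (hε : ε ∈ Set.Ioo (0 : ℝ) 1)
    (ξ : TorusDistribution) :
    ∫ x, ‖gradient (potential ρ ε ξ) x‖ ^ 4 ∂torusMeasure ≤ 2 * (gradEnergy ρ ε ξ).toReal := by
  have hc : Continuous fun x => ‖gradient (potential ρ ε ξ) x‖ ^ 4 :=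
    (isC1Potential_potential ρ hε ξ).continuous_gradient.norm.pow 4
  have htop := (gradEnergy_lt_top ρ hε ξ).ne
  rw [integral_eq_lintegral_of_nonneg_ae (Eventually.of_forall fun y => by positivity)
    hc.aestronglyMeasurable, ← ENNReal.toReal_ofNat 2, ← ENNReal.toReal_mul]
  refine ENNReal.toReal_mono (by finiteness) ?_
  rw [gradEnergy, ← lintegral_const_mul' _ _ (by finiteness)]
  refine lintegral_mono fun x => ?_
  simp only [← ofReal_norm, ← ENNReal.ofReal_pow (norm_nonneg _)]
  rw [← ENNReal.ofReal_add (by positivity) (by positivity)]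
  have h := norm_gradient_potential_sq_le ρ hε ξ x
  set a := ‖noiseSeries (gradGreen ρ ε 0) ξ x‖
  set b := ‖noiseSeries (gradGreen ρ ε 1) ξ x‖
  have h4 : ‖gradient (potential ρ ε ξ) x‖ ^ 4 ≤ 2 * (a ^ 4 + b ^ 4) := by
    calc ‖gradient (potential ρ ε ξ) x‖ ^ 4 = (‖gradient (potential ρ ε ξ) x‖ ^ 2) ^ 2 := by ring
      _ ≤ (a ^ 2 + b ^ 2) ^ 2 := by gcongr
      _ ≤ _ := by nlinarith [sq_nonneg (a ^ 2 - b ^ 2)]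
  refine (ENNReal.ofReal_le_ofReal h4).trans_eq ?_
  rw [ENNReal.ofReal_mul two_pos.le, ENNReal.ofReal_ofNat]

/-! ### The random constant and its moments. -/

/-- The random constant of the a priori estimate. -/
noncomputable def noiseBound (ρ : Mollifier) (ε : ℝ) (ξ : TorusDistribution) : ℝ :=
  -- `128 = 2 · 64` gives `exp(2S)` with `S` from `abs_potential_le`; the gradient energy is divided
  -- by `|ln ε|²`, the order of its mean bound.
  Real.exp (128 * (supEnergy ρ ε ξ).toReal ^ (4⁻¹ : ℝ)) *
    (1 + (gradEnergy ρ ε ξ).toReal / |Real.log ε| ^ 2)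

theorem noiseBound_nonneg (ρ : Mollifier) (ε : ℝ) (ξ : TorusDistribution) : 0 ≤ noiseBound ρ ε ξ := by
  have : 0 ≤ (gradEnergy ρ ε ξ).toReal := ENNReal.toReal_nonneg
  rw [noiseBound]
  positivity

theorem mem_Ioo_one {ε : ℝ} (hε : ε ∈ Set.Ioo 0 (Real.exp (-1))) : ε ∈ Set.Ioo (0 : ℝ) 1 :=
  ⟨hε.1, hε.2.trans_le (Real.exp_le_one_iff.2 (by norm_num))⟩

theorem one_le_abs_log {ε : ℝ} (hε : ε ∈ Set.Ioo 0 (Real.exp (-1))) : 1 ≤ |Real.log ε| := by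
  have hlog : Real.log ε < -1 := (Real.log_lt_iff_lt_exp hε.1).2 hε.2
  rw [abs_of_neg (by linarith)]
  linarith

section Moments

variable {Ω : Type*} [MeasurableSpace Ω] {μ : Measure Ω} {ξ : Ω → TorusDistribution}

theorem measurable_supEnergy (hξ : IsWhiteNoise μ ξ) (ρ : Mollifier) {ε : ℝ}
    (hε : ε ∈ Set.Ioo (0 : ℝ) 1) : Measurable fun ω => supEnergy ρ ε (ξ ω) :=
  (measurable_supEnergy_integrand hξ ρ hε).lintegral_prod_right'

theorem measurable_gradEnergy_integrand (hξ : IsWhiteNoise μ ξ) (ρ : Mollifier) {ε : ℝ}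
    (hε : ε ∈ Set.Ioo (0 : ℝ) 1) :
    Measurable fun p : Ω × Plane => ‖noiseSeries (gradGreen ρ ε 0) (ξ p.1) p.2‖ₑ ^ 4 +
      ‖noiseSeries (gradGreen ρ ε 1) (ξ p.1) p.2‖ₑ ^ 4 :=
  ((measurable_noiseSeries hξ (rapidDecay_gradGreen ρ hε 0)).enorm.pow_const 4).add
    ((measurable_noiseSeries hξ (rapidDecay_gradGreen ρ hε 1)).enorm.pow_const 4)

theorem measurable_gradEnergy (hξ : IsWhiteNoise μ ξ) (ρ : Mollifier) {ε : ℝ}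
    (hε : ε ∈ Set.Ioo (0 : ℝ) 1) : Measurable fun ω => gradEnergy ρ ε (ξ ω) :=
  (measurable_gradEnergy_integrand hξ ρ hε).lintegral_prod_right'

theorem measurable_noiseBound (hξ : IsWhiteNoise μ ξ) (ρ : Mollifier) {ε : ℝ}
    (hε : ε ∈ Set.Ioo (0 : ℝ) 1) : Measurable fun ω => noiseBound ρ ε (ξ ω) :=
  (((measurable_supEnergy hξ ρ hε).ennreal_toReal.pow_const _).const_mul _).exp.mul
    (((measurable_gradEnergy hξ ρ hε).ennreal_toReal.div_const _).const_add _)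

theorem exists_lintegral_gradEnergy_pow_le [IsProbabilityMeasure μ] (hξ : IsWhiteNoise μ ξ)
    (ρ : Mollifier) :
    ∃ A : ℝ, 0 ≤ A ∧ ∀ ε ∈ Set.Ioo 0 (Real.exp (-1)), ∀ n : ℕ, ∫⁻ ω, gradEnergy ρ ε (ξ ω) ^ n ∂μ ≤
      ENNReal.ofReal (8 * (A * |Real.log ε| ^ 2) ^ n * (2 * n).factorial) := by
  obtain ⟨V, hV0, hV⟩ := exists_gradGreen_variance_le ρ
  set a := (torusMeasure Set.univ).toReal with ha
  have ha0 : 0 ≤ a := ENNReal.toReal_nonneg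
  refine ⟨a * 2 * (8 * V) ^ 2, by positivity, fun ε hε n => ?_⟩
  have hε1 := mem_Ioo_one hε
  rcases eq_or_ne n 0 with rfl | hn
  · simp
  set b := 4 * (8 * (V * |Real.log ε|)) ^ (2 * n) * ((2 * n).factorial : ℝ) with hb
  have hb0 : 0 ≤ b := by positivity
  have hj : ∀ j x, ∫⁻ ω, (‖noiseSeries (gradGreen ρ ε j) (ξ ω) x‖ₑ ^ 4) ^ n ∂μ ≤ ENNReal.ofReal b := by
    intro j x
    have := lintegral_noiseSeries_pow_le hξ (rapidDecay_gradGreen ρ hε1 j) (hV ε hε j) x (2 * n)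
    simpa only [← pow_mul, show 4 * n = 2 * (2 * n) by ring] using this
  have h := lintegral_lintegral_pow_le (ν := torusMeasure) (μ := μ)
    (g := fun ω x => ‖noiseSeries (gradGreen ρ ε 0) (ξ ω) x‖ₑ ^ 4 +
      ‖noiseSeries (gradGreen ρ ε 1) (ξ ω) x‖ₑ ^ 4)
    (measurable_gradEnergy_integrand hξ ρ hε1) hn (B := ENNReal.ofReal (2 ^ n * (b + b))) fun x => by
      have hm : Measurable fun ω => (‖noiseSeries (gradGreen ρ ε 0) (ξ ω) x‖ₑ ^ 4) ^ n :=
        (((measurable_noiseSeries hξ (rapidDecay_gradGreen ρ hε1 0)).comp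
          measurable_prodMk_right).enorm.pow_const 4).pow_const n
      calc _ ≤ ∫⁻ ω, 2 ^ n * ((‖noiseSeries (gradGreen ρ ε 0) (ξ ω) x‖ₑ ^ 4) ^ n +
            (‖noiseSeries (gradGreen ρ ε 1) (ξ ω) x‖ₑ ^ 4) ^ n) ∂μ :=
            lintegral_mono fun ω => add_pow_le_two_pow_mul _ _ n
        _ ≤ 2 ^ n * (ENNReal.ofReal b + ENNReal.ofReal b) := by
            rw [lintegral_const_mul' _ _ (by finiteness), lintegral_add_left hm]
            gcongr <;> exact hj _ x
        _ = _ := by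
            rw [← ENNReal.ofReal_add hb0 hb0, ENNReal.ofReal_mul (by positivity),
              ENNReal.ofReal_pow (by norm_num), ENNReal.ofReal_ofNat]
  refine h.trans_eq ?_
  rw [← ENNReal.ofReal_toReal (measure_ne_top torusMeasure Set.univ), ← ha,
    ← ENNReal.ofReal_pow ha0, ← ENNReal.ofReal_mul (by positivity)]
  congr 1
  rw [hb, mul_assoc _ _ (|Real.log ε| ^ 2), ← mul_pow (8 * V), mul_pow (a * 2), mul_pow a,
    pow_mul, mul_assoc 8 V]
  ring

/-- The second moment of the gradient at one point. Only the size of `C_ε` is used, not its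
cancellation against `|∇Y_ε|²`: the drift alone already requires `R²` of order `|ln ε|²`. -/
theorem exists_abs_renormConst_le (hξ : IsWhiteNoise μ ξ) (ρ : Mollifier) :
    ∃ A : ℝ, 0 ≤ A ∧ ∀ ε ∈ Set.Ioo 0 (Real.exp (-1)), |renormConst μ ρ ξ ε| ≤ A * |Real.log ε| := by
  obtain ⟨V, hV0, hV⟩ := exists_gradGreen_variance_le ρ
  refine ⟨64 * V, by positivity, fun ε hε => ?_⟩
  have hε1 := mem_Ioo_one hε
  have hj : ∀ j, ∫⁻ ω, ‖noiseSeries (gradGreen ρ ε j) (ξ ω) 0‖ₑ ^ 2 ∂μ ≤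
      ENNReal.ofReal (32 * (V * |Real.log ε|)) := by
    intro j
    have := lintegral_noiseSeries_pow_le hξ (rapidDecay_gradGreen ρ hε1 j) (hV ε hε j) 0 1
    refine this.trans_eq ?_
    congr 1
    rw [pow_one, Nat.factorial_one]
    push_cast
    ring
  have hm : Measurable fun ω => ‖noiseSeries (gradGreen ρ ε 0) (ξ ω) 0‖ₑ ^ 2 :=
    ((measurable_noiseSeries hξ (rapidDecay_gradGreen ρ hε1 0)).comp
      measurable_prodMk_right).enorm.pow_const 2
  rw [renormConst, ← Real.norm_eq_abs]
  refine (norm_integral_le_lintegral_norm _).trans (ENNReal.toReal_le_of_le_ofReal (by positivity) ?_)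
  calc _ ≤ ∫⁻ ω, (‖noiseSeries (gradGreen ρ ε 0) (ξ ω) 0‖ₑ ^ 2 +
        ‖noiseSeries (gradGreen ρ ε 1) (ξ ω) 0‖ₑ ^ 2) ∂μ := by
        refine lintegral_mono fun ω => ?_
        simp only [← ofReal_norm, ← ENNReal.ofReal_pow (norm_nonneg _)]
        rw [← ENNReal.ofReal_add (by positivity) (by positivity), Real.norm_of_nonneg (by positivity)]
        exact ENNReal.ofReal_le_ofReal (norm_gradient_potential_sq_le ρ hε1 (ξ ω) 0)
    _ ≤ ENNReal.ofReal (32 * (V * |Real.log ε|)) + ENNReal.ofReal (32 * (V * |Real.log ε|)) := by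
        rw [lintegral_add_left hm]
        exact add_le_add (hj 0) (hj 1)
    _ = _ := by
        rw [← ENNReal.ofReal_add (by positivity) (by positivity)]
        congr 1
        ring

theorem exists_lintegral_noiseBound_pow_le [IsProbabilityMeasure μ] (hξ : IsWhiteNoise μ ξ)
    (ρ : Mollifier) (q : ℕ) :
    ∃ M : ℝ, ∀ ε ∈ Set.Ioo 0 (Real.exp (-1)),
      ∫⁻ ω, ‖noiseBound ρ ε (ξ ω)‖ₑ ^ q ∂μ ≤ ENNReal.ofReal M := by
  obtain ⟨A, hA0, hA⟩ := exists_lintegral_supEnergy_pow_le hξ ρ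
  obtain ⟨D, hD0, hD⟩ := exists_lintegral_gradEnergy_pow_le hξ ρ
  refine ⟨(2 + 4 * Real.exp (32 * (256 * q) ^ 4 * A)) +
    4 ^ q * (1 + 8 * D ^ (2 * q) * (2 * (2 * q)).factorial), fun ε hε => ?_⟩
  have hε1 := mem_Ioo_one hε
  have hL := one_le_abs_log hε
  set L := |Real.log ε|
  have hX := measurable_supEnergy hξ ρ hε1
  have hG := measurable_gradEnergy hξ ρ hε1
  have hpt : ∀ ω, ‖noiseBound ρ ε (ξ ω)‖ₑ ^ q ≤
      ENNReal.ofReal (Real.exp (256 * q * (supEnergy ρ ε (ξ ω)).toReal ^ (4⁻¹ : ℝ))) +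
        ENNReal.ofReal (4 ^ q) *
          (1 + ENNReal.ofReal ((L ^ 2)⁻¹ ^ (2 * q)) * gradEnergy ρ ε (ξ ω) ^ (2 * q)) := by
    intro ω
    set s := (supEnergy ρ ε (ξ ω)).toReal ^ (4⁻¹ : ℝ) with hs
    set h := (gradEnergy ρ ε (ξ ω)).toReal with hh
    have h0 : 0 ≤ h := ENNReal.toReal_nonneg
    -- The inequality `xy ≤ x² + y²` separates the exponential factor from the gradient factor and
    -- doubles the exponent `128` to `256`.
    have e1 : noiseBound ρ ε (ξ ω) ^ q ≤ Real.exp (256 * q * s) +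
        4 ^ q * (1 + (L ^ 2)⁻¹ ^ (2 * q) * h ^ (2 * q)) := by
      have e2 : Real.exp (256 * q * s) = (Real.exp (128 * s) ^ q) ^ 2 := by
        rw [← pow_mul, ← Real.exp_nat_mul]; congr 1; push_cast; ring
      have e3 : ((1 + h / L ^ 2) ^ q) ^ 2 ≤ 4 ^ q * (1 + (L ^ 2)⁻¹ ^ (2 * q) * h ^ (2 * q)) := by
        have h1 := add_pow_le zero_le_one (show 0 ≤ h / L ^ 2 by positivity) (2 * q)
        have h2 : (2 : ℝ) ^ (2 * q - 1) ≤ 4 ^ q := by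
          rw [show (4 : ℝ) = 2 ^ 2 by norm_num, ← pow_mul]
          exact pow_le_pow_right₀ one_le_two (Nat.sub_le _ _)
        rw [← pow_mul, mul_comm q 2, ← mul_pow]
        rw [one_pow, div_eq_inv_mul] at h1
        rw [div_eq_inv_mul]
        exact h1.trans (mul_le_mul_of_nonneg_right h2 (by positivity))
      rw [noiseBound, ← hs, ← hh, mul_pow, e2]
      refine le_trans ?_ (add_le_add_right e3 _)
      have p1 : 0 ≤ Real.exp (128 * s) ^ q := by positivity
      nlinarith [sq_nonneg (Real.exp (128 * s) ^ q - (1 + h / L ^ 2) ^ q),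
        sq_nonneg (Real.exp (128 * s) ^ q), sq_nonneg ((1 + h / L ^ 2) ^ q)]
    rw [Real.enorm_of_nonneg (noiseBound_nonneg ρ ε _), ← ENNReal.ofReal_pow (noiseBound_nonneg ρ ε _)]
    refine (ENNReal.ofReal_le_ofReal e1).trans ?_
    rw [ENNReal.ofReal_add (by positivity) (by positivity), ENNReal.ofReal_mul (by positivity),
      ENNReal.ofReal_add zero_le_one (by positivity), ENNReal.ofReal_mul (by positivity),
      ENNReal.ofReal_one, ENNReal.ofReal_pow h0]
    gcongr
    exact ENNReal.ofReal_toReal_le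
  have hexp := lintegral_exp_rpow_le hX hA0 (hA ε hε1) (l := 256 * q) (by positivity)
  have hgrad : ENNReal.ofReal ((L ^ 2)⁻¹ ^ (2 * q)) * ∫⁻ ω, gradEnergy ρ ε (ξ ω) ^ (2 * q) ∂μ ≤
      ENNReal.ofReal (8 * D ^ (2 * q) * (2 * (2 * q)).factorial) := by
    refine (mul_le_mul_right (hD ε hε (2 * q)) _).trans_eq ?_
    rw [← ENNReal.ofReal_mul (by positivity)]
    congr 1
    have : (L ^ 2)⁻¹ ^ (2 * q) * (L ^ 2) ^ (2 * q) = 1 := by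
      rw [← mul_pow, inv_mul_cancel₀ (by positivity), one_pow]
    rw [mul_pow D]
    linear_combination (8 * D ^ (2 * q) * ((2 * (2 * q)).factorial : ℝ)) * this
  calc _ ≤ ∫⁻ ω, (ENNReal.ofReal (Real.exp (256 * q * (supEnergy ρ ε (ξ ω)).toReal ^ (4⁻¹ : ℝ))) +
        ENNReal.ofReal (4 ^ q) *
          (1 + ENNReal.ofReal ((L ^ 2)⁻¹ ^ (2 * q)) * gradEnergy ρ ε (ξ ω) ^ (2 * q))) ∂μ :=
        lintegral_mono hpt
    _ = ∫⁻ ω, ENNReal.ofReal (Real.exp (256 * q * (supEnergy ρ ε (ξ ω)).toReal ^ (4⁻¹ : ℝ))) ∂μ +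
        ENNReal.ofReal (4 ^ q) * (1 + ENNReal.ofReal ((L ^ 2)⁻¹ ^ (2 * q)) *
          ∫⁻ ω, gradEnergy ρ ε (ξ ω) ^ (2 * q) ∂μ) := by
        rw [lintegral_add_left (((hX.ennreal_toReal.pow_const _).const_mul _).exp.ennreal_ofReal),
          lintegral_const_mul' _ _ (by finiteness), lintegral_add_left measurable_const,
          lintegral_const, measure_univ, mul_one, lintegral_const_mul _ (hG.pow_const _)]
    _ ≤ _ := by
        rw [ENNReal.ofReal_add (by positivity) (by positivity), ENNReal.ofReal_mul (by positivity),
          ENNReal.ofReal_add zero_le_one (by positivity), ENNReal.ofReal_one]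
        gcongr

end Moments

/-! ### The pathwise estimate and the conclusion. -/

/-- The a priori estimate, with deterministic bounds on the renormalization constant. -/
theorem h2Norm_le_of_isSolution_potential (ρ : Mollifier) {ε : ℝ}
    (hε : ε ∈ Set.Ioo 0 (Real.exp (-1))) (ξ : TorusDistribution) {A C T : ℝ}
    (hC : |C| ≤ A * |Real.log ε|) {v : ℝ → L2T} (hv : IsSolution (potential ρ ε ξ) C T v) {t : ℝ}
    (ht : t ∈ Set.Icc 0 T) :
    h2Norm (v t) ≤ (11 + 7 * (655360 * (2 + A ^ 2) + 1)) * noiseBound ρ ε ξ *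
      (h2Norm (v 0) + ‖v 0‖ * |Real.log ε| ^ 2) := by
  have hε1 := mem_Ioo_one hε
  have hL := one_le_abs_log hε
  set L := |Real.log ε| with hLdef
  have h := (isC1Potential_potential ρ hε1 ξ).h2Norm_le_of_isSolution (abs_potential_le ρ hε1 ξ) hv ht
  have h4 := integral_norm_gradient_pow_four_le ρ hε1 ξ
  set I := ∫ x, ‖gradient (potential ρ ε ξ) x‖ ^ 4 ∂torusMeasure
  rw [noiseBound, ← hLdef]
  set s := (supEnergy ρ ε ξ).toReal ^ (4⁻¹ : ℝ)
  set H := (gradEnergy ρ ε ξ).toReal with hH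
  have hH0 : 0 ≤ H := ENNReal.toReal_nonneg
  set e := H / L ^ 2 with he
  have he0 : 0 ≤ e := by positivity
  have hHe : H = e * L ^ 2 := by rw [he]; field_simp
  have hC2 : C ^ 2 ≤ A ^ 2 * L ^ 2 := by
    rw [← mul_pow, ← sq_abs]; gcongr
  have hL2 : 1 ≤ L ^ 2 := one_le_pow₀ hL
  have hn := norm_nonneg (v 0)
  have hh : 0 ≤ h2Norm (v 0) := Real.sqrt_nonneg _
  -- `I ≤ 2H = 2 e L²` and `C² ≤ A² L²`, so every term is a multiple of `(1 + e) L²`, including the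
  -- `+ 1` because `L ≥ 1`.
  have hbr : 655360 * (I + C ^ 2) + 1 ≤ (655360 * (2 + A ^ 2) + 1) * ((1 + e) * L ^ 2) := by
    have h1 : I + C ^ 2 ≤ (2 + A ^ 2) * ((1 + e) * L ^ 2) := by
      have : 0 ≤ A ^ 2 * (e * L ^ 2) := by positivity
      nlinarith
    have h2 : 1 ≤ (1 + e) * L ^ 2 := by nlinarith
    nlinarith
  rw [show 2 * (64 * s) = 128 * s by ring] at h
  refine h.trans ?_
  have hA : 0 ≤ 655360 * (2 + A ^ 2) + 1 := by positivity
  set a := 655360 * (2 + A ^ 2) + 1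
  calc _ ≤ Real.exp (128 * s) * (11 * ((1 + e) * h2Norm (v 0)) + 7 * (a * ((1 + e) * L ^ 2)) * ‖v 0‖) := by
        gcongr
        exact le_mul_of_one_le_left hh (by linarith)
    _ = Real.exp (128 * s) * (1 + e) * (11 * h2Norm (v 0) + 7 * a * (‖v 0‖ * L ^ 2)) := by ring
    _ ≤ Real.exp (128 * s) * (1 + e) *
        ((11 + 7 * a) * h2Norm (v 0) + (11 + 7 * a) * (‖v 0‖ * L ^ 2)) := by
        gcongr <;> linarith
    _ = _ := by ring

end TorusNoise

open TorusNoise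
theorem proposition3p3 {Ω : Type*} [MeasurableSpace Ω] (μ : Measure Ω) [IsProbabilityMeasure μ]
    (ξ : Ω → TorusDistribution) (hξ : IsWhiteNoise μ ξ) (ρ : Mollifier) :
    ∃ (c : ℝ) (K : ℝ → Ω → ℝ), 0 < c ∧
      (∀ ε ∈ Set.Ioo 0 (Real.exp (-1)), Measurable (K ε) ∧ ∀ ω, 0 ≤ K ε ω) ∧
      (∀ p : ℝ≥0, 1 ≤ p → ∃ M : ℝ≥0, ∀ ε ∈ Set.Ioo 0 (Real.exp (-1)),
        eLpNorm (K ε) (p : ℝ≥0∞) μ ≤ (M : ℝ≥0∞)) ∧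
      ∀ᵐ ω ∂μ, ∀ ε ∈ Set.Ioo 0 (Real.exp (-1)), ∀ (T : ℝ), 0 < T → ∀ v : ℝ → L2T,
        IsSolution (potential ρ ε (ξ ω)) (renormConst μ ρ ξ ε) T v →
        ∀ t ∈ Set.Icc 0 T,
          h2Norm (v t) ≤ c * K ε ω * (h2Norm (v 0) + ‖v 0‖ * |Real.log ε| ^ 2) := by
  obtain ⟨A, _, hA⟩ := exists_abs_renormConst_le hξ ρ
  -- The estimate holds for every `ω`; probability enters only through the moments of `noiseBound`
  -- and the size of `C_ε`.
  refine ⟨11 + 7 * (655360 * (2 + A ^ 2) + 1), fun ε ω => noiseBound ρ ε (ξ ω), by positivity,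
    fun ε hε => ⟨measurable_noiseBound hξ ρ (mem_Ioo_one hε), fun ω => noiseBound_nonneg ρ ε _⟩,
    fun p hp => ?_, Eventually.of_forall fun ω ε hε T _ v hv t ht =>
      h2Norm_le_of_isSolution_potential ρ hε (ξ ω) (hA ε hε) hv ht⟩
  -- On a probability space, the moment of integer order `q ≥ p` controls the one of order `p`.
  set q := ⌈p⌉₊
  have hq : q ≠ 0 := (Nat.ceil_pos.2 (one_pos.trans_le hp)).ne'
  obtain ⟨M, hM⟩ := exists_lintegral_noiseBound_pow_le hξ ρ q
  refine ⟨M.toNNReal ^ (1 / (q : ℝ)), fun ε hε => ?_⟩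
  have hpq : (p : ℝ≥0∞) ≤ (q : ℝ≥0∞) := by exact_mod_cast Nat.le_ceil p
  refine (eLpNorm_le_eLpNorm_of_exponent_le hpq
    (measurable_noiseBound hξ ρ (mem_Ioo_one hε)).aestronglyMeasurable).trans ?_
  rw [eLpNorm_eq_lintegral_rpow_enorm_toReal (by exact_mod_cast hq) (ENNReal.natCast_ne_top q),
    ENNReal.toReal_natCast, ENNReal.coe_rpow_of_nonneg _ (by positivity)]
  simp only [ENNReal.rpow_natCast]
  exact ENNReal.rpow_le_rpow (hM ε hε) (by positivity)
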